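/- **Setting.** Let $H\in(\tfrac12,1)$, $\theta>0$, and let $B^H$ be a fractional Brownian motion of Hurst index $H$ (centered Gaussian, continuous paths, covariance $\tfrac12(t^{2H}+s^{2H}-|t-s|^{2H})$). Let $U_H(t)=e^{-t/\theta}\int_0^t e^{s/\theta}\,dB^H(s)$ be the fractional Ornstein–Uhlenbeck process, $V(t)=\mathbf E|U_H(t)|^2$ and $p_H(t,\cdot)$ the density of $U_H(t)$. Let $\sigma$ be a driftless subordinator independent of $B^H$ with Lévy measure $\nu$ on $(0,\infty)$, $\int(1\wedge x)\,\nu(dx)<\infty$, $\nu(0,\infty)=\infty$, and Laplace exponent $\Psi(\lambda)=\int_0^\infty(1-e^{-\lambda x})\,\nu(dx)$, $\operatorname{Re}\lambda\ge 0$. Put $E(t)=\inf\{y>0:\sigma(y)>t\}$ and let $p_H^\Psi(t,\cdot)$ be the density of $U_H(E(t))$; the densities are taken in their versions continuous on $\mathbf R^*=\mathbf R\setminus\{0\}$. Write $\mathbf H^*=\{\operatorname{Re}\lambda>0\}$, $\mathcal L[f](\lambda)=\int_0^\infty e^{-\lambda t}f(t)\,dt$, $\overline p_H^\Psi(\lambda,x)=\mathcal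 L[p_H^\Psi(\cdot,x)](\lambda)$ and $$L u(\lambda,x)=\int_0^\infty e^{-\lambda s}V'(s)u(s,x)\,ds .$$ **The operator $\hat L$.** Fix $c_1<0<c_2$ with $c_1-c_2>-\tfrac1\theta$. For $v:\mathbf H^*\times I\to\mathbf C$, $I\subseteq\mathbf R$, and $x\in I$, let $w_v(\xi,x)$, $\xi\in\mathbf H^*$, denote the quantity $\frac{\Psi^{-1}(\xi)}{\xi}\,v(\Psi^{-1}(\xi),x)$, in the following sense: $w_v(\cdot,x)$ is holomorphic in $\mathbf H^*$, and for every $\xi\in\mathbf H^*$ and every holomorphic local inverse $g$ of $\Psi$ at $\xi$ with $g(\xi)\in\mathbf H^*$ one has $w_v(\xi,x)=\frac{g(\xi)}{\xi}v(g(\xi),x)$, independently of the choice of $g$. (At the points of $\mathbf H^*$ where $\Psi$ has no such local inverse, $w_v$ is defined by holomorphic continuation; there is at most one such $w_v(\cdot,x)$.) Then $v\in\mathcal D(\hat L,I)$ if for every $x\in I$ the function $w_v(\cdot,x)$ exists and for all $\lambda\in\mathbf H^*$ all the integrals (absolutely convergent) and the limit (for every $t>0$) in $$\hat Lv(\lambda,x)=\frac1{4\pi^2}\int_0^\infty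 e^{-\Psi(\lambda)t}\lim_{R\to\infty}\int_{-\infty}^\infty e^{(c_1+is)t}\int_{-R}^{R}\mathcal L[V'](c_1-c_2+i(s-z))\,w_v(c_2+iz,x)\,dz\,ds\,dt$$ exist. **Lemma.** The integral defining $\overline p_H^\Psi(\lambda,x)$ converges absolutely for $\lambda\in\mathbf H^*$, $x\in\mathbf R^*$; $\overline p_H^\Psi\in\mathcal D(\hat L,\mathbf R^*)$; and for all $\lambda\in\mathbf H^*$ and $x\in\mathbf R^*$ the integral $Lp_H(\Psi(\lambda),x)$ converges absolutely and $$\hat L\,\overline p_H^\Psi(\lambda,x)=Lp_H(\Psi(\lambda),x).$$ -/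

import Mathlib

open MeasureTheory ProbabilityTheory Filter Topology Set
open scoped NNReal ENNReal

namespace TimeChangedFOU

noncomputable section

/-- The open right half-plane `𝐇* = {l : Re l > 0}`. -/
def rightHalfPlane : Set ℂ := {l | 0 < l.re}

/-! ### The fractional Ornstein-Uhlenbeck process -/

/-- Fractional Brownian motion with Hurst index `H`: a centered Gaussian process with covariance
`(t^(2H) + s^(2H) - |t - s|^(2H)) / 2` and almost surely continuous paths. -/
structure IsFractionalBrownianMotion {Ω : Type*} [MeasurableSpace Ω] (H : ℝ)
    (B : ℝ≥0 → Ω → ℝ) (P : Measure Ω) : Prop where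
  measurable : ∀ t, Measurable (B t)
  gaussian : IsGaussianProcess B P
  mean : ∀ t, ∫ ω, B t ω ∂P = 0
  cov : ∀ s t : ℝ≥0, ∫ ω, B t ω * B s ω ∂P
    = 1 / 2 * ((t : ℝ) ^ (2 * H) + (s : ℝ) ^ (2 * H) - |(t : ℝ) - (s : ℝ)| ^ (2 * H))
  continuous : ∀ᵐ ω ∂P, Continuous fun t => B t ω

/-- The pathwise Riemann-Stieltjes integral `∫₀ᵗ e^(s/θ) dB(s)` along a continuous path,
written through integration by parts as
`e^(t/θ) B(t) - B(0) - ∫₀ᵗ B(s) d(e^(s/θ))`. -/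
def expIntegral {Ω : Type*} (θ : ℝ) (B : ℝ≥0 → Ω → ℝ) (t : ℝ≥0) (ω : Ω) : ℝ :=
  Real.exp (t / θ) * B t ω - B 0 ω
    - ∫ s in (0 : ℝ)..t, (1 / θ) * Real.exp (s / θ) * B s.toNNReal ω

/-- The fractional Ornstein-Uhlenbeck process `U(t) = e^(-t/θ) ∫₀ᵗ e^(s/θ) dB(s)`. -/
def fOU {Ω : Type*} (θ : ℝ) (B : ℝ≥0 → Ω → ℝ) (t : ℝ≥0) (ω : Ω) : ℝ :=
  Real.exp (-(t / θ)) * expIntegral θ B t ω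

/-- The variance function `V(t) = E |U(t)|²` of the process `U`, for `t ≥ 0`. -/
def varianceFun {Ω : Type*} [MeasurableSpace Ω] (P : Measure Ω) (U : ℝ≥0 → Ω → ℝ) (t : ℝ) : ℝ :=
  ∫ ω, |U t.toNNReal ω| ^ 2 ∂P

/-- The density at `x` of a law `μ` on the line, as the limit of `μ [x - r, x + r] / (2 r)` as
`r ↓ 0`. For an absolutely continuous law this is a version of the Radon-Nikodym derivative, and
it is the continuous version on any open set on which there is one. -/
def densityAt (μ : Measure ℝ) (x : ℝ) : ℝ :=
  limUnder (𝓝[>] (0 : ℝ)) fun r => μ.real (Metric.closedBall x r) / (2 * r)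

/-- The probability density `p(t, x)` at `x` of the value at time `t` of a process. -/
def processDensity {Ω : Type*} [MeasurableSpace Ω] (P : Measure Ω) (U : ℝ≥0 → Ω → ℝ)
    (t x : ℝ) : ℝ :=
  densityAt (P.map (U t.toNNReal)) x

/-! ### Subordinators and their inverses -/

/-- Lévy measure of a driftless subordinator: carried by `(0, ∞)`, with `∫ min(1, x) ν(dx) < ∞`. -/
structure IsSubordinatorLevyMeasure (ν : Measure ℝ) : Prop where
  nonpos : ν (Iic 0) = 0
  integrable : ∫⁻ x, ENNReal.ofReal (min 1 x) ∂ν < ∞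

/-- The Laplace exponent `Ψ(l) = ∫ (1 - e^(-l x)) ν(dx)`, for `Re l ≥ 0`. -/
def laplaceExponent (ν : Measure ℝ) (l : ℂ) : ℂ :=
  ∫ x, (1 - Complex.exp (-(l * x))) ∂ν

/-- A driftless subordinator with Lévy measure `ν`. -/
structure IsSubordinator {Ω : Type*} [MeasurableSpace Ω] (ν : Measure ℝ)
    (σ : ℝ≥0 → Ω → ℝ) (P : Measure Ω) : Prop where
  measurable : ∀ y, Measurable (σ y)
  zero : ∀ᵐ ω ∂P, σ 0 ω = 0
  monotone : ∀ᵐ ω ∂P, Monotone fun y => σ y ω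
  rightContinuous : ∀ᵐ ω ∂P, ∀ y, ContinuousWithinAt (fun z => σ z ω) (Ici y) y
  indepIncrements : HasIndepIncrements σ P
  stationaryIncrements : ∀ y z : ℝ≥0,
    IdentDistrib (fun ω => σ (y + z) ω - σ y ω) (σ z) P P
  laplace : ∀ (y : ℝ≥0) (l : ℝ), 0 < l →
    ∫ ω, Real.exp (-(l * σ y ω)) ∂P
      = Real.exp (-(y * ∫ x, (1 - Real.exp (-(l * x))) ∂ν))

/-- The inverse subordinator `E(t) = inf {y > 0 : σ(y) > t}`. -/
def inverseSubordinator {Ω : Type*} (σ : ℝ≥0 → Ω → ℝ) (t : ℝ≥0) (ω : Ω) : ℝ≥0 :=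
  sInf {y : ℝ≥0 | 0 < y ∧ (t : ℝ) < σ y ω}

/-- The time-changed process `t ↦ U(E(t))`. -/
def timeChange {Ω : Type*} (U : ℝ≥0 → Ω → ℝ) (E : ℝ≥0 → Ω → ℝ≥0) (t : ℝ≥0) (ω : Ω) : ℝ :=
  U (E t ω) ω

/-! ### The Laplace transform and the operator `L` -/

/-- The integrand `e^(-l t) f(t)` of the Laplace transform. -/
def laplaceIntegrand (f : ℝ → ℝ) (l : ℂ) (t : ℝ) : ℂ :=
  Complex.exp (-(l * t)) * (f t : ℂ)

/-- The Laplace transform `∫₀^∞ e^(-l t) f(t) dt`. -/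
def laplaceTransform (f : ℝ → ℝ) (l : ℂ) : ℂ :=
  ∫ t in Ioi (0 : ℝ), laplaceIntegrand f l t

/-- The operator `L(u)(l, x) = ∫₀^∞ e^(-l s) V'(s) u(s, x) ds`. -/
def opL (V : ℝ → ℝ) (u : ℝ → ℝ → ℝ) (l : ℂ) (x : ℝ) : ℂ :=
  laplaceTransform (fun s => deriv V s * u s x) l

/-- `L(u)(l, x)` is well defined. -/
def OpLDefinedAt (V : ℝ → ℝ) (u : ℝ → ℝ → ℝ) (l : ℂ) (x : ℝ) : Prop :=
  IntegrableOn (laplaceIntegrand (fun s => deriv V s * u s x) l) (Ioi 0)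

/-! ### The operator `L̂` -/

/-- `g` is a holomorphic local inverse of `Ψ` at the point `ξ`, with values in `𝐇*`. -/
def IsLocalInverse (Ψ : ℂ → ℂ) (g : ℂ → ℂ) (ξ : ℂ) : Prop :=
  AnalyticAt ℂ g ξ ∧ g ξ ∈ rightHalfPlane ∧ ∀ᶠ η in 𝓝 ξ, Ψ (g η) = η

/-- `w` is the function `ξ ↦ (Ψ⁻¹(ξ) / ξ) f(Ψ⁻¹(ξ))` on `𝐇*`: at every point of `𝐇*` where `Ψ` has
local inverses it is given by this formula, whichever local inverse is used, and at the other points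
(critical values of `Ψ`, and points outside the range `Ψ(𝐇*)`, which is in general a proper subset
of `𝐇*`) it is given by holomorphic continuation. By the identity theorem there is at most one such
`w` on `𝐇*` if `Ψ` is holomorphic and not constant there. -/
def IsInverseTransport (Ψ : ℂ → ℂ) (f w : ℂ → ℂ) : Prop :=
  DifferentiableOn ℂ w rightHalfPlane ∧
    ∀ ξ ∈ rightHalfPlane, ∀ g : ℂ → ℂ, IsLocalInverse Ψ g ξ → w ξ = g ξ / ξ * f (g ξ)

open Classical in
/-- The function `ξ ↦ (Ψ⁻¹(ξ) / ξ) f(Ψ⁻¹(ξ))` on `𝐇*`, if it exists. -/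
def inverseTransport (Ψ : ℂ → ℂ) (f : ℂ → ℂ) : ℂ → ℂ :=
  if h : ∃ w, IsInverseTransport Ψ f w then h.choose else 0

/-- The integrand `𝓛[V'](c₁ - c₂ + i (s - z)) w(c₂ + i z)` of the innermost integral. -/
def hatLInnerIntegrand (V : ℝ → ℝ) (c₁ c₂ : ℝ) (w : ℂ → ℂ) (s z : ℝ) : ℂ :=
  laplaceTransform (deriv V) (c₁ - c₂ + Complex.I * (s - z)) * w (c₂ + Complex.I * z)

/-- The integrand in `s` over the real line, at time `t` and with truncation level `R`. -/
def hatLMiddleIntegrand (V : ℝ → ℝ) (c₁ c₂ : ℝ) (w : ℂ → ℂ) (t R s : ℝ) : ℂ :=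
  Complex.exp ((c₁ + Complex.I * s) * t) * ∫ z in (-R)..R, hatLInnerIntegrand V c₁ c₂ w s z

/-- The integral over the real line, whose limit is taken as `R → ∞`. -/
def hatLTruncated (V : ℝ → ℝ) (c₁ c₂ : ℝ) (w : ℂ → ℂ) (t R : ℝ) : ℂ :=
  ∫ s : ℝ, hatLMiddleIntegrand V c₁ c₂ w t R s

/-- The integrand in `t` of the outermost integral. -/
def hatLOuterIntegrand (V : ℝ → ℝ) (Ψ : ℂ → ℂ) (c₁ c₂ : ℝ) (w : ℂ → ℂ) (l : ℂ) (t : ℝ) : ℂ :=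
  Complex.exp (-(Ψ l * t)) * limUnder atTop fun R : ℝ => hatLTruncated V c₁ c₂ w t R

/-- The operator
`L̂v(l, x) = (1 / 4π²) ∫₀^∞ e^(-Ψ(l) t) lim_{R → ∞} ∫_ℝ e^((c₁ + i s) t)
  ∫_{-R}^{R} 𝓛[V'](c₁ - c₂ + i (s - z)) (Ψ⁻¹(c₂ + i z) / (c₂ + i z)) v(Ψ⁻¹(c₂ + i z), x) dz ds dt`. -/
def opHatL (V : ℝ → ℝ) (Ψ : ℂ → ℂ) (c₁ c₂ : ℝ) (v : ℂ → ℝ → ℂ) (l : ℂ) (x : ℝ) : ℂ :=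
  1 / (4 * (Real.pi : ℂ) ^ 2) *
    ∫ t in Ioi (0 : ℝ), hatLOuterIntegrand V Ψ c₁ c₂ (inverseTransport Ψ fun ζ => v ζ x) l t

/-- All integrals and limits in the definition of `L̂` at `l` make sense. -/
structure HatLWellDefined (V : ℝ → ℝ) (Ψ : ℂ → ℂ) (c₁ c₂ : ℝ) (w : ℂ → ℂ) (l : ℂ) : Prop where
  inner : ∀ R s : ℝ, 0 < R →
    IntervalIntegrable (hatLInnerIntegrand V c₁ c₂ w s) volume (-R) R
  middle : ∀ t R : ℝ, 0 < t → 0 < R → Integrable (hatLMiddleIntegrand V c₁ c₂ w t R)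
  limit : ∀ t : ℝ, 0 < t → ∃ a : ℂ, Tendsto (fun R : ℝ => hatLTruncated V c₁ c₂ w t R) atTop (𝓝 a)
  outer : IntegrableOn (hatLOuterIntegrand V Ψ c₁ c₂ w l) (Ioi 0)

/-- The domain `𝓓(L̂, I)`. -/
def MemDomainHatL (V : ℝ → ℝ) (Ψ : ℂ → ℂ) (c₁ c₂ : ℝ) (v : ℂ → ℝ → ℂ) (I : Set ℝ) : Prop :=
  ∀ x ∈ I, (∃ w, IsInverseTransport Ψ (fun ζ => v ζ x) w) ∧
    ∀ l ∈ rightHalfPlane,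
      HatLWellDefined V Ψ c₁ c₂ (inverseTransport Ψ fun ζ => v ζ x) l

end

end TimeChangedFOU

/-! Write a = 1/θ, h = 2H, D = V' and, for fixed x ≠ 0, f(t) = p_H(t, x); hats denote Laplace
transforms in time. The heart of the matter is p̄(l, x) = (Ψ(l)/l) f̂(Ψ(l))
(`laplaceTransform_integral_fouDensity`). The process U is Gaussian with variance V and independent
of E, so away from the origin the density of U(E(t)) is the expectation of f(E(t)). Since f vanishes
at 0, f(E(t)) is the integral of f' over 0 < s < E(t). For almost every t the event s < E(t) is σ(s)
< t, so Laplace transform in t and expectation turn its indicator into e^(-sΨ(l))/l. Fubini and one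
integration by parts finish.

Hence for v = p̄ the transported function w_v is simply f̂, holomorphic on the whole half-plane even
where Ψ has no local inverse, and the identity theorem shows that it is the only candidate
(`IsInverseTransport.eqOn`). What remains concerns D and f alone
(`hatLWellDefined_and_integral_eq`): the integrals in z and s form a convolution of D̂ with f̂ along
vertical lines. Fubini, a translation, and Laplace inversion of D and then of f give 4π² D(t) f(t),
and the outer integral is the Laplace transform of D f at Ψ(l), a point of the right half-plane.

The analytic input is the absolute integrability of D̂ and f̂ on vertical lines. The variance is
computed explicitly from the covariance (`variance_integral_eq_fouVar`); D solves a first-order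
linear equation, so D̂ is explicit and decays like |l|^(-h) with h > 1
(`integrable_laplaceTransform_fouVarDeriv`). As x ≠ 0, the factor e^(-x²/(2V)) kills every negative
power of V. So f and f' vanish at 0+, the Laplace integral of f'' converges absolutely, and f̂ is
O(|l|^(-2)) on each line to the right of 0 (`integrable_laplaceTransform_fouDensity`). -/

namespace TimeChangedFOU

/-! ### The Laplace transform -/

/-- The Laplace integral of `f` converges absolutely on the line `Re l = c`. -/
def LaplaceIntegrable (f : ℝ → ℝ) (c : ℝ) : Prop :=
  IntegrableOn (fun t => Real.exp (-(c * t)) * f t) (Ioi 0)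

lemma norm_laplaceIntegrand (f : ℝ → ℝ) (l : ℂ) (t : ℝ) :
    ‖laplaceIntegrand f l t‖ = ‖Real.exp (-(l.re * t)) * f t‖ := by
  simp [laplaceIntegrand, Complex.norm_exp]

lemma laplaceIntegrand_eq (f : ℝ → ℝ) (l : ℂ) (t : ℝ) :
    laplaceIntegrand f l t
      = Complex.exp (-(l.im * t) * Complex.I) * ((Real.exp (-(l.re * t)) * f t : ℝ) : ℂ) := by
  simp only [laplaceIntegrand, Complex.ofReal_mul, Complex.ofReal_exp, ← mul_assoc,
    ← Complex.exp_add]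
  congr 2
  nth_rewrite 1 [← Complex.re_add_im l]
  push_cast
  ring

lemma LaplaceIntegrable.aestronglyMeasurable {f : ℝ → ℝ} {c : ℝ} (hf : LaplaceIntegrable f c) :
    AEStronglyMeasurable f (volume.restrict (Ioi 0)) := by
  have h : AEStronglyMeasurable
      (fun t => Real.exp (c * t) * (Real.exp (-(c * t)) * f t)) (volume.restrict (Ioi 0)) :=
    (Continuous.aestronglyMeasurable (by fun_prop)).mul
      (Integrable.aestronglyMeasurable hf)
  refine h.congr (Eventually.of_forall fun t => ?_)
  simp only [← mul_assoc, ← Real.exp_add]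
  simp

lemma aestronglyMeasurable_laplaceIntegrand {f : ℝ → ℝ}
    (hf : AEStronglyMeasurable f (volume.restrict (Ioi 0))) (l : ℂ) :
    AEStronglyMeasurable (laplaceIntegrand f l) (volume.restrict (Ioi 0)) := by
  unfold laplaceIntegrand
  exact (Continuous.aestronglyMeasurable (by fun_prop)).mul
    (Complex.continuous_ofReal.comp_aestronglyMeasurable hf)

lemma LaplaceIntegrable.integrableOn {f : ℝ → ℝ} {l : ℂ} (hf : LaplaceIntegrable f l.re) :
    IntegrableOn (laplaceIntegrand f l) (Ioi 0) :=
  Integrable.mono hf (aestronglyMeasurable_laplaceIntegrand hf.aestronglyMeasurable l)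
    (Eventually.of_forall fun t => (norm_laplaceIntegrand f l t).le)

lemma LaplaceIntegrable.mono {f : ℝ → ℝ} {c c' : ℝ} (hf : LaplaceIntegrable f c) (h : c ≤ c') :
    LaplaceIntegrable f c' := by
  refine Integrable.mono hf ((Continuous.aestronglyMeasurable (by fun_prop)).mul
    hf.aestronglyMeasurable) ?_
  filter_upwards [ae_restrict_mem measurableSet_Ioi] with t ht
  simp only [norm_mul, Real.norm_eq_abs, Real.abs_exp]
  gcongr
  exact le_of_lt ht

lemma norm_laplaceTransform_le (f : ℝ → ℝ) (l : ℂ) :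
    ‖laplaceTransform f l‖ ≤ ∫ t in Ioi (0 : ℝ), ‖Real.exp (-(l.re * t)) * f t‖ := by
  refine (norm_integral_le_integral_norm _).trans_eq ?_
  simp only [norm_laplaceIntegrand]

lemma LaplaceIntegrable.of_bounded {f : ℝ → ℝ} {c C : ℝ} (hc : 0 < c)
    (hm : AEStronglyMeasurable f (volume.restrict (Ioi 0))) (hf : ∀ t ∈ Ioi (0 : ℝ), |f t| ≤ C) :
    LaplaceIntegrable f c := by
  refine Integrable.mono' ((integrableOn_exp_mul_Ioi (a := -c) (by linarith) 0).mul_const C)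
    ((Continuous.aestronglyMeasurable (by fun_prop)).mul hm) ?_
  filter_upwards [ae_restrict_mem measurableSet_Ioi] with t ht
  simp only [norm_mul, Real.norm_eq_abs, Real.abs_exp, neg_mul]
  gcongr
  exact hf t ht

lemma mul_exp_neg_le {b : ℝ} (hb : 0 < b) (t : ℝ) : t * Real.exp (-(b * t)) ≤ 1 / b := by
  have h1 : b * t ≤ Real.exp (b * t) := by linarith [Real.add_one_le_exp (b * t)]
  rw [le_div_iff₀ hb]
  calc t * Real.exp (-(b * t)) * b = b * t * Real.exp (-(b * t)) := by ring
    _ ≤ Real.exp (b * t) * Real.exp (-(b * t)) := by gcongr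
    _ = 1 := by rw [← Real.exp_add]; simp

lemma differentiableAt_laplaceTransform {f : ℝ → ℝ} {c : ℝ} (hf : LaplaceIntegrable f c) {l : ℂ}
    (hl : c < l.re) : DifferentiableAt ℂ (laplaceTransform f) l := by
  -- Half of the gap between c and Re l defines a neighbourhood of l; the other half absorbs the
  -- factor t that differentiation brings down.
  set b := (l.re - c) / 2 with hb
  have hb0 : 0 < b := by linarith
  have hm := hf.aestronglyMeasurable
  have hs : {z : ℂ | c + b < z.re} ∈ 𝓝 l :=
    (isOpen_lt continuous_const Complex.continuous_re).mem_nhds (by simp; linarith)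
  refine (hasDerivAt_integral_of_dominated_loc_of_deriv_le (𝕜 := ℂ)
    (F := fun z t => laplaceIntegrand f z t)
    (F' := fun z t => -t * laplaceIntegrand f z t)
    (bound := fun t => 1 / b * ‖Real.exp (-(c * t)) * f t‖) hs
    (Eventually.of_forall fun z => aestronglyMeasurable_laplaceIntegrand hm z)
    (hf.mono hl.le).integrableOn
    ((Continuous.aestronglyMeasurable (by fun_prop)).mul
      (aestronglyMeasurable_laplaceIntegrand hm l)) ?_ (hf.norm.const_mul _) ?_).2.differentiableAt
  · filter_upwards [ae_restrict_mem measurableSet_Ioi] with t ht z hz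
    have ht : 0 < t := ht
    rw [norm_mul, norm_laplaceIntegrand, norm_mul, norm_mul, ← mul_assoc, ← mul_assoc]
    refine mul_le_mul_of_nonneg_right ?_ (norm_nonneg _)
    simp only [norm_neg, Complex.norm_real, Real.norm_eq_abs, Real.abs_exp, abs_of_pos ht]
    calc t * Real.exp (-(z.re * t)) ≤ t * Real.exp (-((c + b) * t)) := by
          gcongr
      _ = t * Real.exp (-(b * t)) * Real.exp (-(c * t)) := by
          rw [mul_assoc, ← Real.exp_add]; congr 2; ring
      _ ≤ _ := by gcongr; exact mul_exp_neg_le hb0 t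
  · refine Eventually.of_forall fun t z _ => ?_
    unfold laplaceIntegrand
    refine ((((hasDerivAt_id' z).mul_const (t : ℂ)).fun_neg.cexp).mul_const
      (f t : ℂ)).congr_deriv ?_
    ring

lemma differentiableOn_laplaceTransform {f : ℝ → ℝ} (hf : ∀ c, 0 < c → LaplaceIntegrable f c) :
    DifferentiableOn ℂ (laplaceTransform f) rightHalfPlane := fun l hl =>
  (differentiableAt_laplaceTransform (hf (l.re / 2) (half_pos hl))
    (half_lt_self hl)).differentiableWithinAt

/-- The Laplace transform of a derivative. -/
lemma laplaceTransform_deriv {f f' : ℝ → ℝ} {l : ℂ}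
    (hderiv : ∀ t ∈ Ioi (0 : ℝ), HasDerivAt f (f' t) t) (h0 : Tendsto f (𝓝[>] 0) (𝓝 0))
    (hf : LaplaceIntegrable f l.re) (hf' : LaplaceIntegrable f' l.re) :
    laplaceTransform f' l = l * laplaceTransform f l := by
  have hu : ∀ t ∈ Ioi (0 : ℝ), HasDerivAt (fun t : ℝ => Complex.exp (-(l * t)))
      (-l * Complex.exp (-(l * t))) t := fun t _ => by
    have := (((hasDerivAt_id' t).ofReal_comp.const_mul l).fun_neg).cexp
    convert this using 1
    simp; ring
  have hv : ∀ t ∈ Ioi (0 : ℝ), HasDerivAt (fun t : ℝ => (f t : ℂ)) (f' t : ℂ) t :=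
    fun t ht => (hderiv t ht).ofReal_comp
  have hi := hf.integrableOn
  have hi' := hf'.integrableOn
  have hj : IntegrableOn (fun t : ℝ => -l * Complex.exp (-(l * t)) * (f t : ℂ)) (Ioi 0) := by
    refine (hi.const_mul (-l)).congr (Eventually.of_forall fun t => ?_)
    simp [laplaceIntegrand]; ring
  have hz : Tendsto ((fun t : ℝ => Complex.exp (-(l * t))) * fun t => (f t : ℂ)) (𝓝[>] 0)
      (𝓝 0) := by
    have h1 : Tendsto (fun t : ℝ => Complex.exp (-(l * t))) (𝓝[>] 0)
        (𝓝 (Complex.exp (-(l * (0 : ℝ))))) :=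
      (Continuous.tendsto (by fun_prop) _).mono_left nhdsWithin_le_nhds
    have h2 := h1.mul ((Complex.continuous_ofReal.tendsto 0).comp h0)
    rwa [Complex.ofReal_zero, mul_zero] at h2
  -- Decay at infinity need not be assumed: a function which is integrable together with its
  -- derivative tends to zero.
  have hinf : Tendsto ((fun t : ℝ => Complex.exp (-(l * t))) * fun t => (f t : ℂ)) atTop
      (𝓝 0) := by
    refine tendsto_zero_of_hasDerivAt_of_integrableOn_Ioi
      (fun t ht => (hu t ht).mul (hv t ht)) (hj.add hi') hi
  have := integral_Ioi_mul_deriv_eq_deriv_mul hu hv hi' hj hz hinf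
  unfold laplaceTransform
  rw [← integral_const_mul]
  calc _ = ∫ t in Ioi (0 : ℝ), Complex.exp (-(l * t)) * (f' t : ℂ) := rfl
    _ = _ := by
      rw [this, sub_zero, zero_sub, ← integral_neg]
      congr 1
      ext t
      simp [laplaceIntegrand]; ring

/-- Damping by e^(-ct) and extending by zero to the left turns a Laplace transform on a vertical
line into a Fourier transform; the 2π comes from the normalisation of the latter. Inversion on the
line is thereby reduced to Fourier inversion. -/
lemma laplaceTransform_eq_fourier (f : ℝ → ℝ) (c z : ℝ) :
    laplaceTransform f (c + Complex.I * z)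
      = FourierTransform.fourier
        ((Ioi (0 : ℝ)).indicator fun t => ((Real.exp (-(c * t)) * f t : ℝ) : ℂ))
        (z / (2 * Real.pi)) := by
  rw [Real.fourier_eq', laplaceTransform, ← integral_indicator measurableSet_Ioi]
  congr 1
  ext t
  by_cases ht : t ∈ Ioi (0 : ℝ)
  · have hpi : (Real.pi : ℂ) ≠ 0 := by exact_mod_cast Real.pi_ne_zero
    simp only [ht, indicator_of_mem, smul_eq_mul]
    rw [laplaceIntegrand_eq]
    simp
    left
    field_simp
  · simp [ht]

/-- Laplace inversion along a vertical line. -/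
lemma integral_exp_mul_laplaceTransform {f : ℝ → ℝ} {c t : ℝ} (hf : LaplaceIntegrable f c)
    (hi : Integrable fun z : ℝ => laplaceTransform f (c + Complex.I * z)) (ht : 0 < t)
    (hc : ContinuousAt f t) :
    ∫ z : ℝ, Complex.exp ((c + Complex.I * z) * t) * laplaceTransform f (c + Complex.I * z)
      = 2 * Real.pi * f t := by
  set g : ℝ → ℂ := (Ioi (0 : ℝ)).indicator fun t => ((Real.exp (-(c * t)) * f t : ℝ) : ℂ) with hg
  have hgi : Integrable g := (integrable_indicator_iff measurableSet_Ioi).2 hf.ofReal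
  have hpi : 2 * Real.pi ≠ 0 := by positivity
  have hFi : Integrable (FourierTransform.fourier g) := by
    have := hi.comp_mul_right' hpi
    simp only [laplaceTransform_eq_fourier] at this
    simpa only [mul_div_assoc, div_self hpi, mul_one] using this
  have hgt : g =ᶠ[𝓝 t] fun t => ((Real.exp (-(c * t)) * f t : ℝ) : ℂ) := by
    filter_upwards [Ioi_mem_nhds ht] with s hs
    simp [hg, mem_Ioi.1 hs]
  have hgc : ContinuousAt g t := by
    refine ContinuousAt.congr ?_ hgt.symm
    exact Complex.continuous_ofReal.continuousAt.comp
      (ContinuousAt.mul (Continuous.continuousAt (by fun_prop)) hc)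
  have key := hgi.fourierInv_fourier_eq hFi hgc
  rw [Real.fourierInv_eq', hgt.eq_of_nhds] at key
  have h2 : ∫ z : ℝ, Complex.exp ((c + Complex.I * z) * t)
        * laplaceTransform f (c + Complex.I * z)
      = Complex.exp (c * t) * ∫ z : ℝ, (fun v : ℝ =>
        Complex.exp (↑(2 * Real.pi * inner ℝ v t) * Complex.I) • FourierTransform.fourier g v)
          (z / (2 * Real.pi)) := by
    rw [← integral_const_mul]
    congr 1
    ext z
    have hpi : (Real.pi : ℂ) ≠ 0 := by exact_mod_cast Real.pi_ne_zero
    dsimp only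
    rw [laplaceTransform_eq_fourier, smul_eq_mul, ← mul_assoc, ← Complex.exp_add]
    congr 2
    simp
    field_simp
  rw [h2, Measure.integral_comp_div (fun v : ℝ =>
    Complex.exp (↑(2 * Real.pi * inner ℝ v t) * Complex.I) • FourierTransform.fourier g v), key, abs_of_pos (by positivity)]
  simp only [Complex.real_smul]
  push_cast
  rw [mul_left_comm, ← mul_assoc (Complex.exp _), ← Complex.exp_add]
  simp

/-! ### Uniqueness of holomorphic functions on the right half-plane -/

lemma isOpen_rightHalfPlane : IsOpen rightHalfPlane :=
  isOpen_lt continuous_const Complex.continuous_re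

lemma isPreconnected_rightHalfPlane : IsPreconnected rightHalfPlane :=
  (convex_halfSpace_re_gt 0).isPreconnected

/-- The positive reals accumulate at the interior point 1, so the identity theorem applies. Real
formulas, for Gamma integrals and for subordinators, are carried to complex arguments this way. -/
lemma eqOn_rightHalfPlane_of_ofReal {f g : ℂ → ℂ} (hf : DifferentiableOn ℂ f rightHalfPlane)
    (hg : DifferentiableOn ℂ g rightHalfPlane) (h : ∀ r : ℝ, 0 < r → f r = g r) :
    EqOn f g rightHalfPlane := by
  refine AnalyticOnNhd.eqOn_of_preconnected_of_frequently_eq (z₀ := 1)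
    (hf.analyticOnNhd isOpen_rightHalfPlane) (hg.analyticOnNhd isOpen_rightHalfPlane)
    isPreconnected_rightHalfPlane (by simp [rightHalfPlane]) ?_
  have ht : Tendsto (fun r : ℝ => (r : ℂ)) (𝓝[≠] 1) (𝓝[≠] 1) := by
    refine tendsto_nhdsWithin_iff.2 ⟨?_, ?_⟩
    · exact (Complex.continuous_ofReal.tendsto' 1 1 (by simp)).mono_left nhdsWithin_le_nhds
    · filter_upwards [self_mem_nhdsWithin] with r hr
      simpa using hr
  refine ht.frequently (Eventually.frequently ?_)
  filter_upwards [mem_nhdsWithin_of_mem_nhds (Ioi_mem_nhds zero_lt_one)] with r hr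
  exact h r hr

lemma laplaceIntegrable_rpow {s c : ℝ} (hs : 0 < s) (hc : 0 < c) :
    LaplaceIntegrable (fun t => t ^ (s - 1)) c := by
  have := integrableOn_rpow_mul_exp_neg_mul_rpow (s := s - 1) (p := 1) (b := c) (by linarith)
    one_pos hc
  refine (integrableOn_congr_fun (fun t _ => ?_) measurableSet_Ioi).1 this
  simp [mul_comm]

lemma laplaceTransform_rpow {s : ℝ} (hs : 0 < s) {l : ℂ} (hl : l ∈ rightHalfPlane) :
    laplaceTransform (fun t => t ^ (s - 1)) l = Real.Gamma s * l ^ (-s : ℂ) := by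
  refine eqOn_rightHalfPlane_of_ofReal (g := fun l => Real.Gamma s * l ^ (-s : ℂ))
    (differentiableOn_laplaceTransform fun c hc => laplaceIntegrable_rpow hs hc) ?_
    (fun r hr => ?_) hl
  · intro z hz
    refine ((differentiableAt_id.cpow_const (Or.inl hz)).const_mul _).differentiableWithinAt
  · have := Real.integral_rpow_mul_exp_neg_mul_Ioi hs hr
    have h2 : laplaceTransform (fun t => t ^ (s - 1)) r
        = ((∫ t in Ioi (0 : ℝ), t ^ (s - 1) * Real.exp (-(r * t)) : ℝ) : ℂ) := by
      rw [laplaceTransform, ← integral_complex_ofReal]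
      congr 1
      ext t
      simp [laplaceIntegrand, mul_comm]
    rw [h2, this, one_div, Real.inv_rpow hr.le, ← Real.rpow_neg hr.le]
    push_cast [Complex.ofReal_cpow hr.le]
    ring

/-! ### The Laplace exponent -/

lemma norm_one_sub_exp_neg_le_two {z : ℂ} (hz : 0 ≤ z.re) : ‖1 - Complex.exp (-z)‖ ≤ 2 := by
  refine (norm_sub_le _ _).trans ?_
  have : ‖Complex.exp (-z)‖ ≤ 1 := by
    rw [Complex.norm_exp]
    simpa using hz
  rw [norm_one]
  linarith

lemma norm_one_sub_exp_neg_le {z : ℂ} (hz : 0 ≤ z.re) : ‖1 - Complex.exp (-z)‖ ≤ 2 * ‖z‖ := by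
  rcases le_total ‖z‖ 1 with h | h
  · rw [norm_sub_rev, ← norm_neg z]
    exact Complex.norm_exp_sub_one_le (by rwa [norm_neg])
  · exact (norm_one_sub_exp_neg_le_two hz).trans (by linarith)

namespace IsSubordinatorLevyMeasure

variable {ν : Measure ℝ}

lemma ae_pos (hν : IsSubordinatorLevyMeasure ν) : ∀ᵐ x ∂ν, 0 < x := by
  rw [ae_iff]
  convert hν.nonpos using 2
  ext x
  simp

lemma integrable_min (hν : IsSubordinatorLevyMeasure ν) : Integrable (fun x => min 1 x) ν := by
  refine ⟨Measurable.aestronglyMeasurable (by fun_prop), ?_⟩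
  rw [hasFiniteIntegral_iff_ofReal]
  · exact hν.integrable
  · filter_upwards [hν.ae_pos] with x hx
    simpa using hx.le

/-- The bounds 2 and 2‖l‖x combine to a multiple of min(1, x), which is exactly what a Lévy measure
integrates. -/
lemma integrable_one_sub_exp (hν : IsSubordinatorLevyMeasure ν) {l : ℂ}
    (hl : l ∈ rightHalfPlane) : Integrable (fun x : ℝ => 1 - Complex.exp (-(l * x))) ν := by
  have hl : 0 < l.re := hl
  refine Integrable.mono' (hν.integrable_min.const_mul (2 * (1 + ‖l‖)))
    (Continuous.aestronglyMeasurable (by fun_prop)) ?_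
  filter_upwards [hν.ae_pos] with x hx
  have h0 : 0 ≤ (l * x).re := by simp; positivity
  have h1 := norm_one_sub_exp_neg_le_two h0
  have h2 := norm_one_sub_exp_neg_le h0
  rw [norm_mul, Complex.norm_real, Real.norm_eq_abs, abs_of_pos hx] at h2
  have := norm_nonneg l
  rcases min_cases 1 x with ⟨h, _⟩ | ⟨h, _⟩ <;> rw [h] <;> nlinarith

/-- For x > 0 the real part of e^(-lx) is at most e^(-x Re l) < 1, so a positive function is
integrated against a nonzero measure. This places Ψ(l) where the Laplace transforms of the density
converge. -/
lemma re_laplaceExponent_pos (hν : IsSubordinatorLevyMeasure ν) (hν0 : ν (Ioi 0) ≠ 0) {l : ℂ}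
    (hl : l ∈ rightHalfPlane) : laplaceExponent ν l ∈ rightHalfPlane := by
  have hl' : 0 < l.re := hl
  have hi := hν.integrable_one_sub_exp hl
  have key : ∀ x : ℝ, 0 < x → 0 < (1 - Complex.exp (-(l * x))).re := fun x hx => by
    have h1 := Complex.re_le_norm (Complex.exp (-(l * x)))
    rw [Complex.norm_exp] at h1
    have h2 : Real.exp (-(l * x)).re < 1 := by
      simp; positivity
    simp only [Complex.sub_re, Complex.one_re]
    linarith
  change 0 < (laplaceExponent ν l).re
  have hre : (laplaceExponent ν l).re = ∫ x, (1 - Complex.exp (-(l * x))).re ∂ν :=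
    (integral_re hi).symm
  rw [hre, integral_pos_iff_support_of_nonneg_ae]
  · refine (pos_iff_ne_zero.2 hν0).trans_le (measure_mono fun x hx => (key x hx).ne')
  · filter_upwards [hν.ae_pos] with x hx using (key x hx).le
  · exact hi.re

lemma hasDerivAt_laplaceExponent (hν : IsSubordinatorLevyMeasure ν) {l : ℂ}
    (hl : l ∈ rightHalfPlane) :
    Integrable (fun x : ℝ => x * Complex.exp (-(l * x))) ν ∧
    HasDerivAt (laplaceExponent ν) (∫ x : ℝ, x * Complex.exp (-(l * x)) ∂ν) l := by
  have hl' : 0 < l.re := hl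
  set b := l.re / 2 with hb
  have hb0 : 0 < b := half_pos hl'
  have hs : {z : ℂ | b < z.re} ∈ 𝓝 l :=
    (isOpen_lt continuous_const Complex.continuous_re).mem_nhds (half_lt_self hl')
  refine hasDerivAt_integral_of_dominated_loc_of_deriv_le (𝕜 := ℂ)
    (F := fun z (x : ℝ) => 1 - Complex.exp (-(z * x)))
    (F' := fun z (x : ℝ) => x * Complex.exp (-(z * x)))
    -- On Re z > b the derivative is at most x e^(-bx), which is bounded both by x and by 1/b.
    (bound := fun x => (1 + 1 / b) * min 1 x) hs
    (Eventually.of_forall fun z => Continuous.aestronglyMeasurable (by fun_prop))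
    (hν.integrable_one_sub_exp hl) (Continuous.aestronglyMeasurable (by fun_prop)) ?_
    (hν.integrable_min.const_mul _) ?_
  · filter_upwards [hν.ae_pos] with x hx z hz
    have hz : b < z.re := hz
    rw [norm_mul, Complex.norm_real, Complex.norm_exp, Real.norm_eq_abs, abs_of_pos hx]
    have h1 : Real.exp (-(z * x)).re ≤ Real.exp (-(b * x)) := by
      simp; gcongr
    have h2 : Real.exp (-(b * x)) ≤ 1 := by simp; positivity
    have h3 := mul_exp_neg_le hb0 x
    have h4 : 0 < 1 / b := by positivity
    have h5 := mul_le_mul_of_nonneg_left h1 hx.le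
    rcases min_cases 1 x with ⟨h, _⟩ | ⟨h, _⟩ <;> rw [h] <;> nlinarith
  · refine Eventually.of_forall fun x z _ => ?_
    refine ((((hasDerivAt_id' z).mul_const (x : ℂ)).fun_neg.cexp).const_sub 1).congr_deriv ?_
    ring

lemma differentiableOn_laplaceExponent (hν : IsSubordinatorLevyMeasure ν) :
    DifferentiableOn ℂ (laplaceExponent ν) rightHalfPlane := fun _ hl =>
  (hν.hasDerivAt_laplaceExponent hl).2.differentiableAt.differentiableWithinAt

/-- At a real point the derivative is the integral of a positive function. The point 1 is thus
noncritical, and an open set of ξ has local inverses; this anchors the uniqueness of the transported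
function. -/
lemma deriv_laplaceExponent_one_ne_zero (hν : IsSubordinatorLevyMeasure ν)
    (hν0 : ν (Ioi 0) ≠ 0) : deriv (laplaceExponent ν) 1 ≠ 0 := by
  obtain ⟨hi, hd⟩ := hν.hasDerivAt_laplaceExponent (l := 1) (by simp [rightHalfPlane])
  rw [hd.deriv]
  have h1 : ∀ x : ℝ, (x : ℂ) * Complex.exp (-(1 * x)) = ((x * Real.exp (-x) : ℝ) : ℂ) := by
    intro x; simp
  simp only [h1] at hi ⊢
  rw [integral_complex_ofReal, Complex.ofReal_ne_zero]
  have hi' : Integrable (fun x : ℝ => x * Real.exp (-x)) ν := hi.re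
  refine ne_of_gt ?_
  rw [integral_pos_iff_support_of_nonneg_ae _ hi']
  · refine (pos_iff_ne_zero.2 hν0).trans_le (measure_mono fun x hx => ?_)
    exact (mul_pos (mem_Ioi.1 hx) (Real.exp_pos _)).ne'
  · filter_upwards [hν.ae_pos] with x hx
    exact (mul_pos hx (Real.exp_pos _)).le

end IsSubordinatorLevyMeasure

lemma laplaceExponent_ofReal (ν : Measure ℝ) (r : ℝ) :
    laplaceExponent ν r = ((∫ x, (1 - Real.exp (-(r * x))) ∂ν : ℝ) : ℂ) := by
  rw [laplaceExponent, ← integral_complex_ofReal]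
  congr 1
  ext x
  simp

/-- Near the value of an analytic function at a noncritical point of the half-plane, there are
local inverses. -/
lemma eventually_exists_isLocalInverse {Ψ : ℂ → ℂ} {l : ℂ} (hl : l ∈ rightHalfPlane)
    (hΨ : AnalyticAt ℂ Ψ l) (hΨ' : deriv Ψ l ≠ 0) :
    ∃ g : ℂ → ℂ, ∀ᶠ ξ in 𝓝 (Ψ l), IsLocalInverse Ψ g ξ := by
  have hs := hΨ.hasStrictDerivAt
  refine ⟨hs.localInverse Ψ _ l hΨ', ?_⟩
  have hg : AnalyticAt ℂ (hs.localInverse Ψ _ l hΨ') (Ψ l) := hΨ.analyticAt_localInverse hΨ'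
  have hgl : hs.localInverse Ψ _ l hΨ' (Ψ l) = l :=
    (hs.eventually_left_inverse hΨ').self_of_nhds
  have hmem : ∀ᶠ ξ in 𝓝 (Ψ l), hs.localInverse Ψ _ l hΨ' ξ ∈ rightHalfPlane :=
    hg.continuousAt.eventually_mem (isOpen_rightHalfPlane.mem_nhds (by rwa [hgl]))
  filter_upwards [hg.eventually_analyticAt, hmem,
    (hs.eventually_right_inverse hΨ').eventually_nhds] with ξ h1 h2 h3
  exact ⟨h1, h2, h3⟩

/-- The transported function is unique on the half-plane. -/
lemma IsInverseTransport.eqOn {Ψ f w w' : ℂ → ℂ} {l : ℂ} (hl : l ∈ rightHalfPlane)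
    (hl' : Ψ l ∈ rightHalfPlane) (hΨ : AnalyticAt ℂ Ψ l) (hΨ' : deriv Ψ l ≠ 0)
    (hw : IsInverseTransport Ψ f w) (hw' : IsInverseTransport Ψ f w') :
    EqOn w w' rightHalfPlane := by
  obtain ⟨g, hg⟩ := eventually_exists_isLocalInverse hl hΨ hΨ'
  refine AnalyticOnNhd.eqOn_of_preconnected_of_eventuallyEq
    (hw.1.analyticOnNhd isOpen_rightHalfPlane) (hw'.1.analyticOnNhd isOpen_rightHalfPlane)
    isPreconnected_rightHalfPlane hl' ?_
  filter_upwards [hg, isOpen_rightHalfPlane.mem_nhds hl'] with ξ h1 h2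
  rw [hw.2 ξ h2 g h1, hw'.2 ξ h2 g h1]

/-! ### The variance function of the fractional Ornstein-Uhlenbeck process -/

lemma integrable_of_norm_le_vertical {g : ℝ → ℂ} {b r K : ℝ} (hb : 0 < b) (hr : 1 < r)
    (hg : Continuous g) (hK : ∀ z : ℝ, ‖g z‖ ≤ K * ‖(b + Complex.I * z : ℂ)‖ ^ (-r)) :
    Integrable g := by
  -- Chosen so that m (1 + z²) ≤ b² + z², which reduces the bound to the standard integrable power
  -- of 1 + z².
  set m := min (b ^ 2) 1 with hm
  have hm0 : 0 < m := by positivity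
  have hi : Integrable fun z : ℝ => (1 + ‖z‖ ^ 2) ^ (-r / 2) :=
    integrable_rpow_neg_one_add_norm_sq (by simpa using hr)
  have hK0 : 0 ≤ K := by
    have h0 := (norm_nonneg _).trans (hK 0)
    refine nonneg_of_mul_nonneg_left h0 (Real.rpow_pos_of_pos ?_ _)
    simpa using hb.ne'
  refine Integrable.mono' (hi.const_mul (K * m ^ (-r / 2))) hg.aestronglyMeasurable
    (Eventually.of_forall fun z => (hK z).trans ?_)
  rw [mul_assoc]
  refine mul_le_mul_of_nonneg_left ?_ hK0
  have h2 : ‖(b + Complex.I * z : ℂ)‖ ^ 2 = b ^ 2 + z ^ 2 := by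
    rw [Complex.sq_norm, Complex.normSq_apply]
    simp; ring
  have h3 : ‖(b + Complex.I * z : ℂ)‖ ^ (-r)
      = (‖(b + Complex.I * z : ℂ)‖ ^ 2) ^ (-r / 2) := by
    rw [← Real.rpow_natCast, ← Real.rpow_mul (norm_nonneg _)]
    congr 1
    push_cast
    ring
  rw [h3, h2, ← Real.mul_rpow hm0.le (by positivity), Real.norm_eq_abs, sq_abs]
  refine Real.rpow_le_rpow_of_nonpos (by positivity) ?_ (by linarith)
  have h4 : m ≤ b ^ 2 := min_le_left _ _
  have h5 : m ≤ 1 := min_le_right _ _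
  nlinarith [sq_nonneg z]

noncomputable section

/-- The variance at time `t` of the fractional Ornstein-Uhlenbeck process with drift `a = 1 / θ`
and Hurst index `h / 2`. -/
def fouVar (a h t : ℝ) : ℝ :=
  Real.exp (-(a * t)) * t ^ h + a / 2 * ((∫ r in (0 : ℝ)..t, Real.exp (-(a * r)) * r ^ h)
    - Real.exp (-(2 * a * t)) * ∫ r in (0 : ℝ)..t, Real.exp (a * r) * r ^ h)

/-- The derivative of `fouVar`. -/
def fouVarDeriv (a h t : ℝ) : ℝ :=
  Real.exp (-(a * t)) * (h * t ^ (h - 1) - a * t ^ h)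
    + a ^ 2 * Real.exp (-(2 * a * t)) * ∫ r in (0 : ℝ)..t, Real.exp (a * r) * r ^ h

end

variable {a h : ℝ}

lemma continuous_exp_mul_rpow (b : ℝ) (hh : 0 < h) :
    Continuous fun r : ℝ => Real.exp (b * r) * r ^ h :=
  (by fun_prop : Continuous fun r : ℝ => Real.exp (b * r)).mul (Real.continuous_rpow_const hh.le)

lemma continuous_exp_neg_mul_rpow (b : ℝ) (hh : 0 < h) :
    Continuous fun r : ℝ => Real.exp (-(b * r)) * r ^ h :=
  (by fun_prop : Continuous fun r : ℝ => Real.exp (-(b * r))).mul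
    (Real.continuous_rpow_const hh.le)

lemma continuous_fouVar (hh : 0 < h) : Continuous (fouVar a h) := by
  have h1 := intervalIntegral.continuous_primitive
    (fun _ _ => (continuous_exp_neg_mul_rpow a hh).intervalIntegrable _ _) 0 (μ := volume)
  have h2 := intervalIntegral.continuous_primitive
    (fun _ _ => (continuous_exp_mul_rpow a hh).intervalIntegrable _ _) 0 (μ := volume)
  have h3 := continuous_exp_neg_mul_rpow a hh
  unfold fouVar
  fun_prop

lemma continuous_fouVarDeriv (hh : 1 < h) : Continuous (fouVarDeriv a h) := by
  have h2 := intervalIntegral.continuous_primitive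
    (fun _ _ => (continuous_exp_mul_rpow a (zero_lt_one.trans hh)).intervalIntegrable _ _) 0
    (μ := volume)
  have h3 : Continuous fun t : ℝ => t ^ h := Real.continuous_rpow_const (by linarith)
  have h4 : Continuous fun t : ℝ => t ^ (h - 1) := Real.continuous_rpow_const (by linarith)
  unfold fouVarDeriv
  fun_prop

lemma fouVar_zero (hh : h ≠ 0) : fouVar a h 0 = 0 := by
  simp [fouVar, Real.zero_rpow hh]

lemma fouVarDeriv_zero (hh : 1 < h) : fouVarDeriv a h 0 = 0 := by
  simp [fouVarDeriv, Real.zero_rpow (by linarith : h ≠ 0),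
    Real.zero_rpow (by linarith : h - 1 ≠ 0)]

lemma hasDerivAt_exp_mul (b t : ℝ) :
    HasDerivAt (fun t : ℝ => Real.exp (b * t)) (b * Real.exp (b * t)) t := by
  refine (((hasDerivAt_id' t).const_mul b).exp).congr_deriv ?_
  ring

lemma hasDerivAt_exp_neg_mul (b t : ℝ) :
    HasDerivAt (fun t : ℝ => Real.exp (-(b * t))) (-b * Real.exp (-(b * t))) t := by
  refine (((hasDerivAt_id' t).const_mul b).fun_neg.exp).congr_deriv ?_
  ring

lemma hasDerivAt_fouVar (hh : 0 < h) {t : ℝ} (ht : 0 < t) :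
    HasDerivAt (fouVar a h) (fouVarDeriv a h t) t := by
  have h1 := intervalIntegral.integral_hasDerivAt_right
    ((continuous_exp_neg_mul_rpow a hh).intervalIntegrable 0 t)
    ((continuous_exp_neg_mul_rpow a hh).stronglyMeasurableAtFilter _ _)
    (continuous_exp_neg_mul_rpow a hh).continuousAt
  have h2 := intervalIntegral.integral_hasDerivAt_right
    ((continuous_exp_mul_rpow a hh).intervalIntegrable 0 t)
    ((continuous_exp_mul_rpow a hh).stronglyMeasurableAtFilter _ _)
    (continuous_exp_mul_rpow a hh).continuousAt
  have h3 := Real.hasDerivAt_rpow_const (p := h) (Or.inl ht.ne')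
  refine (((hasDerivAt_exp_neg_mul a t).mul h3).add
    ((h1.sub ((hasDerivAt_exp_neg_mul (2 * a) t).mul h2)).const_mul (a / 2))).congr_deriv ?_
  have h4 : Real.exp (-(2 * a * t)) * Real.exp (a * t) = Real.exp (-(a * t)) := by
    rw [← Real.exp_add]; congr 1; ring
  unfold fouVarDeriv
  linear_combination (-a / 2 * t ^ h) * h4

/-- Differentiation reproduces the integral term up to the factor -2a, so the integral can be
eliminated. The resulting linear equation yields both the sign of the derivative of the variance and
its Laplace transform. -/
lemma hasDerivAt_fouVarDeriv (hh : 0 < h) {t : ℝ} (ht : 0 < t) :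
    HasDerivAt (fouVarDeriv a h)
      (-(2 * a) * fouVarDeriv a h t + h * (h - 1) * (Real.exp (-(a * t)) * t ^ (h - 2))) t := by
  have h2 := intervalIntegral.integral_hasDerivAt_right
    ((continuous_exp_mul_rpow a hh).intervalIntegrable 0 t)
    ((continuous_exp_mul_rpow a hh).stronglyMeasurableAtFilter _ _)
    (continuous_exp_mul_rpow a hh).continuousAt
  have h3 := Real.hasDerivAt_rpow_const (p := h) (Or.inl ht.ne')
  have h5 := Real.hasDerivAt_rpow_const (p := h - 1) (Or.inl ht.ne')
  refine (((hasDerivAt_exp_neg_mul a t).mul ((h5.const_mul h).sub (h3.const_mul a))).add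
    (((hasDerivAt_exp_neg_mul (2 * a) t).const_mul (a ^ 2)).mul h2)).congr_deriv ?_
  have h4 : Real.exp (-(2 * a * t)) * Real.exp (a * t) = Real.exp (-(a * t)) := by
    rw [← Real.exp_add]; congr 1; ring
  unfold fouVarDeriv
  rw [show h - 1 - 1 = h - 2 by ring]
  dsimp only [Pi.sub_apply, Pi.mul_apply]
  linear_combination (a ^ 2 * t ^ h) * h4

lemma fouVarDeriv_pos (hh : 1 < h) {t : ℝ} (ht : 0 < t) : 0 < fouVarDeriv a h t := by
  -- The exponential is the integrating factor of the linear equation: the product has derivative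
  -- e^(2at) times the forcing term, positive because h > 1, and it starts from zero.
  have hmono : StrictMonoOn (fun t => Real.exp (2 * a * t) * fouVarDeriv a h t) (Ici 0) := by
    refine strictMonoOn_of_deriv_pos (convex_Ici 0) ?_ fun t ht => ?_
    · have := continuous_fouVarDeriv (a := a) hh
      fun_prop
    · rw [interior_Ici] at ht
      have ht : 0 < t := ht
      rw [((hasDerivAt_exp_mul (2 * a) t).fun_mul
        (hasDerivAt_fouVarDeriv (zero_lt_one.trans hh) ht)).deriv]
      have : 0 < Real.exp (2 * a * t) * (h * (h - 1) * (Real.exp (-(a * t)) * t ^ (h - 2))) := by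
        have : 0 < h - 1 := by linarith
        positivity
      linarith
  have := hmono self_mem_Ici ht.le ht
  simp only [fouVarDeriv_zero hh, mul_zero] at this
  exact pos_of_mul_pos_right this (Real.exp_pos _).le

lemma fouVar_pos (hh : 1 < h) {t : ℝ} (ht : 0 < t) : 0 < fouVar a h t := by
  have hmono : StrictMonoOn (fouVar a h) (Ici 0) := by
    refine strictMonoOn_of_deriv_pos (convex_Ici 0)
      (continuous_fouVar (by linarith)).continuousOn fun t ht => ?_
    rw [interior_Ici] at ht
    rw [(hasDerivAt_fouVar (by linarith) ht).deriv]
    exact fouVarDeriv_pos hh ht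
  simpa only [fouVar_zero (by linarith : h ≠ 0)] using hmono self_mem_Ici ht.le ht

/-- The integral is at most its length times the value of the integrand at the right end, and
e^(-2at) e^(at) leaves e^(-at). This decay is what permits abscissas down to -a. -/
lemma abs_fouVarDeriv_le (ha : 0 < a) (hh : 1 < h) {t : ℝ} (ht : 0 < t) :
    |fouVarDeriv a h t|
      ≤ Real.exp (-(a * t)) * (h * t ^ (h - 1) + a * t ^ h + a ^ 2 * t ^ (h + 1)) := by
  have h1 : |∫ r in (0 : ℝ)..t, Real.exp (a * r) * r ^ h| ≤ Real.exp (a * t) * t ^ (h + 1) := by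
    have := intervalIntegral.norm_integral_le_of_norm_le_const (a := 0) (b := t)
      (f := fun r => Real.exp (a * r) * r ^ h) (C := Real.exp (a * t) * t ^ h) fun r hr => by
        rw [uIoc_of_le ht.le] at hr
        have := hr.1
        rw [Real.norm_eq_abs, abs_of_nonneg (by positivity)]
        gcongr
        exacts [hr.2, hr.2]
    rw [sub_zero, abs_of_pos ht] at this
    rwa [Real.rpow_add_one ht.ne', ← mul_assoc]
  have h2 : Real.exp (-(2 * a * t)) * Real.exp (a * t) = Real.exp (-(a * t)) := by
    rw [← Real.exp_add]; congr 1; ring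
  unfold fouVarDeriv
  refine (abs_add_le _ _).trans ?_
  rw [abs_mul, abs_mul, abs_mul, Real.abs_exp, Real.abs_exp, abs_of_nonneg (sq_nonneg a), mul_add]
  have h0 : 0 < h := by linarith
  have h3 : |h * t ^ (h - 1) - a * t ^ h| ≤ h * t ^ (h - 1) + a * t ^ h := by
    have p1 : 0 ≤ h * t ^ (h - 1) := by positivity
    have p2 : 0 ≤ a * t ^ h := by positivity
    rw [abs_le]
    constructor <;> linarith
  refine add_le_add (mul_le_mul_of_nonneg_left h3 (Real.exp_pos _).le) ?_
  calc _ ≤ a ^ 2 * Real.exp (-(2 * a * t)) * (Real.exp (a * t) * t ^ (h + 1)) := by gcongr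
    _ = _ := by rw [← h2]; ring

/-! ### Laplace transform of the derivative of the variance -/

lemma LaplaceIntegrable.add {f g : ℝ → ℝ} {c : ℝ} (hf : LaplaceIntegrable f c)
    (hg : LaplaceIntegrable g c) : LaplaceIntegrable (fun t => f t + g t) c := by
  refine (Integrable.add hf hg).congr (Eventually.of_forall fun t => ?_)
  simp [mul_add]

lemma LaplaceIntegrable.const_mul {f : ℝ → ℝ} {c : ℝ} (hf : LaplaceIntegrable f c) (k : ℝ) :
    LaplaceIntegrable (fun t => k * f t) c := by
  refine (Integrable.const_mul hf k).congr (Eventually.of_forall fun t => ?_)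
  simp only
  ring

lemma LaplaceIntegrable.exp_neg_mul {f : ℝ → ℝ} {b c : ℝ} (hf : LaplaceIntegrable f (c + b)) :
    LaplaceIntegrable (fun t => Real.exp (-(b * t)) * f t) c := by
  refine Integrable.congr hf (Eventually.of_forall fun t => ?_)
  simp only
  rw [← mul_assoc, ← Real.exp_add]
  congr 2
  ring

lemma LaplaceIntegrable.of_abs_le {f g : ℝ → ℝ} {c : ℝ} (hg : LaplaceIntegrable g c)
    (hm : AEStronglyMeasurable f (volume.restrict (Ioi 0)))
    (hfg : ∀ t ∈ Ioi (0 : ℝ), |f t| ≤ g t) : LaplaceIntegrable f c := by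
  refine Integrable.mono' hg ((Continuous.aestronglyMeasurable (by fun_prop)).mul hm) ?_
  filter_upwards [ae_restrict_mem measurableSet_Ioi] with t ht
  rw [norm_mul, Real.norm_eq_abs, Real.abs_exp, Real.norm_eq_abs]
  gcongr
  exact hfg t ht

lemma laplaceTransform_exp_neg_mul (f : ℝ → ℝ) (b : ℝ) (l : ℂ) :
    laplaceTransform (fun t => Real.exp (-(b * t)) * f t) l = laplaceTransform f (l + b) := by
  unfold laplaceTransform
  congr 1
  ext t
  simp only [laplaceIntegrand, Complex.ofReal_mul, Complex.ofReal_exp, ← mul_assoc,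
    ← Complex.exp_add]
  congr 2
  push_cast
  ring

lemma laplaceTransform_add {f g : ℝ → ℝ} {l : ℂ} (hf : LaplaceIntegrable f l.re)
    (hg : LaplaceIntegrable g l.re) :
    laplaceTransform (fun t => f t + g t) l = laplaceTransform f l + laplaceTransform g l := by
  unfold laplaceTransform
  rw [← integral_add hf.integrableOn hg.integrableOn]
  congr 1
  ext t
  simp [laplaceIntegrand, mul_add]

lemma laplaceTransform_const_mul (f : ℝ → ℝ) (k : ℝ) (l : ℂ) :
    laplaceTransform (fun t => k * f t) l = k * laplaceTransform f l := by
  unfold laplaceTransform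
  rw [← integral_const_mul]
  congr 1
  ext t
  simp [laplaceIntegrand]
  ring

lemma laplaceIntegrable_rpow' {s c : ℝ} (hs : -1 < s) (hc : 0 < c) :
    LaplaceIntegrable (fun t => t ^ s) c := by
  have := laplaceIntegrable_rpow (s := s + 1) (c := c) (by linarith) hc
  simpa using this

lemma laplaceIntegrable_fouVarDeriv (ha : 0 < a) (hh : 1 < h) {c : ℝ} (hc : -a < c) :
    LaplaceIntegrable (fouVarDeriv a h) c := by
  refine LaplaceIntegrable.of_abs_le (LaplaceIntegrable.exp_neg_mul (b := a) ?_)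
    (continuous_fouVarDeriv hh).aestronglyMeasurable fun t ht => abs_fouVarDeriv_le ha hh ht
  have hc' : 0 < c + a := by linarith
  exact (((laplaceIntegrable_rpow' (by linarith) hc').const_mul _).add
    ((laplaceIntegrable_rpow' (by linarith) hc').const_mul _)).add
    ((laplaceIntegrable_rpow' (by linarith) hc').const_mul _)

/-- Needed because the second time derivative of the density contains the square of the derivative
of the variance. The majorant comes from (x + y + z)² ≤ 3(x² + y² + z²). -/
lemma laplaceIntegrable_fouVarDeriv_sq (ha : 0 < a) (hh : 1 < h) {c : ℝ} (hc : -(2 * a) < c) :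
    LaplaceIntegrable (fun t => fouVarDeriv a h t ^ 2) c := by
  have hc' : 0 < c + 2 * a := by linarith
  refine LaplaceIntegrable.of_abs_le (g := fun t => Real.exp (-(2 * a * t))
      * (3 * h ^ 2 * t ^ (2 * (h - 1)) + 3 * a ^ 2 * t ^ (2 * h) + 3 * a ^ 4 * t ^ (2 * (h + 1))))
    (LaplaceIntegrable.exp_neg_mul (b := 2 * a) ?_)
    ((continuous_fouVarDeriv hh).pow 2).aestronglyMeasurable fun t ht => ?_
  · exact (((laplaceIntegrable_rpow' (by linarith) hc').const_mul _).add
      ((laplaceIntegrable_rpow' (by linarith) hc').const_mul _)).add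
      ((laplaceIntegrable_rpow' (by linarith) hc').const_mul _)
  · have ht : 0 < t := ht
    have h1 := pow_le_pow_left₀ (abs_nonneg _) (abs_fouVarDeriv_le ha hh ht) 2
    have h2 : ∀ s : ℝ, t ^ (2 * s) = (t ^ s) ^ 2 := fun s => by
      rw [mul_comm, Real.rpow_mul ht.le]; norm_cast
    have h3 : Real.exp (-(2 * a * t)) = Real.exp (-(a * t)) ^ 2 := by
      rw [← Real.exp_nat_mul]; congr 1; push_cast; ring
    rw [abs_of_nonneg (sq_nonneg _), ← sq_abs]
    refine h1.trans ?_
    rw [h2, h2, h2, h3, mul_pow]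
    refine mul_le_mul_of_nonneg_left ?_ (sq_nonneg _)
    generalize t ^ (h - 1) = x
    generalize t ^ h = y
    generalize t ^ (h + 1) = z
    nlinarith [sq_nonneg (h * x - a * y), sq_nonneg (h * x - a ^ 2 * z),
      sq_nonneg (a * y - a ^ 2 * z)]

lemma laplaceIntegrable_fouVarDeriv_deriv (ha : 0 < a) (hh : 1 < h) {c : ℝ} (hc : -a < c) :
    LaplaceIntegrable (fun t => -(2 * a) * fouVarDeriv a h t
      + h * (h - 1) * (Real.exp (-(a * t)) * t ^ (h - 2))) c :=
  ((laplaceIntegrable_fouVarDeriv ha hh hc).const_mul _).add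
    ((LaplaceIntegrable.exp_neg_mul (laplaceIntegrable_rpow' (by linarith) (by linarith))).const_mul
      _)

lemma tendsto_fouVarDeriv_zero (hh : 1 < h) : Tendsto (fouVarDeriv a h) (𝓝[>] 0) (𝓝 0) :=
  ((continuous_fouVarDeriv hh).tendsto' 0 0 (fouVarDeriv_zero hh)).mono_left nhdsWithin_le_nhds

lemma tendsto_fouVar_zero (hh : 0 < h) : Tendsto (fouVar a h) (𝓝[>] 0) (𝓝 0) :=
  ((continuous_fouVar hh).tendsto' 0 0 (fouVar_zero hh.ne')).mono_left nhdsWithin_le_nhds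

/-- This is the Laplace transform of the linear equation for the derivative of the variance, which
vanishes at 0 and so leaves no boundary term; the forcing term contributes a Gamma integral shifted
by a. -/
lemma laplaceTransform_fouVarDeriv (ha : 0 < a) (hh : 1 < h) {l : ℂ} (hl : -a < l.re) :
    (l + 2 * a) * laplaceTransform (fouVarDeriv a h) l
      = h * (h - 1) * Real.Gamma (h - 1) * (l + a) ^ (-(h - 1) : ℂ) := by
  have hla : l + a ∈ rightHalfPlane := by
    change 0 < (l + a).re
    simp; linarith
  have h1 := laplaceTransform_deriv (fun t ht => hasDerivAt_fouVarDeriv (by linarith) ht)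
    (tendsto_fouVarDeriv_zero hh) (laplaceIntegrable_fouVarDeriv ha hh hl)
    (laplaceIntegrable_fouVarDeriv_deriv ha hh hl)
  have h2 := laplaceTransform_rpow (s := h - 1) (by linarith) hla
  rw [show h - 1 - 1 = h - 2 by ring] at h2
  rw [laplaceTransform_add ((laplaceIntegrable_fouVarDeriv ha hh hl).const_mul _)
    ((LaplaceIntegrable.exp_neg_mul (laplaceIntegrable_rpow' (by linarith)
      (by linarith))).const_mul _), laplaceTransform_const_mul, laplaceTransform_const_mul,
    laplaceTransform_exp_neg_mul, h2] at h1
  push_cast at h1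
  linear_combination -h1

lemma continuous_laplaceTransform_vertical {f : ℝ → ℝ} {b c : ℝ} (hf : LaplaceIntegrable f b)
    (hc : b < c) : Continuous fun z : ℝ => laplaceTransform f (c + Complex.I * z) := by
  refine continuous_iff_continuousAt.2 fun z => ?_
  refine ContinuousAt.comp' (f := fun z : ℝ => (c + Complex.I * z : ℂ))
    (differentiableAt_laplaceTransform hf ?_).continuousAt (by fun_prop)
  simpa using hc

/-- Since |l + a| ≤ |l + 2a| to the right of -a, the explicit transform is bounded by a constant
times |l + a|^(-h). Integrability on the line is the condition h > 1, that is, H > 1/2. -/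
lemma integrable_laplaceTransform_fouVarDeriv (ha : 0 < a) (hh : 1 < h) {c : ℝ} (hc : -a < c) :
    Integrable fun z : ℝ => laplaceTransform (fouVarDeriv a h) (c + Complex.I * z) := by
  refine integrable_of_norm_le_vertical (b := c + a) (r := h)
    (K := ‖(h * (h - 1) * Real.Gamma (h - 1) : ℂ)‖) (by linarith) hh
    (continuous_laplaceTransform_vertical
      -- The midpoint of -a and c: continuity on the line requires convergence strictly to its left.
      (laplaceIntegrable_fouVarDeriv ha hh (c := (c - a) / 2) (by linarith)) (by linarith))
    fun z => ?_
  set l : ℂ := c + Complex.I * z with hl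
  have hre : l.re = c := by simp [hl]
  have key := laplaceTransform_fouVarDeriv ha hh (l := l) (by rwa [hre])
  have h1 : ((c + a : ℝ) : ℂ) + Complex.I * z = l + a := by rw [hl]; push_cast; ring
  have h2 : 0 < ‖l + a‖ := by
    rw [norm_pos_iff]
    intro h0
    have := congrArg Complex.re h0
    simp [hre] at this
    linarith
  have h3 : ‖l + a‖ ≤ ‖l + 2 * a‖ := by
    refine abs_le_of_sq_le_sq' ?_ (norm_nonneg _) |>.2
    rw [Complex.sq_norm, Complex.sq_norm, Complex.normSq_apply, Complex.normSq_apply]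
    simp [hre]
    nlinarith
  have h4 := congrArg norm key
  rw [norm_mul, norm_mul _ ((l + a) ^ _), Complex.norm_cpow_of_ne_zero (norm_pos_iff.1 h2)] at h4
  simp only [Complex.neg_re, Complex.sub_re, Complex.ofReal_re, Complex.one_re, Complex.neg_im,
    Complex.sub_im, Complex.ofReal_im, Complex.one_im, sub_zero, neg_zero, mul_zero, Real.exp_zero,
    div_one] at h4
  rw [h1, Real.rpow_neg h2.le, ← div_eq_mul_inv, le_div_iff₀ (by positivity)]
  have h5 : ‖l + a‖ ^ h = ‖l + a‖ * ‖l + a‖ ^ (h - 1) := by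
    rw [mul_comm, ← Real.rpow_add_one h2.ne']; congr 1; ring
  have h6 : ‖l + a‖ ^ (-(h - 1)) * ‖l + a‖ ^ (h - 1) = 1 := by
    rw [← Real.rpow_add h2]; simp
  calc ‖laplaceTransform (fouVarDeriv a h) l‖ * ‖l + a‖ ^ h
      ≤ ‖laplaceTransform (fouVarDeriv a h) l‖ * (‖l + 2 * a‖ * ‖l + a‖ ^ (h - 1)) := by
        rw [h5]; gcongr
    _ = ‖l + 2 * a‖ * ‖laplaceTransform (fouVarDeriv a h) l‖ * ‖l + a‖ ^ (h - 1) := by ring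
    _ = _ := by rw [h4, mul_assoc, h6, mul_one]

/-! ### The Gaussian density as a function of the variance -/

noncomputable section

/-- The function `v ↦ v^(-s) e^(-q/v)`. -/
def gaussPow (q s v : ℝ) : ℝ := v ^ (-s) * Real.exp (-(q / v))

/-- The centered Gaussian density at `x` as a function of the variance. -/
def gaussKernel (x v : ℝ) : ℝ := (√(2 * Real.pi))⁻¹ * gaussPow (x ^ 2 / 2) (1 / 2) v

/-- The density at `x` of the fractional Ornstein-Uhlenbeck process at time `t`. -/
def fouDensity (a h x t : ℝ) : ℝ := gaussKernel x (fouVar a h t)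

/-- The factor of `fouVarDeriv` in the time derivative of `fouDensity`. -/
def fouDensityFactor (a h x t : ℝ) : ℝ :=
  (√(2 * Real.pi))⁻¹ * (-(1 / 2) * gaussPow (x ^ 2 / 2) (3 / 2) (fouVar a h t)
    + x ^ 2 / 2 * gaussPow (x ^ 2 / 2) (5 / 2) (fouVar a h t))

/-- The time derivative of `fouDensityFactor` divided by `fouVarDeriv`. -/
def fouDensityFactorDeriv (a h x t : ℝ) : ℝ :=
  (√(2 * Real.pi))⁻¹ * (-(1 / 2) * (-(3 / 2) * gaussPow (x ^ 2 / 2) (5 / 2) (fouVar a h t)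
      + x ^ 2 / 2 * gaussPow (x ^ 2 / 2) (7 / 2) (fouVar a h t))
    + x ^ 2 / 2 * (-(5 / 2) * gaussPow (x ^ 2 / 2) (7 / 2) (fouVar a h t)
      + x ^ 2 / 2 * gaussPow (x ^ 2 / 2) (9 / 2) (fouVar a h t)))

/-- The time derivative of `fouDensity`. -/
def fouDensityDeriv (a h x t : ℝ) : ℝ := fouDensityFactor a h x t * fouVarDeriv a h t

end

lemma gaussianPDFReal_eq_gaussKernel (v : ℝ≥0) (x : ℝ) :
    gaussianPDFReal 0 v x = gaussKernel x v := by
  unfold gaussianPDFReal gaussKernel gaussPow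
  rw [Real.sqrt_mul (by positivity), mul_inv, mul_assoc, Real.rpow_neg v.coe_nonneg,
    ← Real.sqrt_eq_rpow]
  congr 3
  rw [sub_zero, neg_div, div_div]

lemma gaussPow_nonneg (q s : ℝ) {v : ℝ} (hv : 0 ≤ v) : 0 ≤ gaussPow q s v := by
  unfold gaussPow
  positivity

/-- In u = 1/v the function is u^s e^(-qu). Majorising u^s by 1 + u^n with an integer n ≥ s leaves
one term of the exponential series to beat. -/
lemma exists_gaussPow_le {q s : ℝ} (hq : 0 < q) (hs : 0 ≤ s) :
    ∃ C, 0 < C ∧ ∀ v, 0 < v → |gaussPow q s v| ≤ C := by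
  set n := ⌈s⌉₊ with hn
  refine ⟨1 + n.factorial / q ^ n, by positivity, fun v hv => ?_⟩
  rw [abs_of_nonneg (gaussPow_nonneg q s hv.le), gaussPow, Real.rpow_neg hv.le,
    ← Real.inv_rpow hv.le, div_eq_mul_inv]
  have hu : 0 < v⁻¹ := inv_pos.2 hv
  generalize v⁻¹ = u at hu
  have h1 : u ^ s ≤ 1 + u ^ n := by
    rcases le_total u 1 with h | h
    · exact (Real.rpow_le_one hu.le h hs).trans (by linarith [pow_pos hu n])
    · have : u ^ s ≤ u ^ (n : ℝ) := Real.rpow_le_rpow_of_exponent_le h (Nat.le_ceil s)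
      rw [Real.rpow_natCast] at this
      linarith
  have h2 : Real.exp (-(q * u)) ≤ 1 := by simp; positivity
  have h3 := Real.pow_div_factorial_le_exp (q * u) (by positivity) n
  rw [div_le_iff₀ (by positivity), mul_pow] at h3
  have h4 : u ^ n * Real.exp (-(q * u)) ≤ n.factorial / q ^ n := by
    rw [Real.exp_neg, ← div_eq_mul_inv, div_le_div_iff₀ (Real.exp_pos _) (by positivity)]
    linarith
  calc u ^ s * Real.exp (-(q * u)) ≤ (1 + u ^ n) * Real.exp (-(q * u)) := by gcongr
    _ ≤ _ := by rw [add_mul, one_mul]; exact add_le_add h2 h4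

/-- One factor of v is gained by raising s by one in the uniform bound; it gives the vanishing of
the density at time zero. -/
lemma exists_abs_gaussPow_le_mul {q s : ℝ} (hq : 0 < q) (hs : 0 ≤ s) :
    ∃ C, 0 < C ∧ ∀ v, 0 < v → |gaussPow q s v| ≤ C * v := by
  obtain ⟨C, hC, h⟩ := exists_gaussPow_le hq (s := s + 1) (by linarith)
  refine ⟨C, hC, fun v hv => ?_⟩
  have : gaussPow q s v = gaussPow q (s + 1) v * v := by
    unfold gaussPow
    rw [mul_right_comm, ← Real.rpow_add_one hv.ne']
    congr 2
    ring
  rw [this, abs_mul, abs_of_pos hv]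
  gcongr
  exact h v hv

lemma hasDerivAt_gaussPow (q s : ℝ) {v : ℝ} (hv : 0 < v) :
    HasDerivAt (gaussPow q s) (-s * gaussPow q (s + 1) v + q * gaussPow q (s + 2) v) v := by
  refine ((Real.hasDerivAt_rpow_const (p := -s) (Or.inl hv.ne')).mul
    (((hasDerivAt_inv hv.ne').const_mul q).fun_neg.exp)).congr_deriv ?_
  have h1 : v ^ (-(s + 2)) = v ^ (-s) * (v ^ 2)⁻¹ := by
    rw [neg_add, Real.rpow_add hv, Real.rpow_neg hv.le 2]
    norm_cast
  unfold gaussPow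
  rw [h1, neg_add' s 1, div_eq_mul_inv]
  ring

variable {a h x : ℝ}

/-! ### The density as a function of time: derivatives, bounds and behaviour at zero -/

lemma hasDerivAt_gaussPow_fouVar (q s : ℝ) (hh : 1 < h) {t : ℝ} (ht : 0 < t) :
    HasDerivAt (fun t => gaussPow q s (fouVar a h t))
      ((-s * gaussPow q (s + 1) (fouVar a h t) + q * gaussPow q (s + 2) (fouVar a h t))
        * fouVarDeriv a h t) t :=
  (hasDerivAt_gaussPow q s (fouVar_pos hh ht)).comp t (hasDerivAt_fouVar (by linarith) ht)

lemma hasDerivAt_fouDensity (hh : 1 < h) {t : ℝ} (ht : 0 < t) :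
    HasDerivAt (fouDensity a h x) (fouDensityDeriv a h x t) t := by
  refine ((hasDerivAt_gaussPow_fouVar (x ^ 2 / 2) (1 / 2) hh ht).const_mul _).congr_deriv ?_
  unfold fouDensityDeriv fouDensityFactor
  norm_num
  ring

lemma hasDerivAt_fouDensityFactor (hh : 1 < h) {t : ℝ} (ht : 0 < t) :
    HasDerivAt (fouDensityFactor a h x) (fouDensityFactorDeriv a h x t * fouVarDeriv a h t) t := by
  refine ((((hasDerivAt_gaussPow_fouVar (x ^ 2 / 2) (3 / 2) hh ht).const_mul _).add
    ((hasDerivAt_gaussPow_fouVar (x ^ 2 / 2) (5 / 2) hh ht).const_mul _)).const_mul _).congr_deriv ?_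
  unfold fouDensityFactorDeriv
  norm_num
  ring

lemma hasDerivAt_fouDensityDeriv (hh : 1 < h) {t : ℝ} (ht : 0 < t) :
    HasDerivAt (fouDensityDeriv a h x)
      (fouDensityFactorDeriv a h x t * fouVarDeriv a h t ^ 2 + fouDensityFactor a h x t *
        (-(2 * a) * fouVarDeriv a h t + h * (h - 1) * (Real.exp (-(a * t)) * t ^ (h - 2)))) t := by
  refine ((hasDerivAt_fouDensityFactor hh ht).mul
    (hasDerivAt_fouVarDeriv (by linarith) ht)).congr_deriv ?_
  ring

/-- The convention that zero to a nonzero power is zero gives the right value here: the law at time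
zero is a point mass at the origin, with density zero elsewhere. -/
lemma fouDensity_zero (hh : h ≠ 0) : fouDensity a h x 0 = 0 := by
  simp [fouDensity, gaussKernel, gaussPow, fouVar_zero hh]

lemma measurable_gaussPow (q s : ℝ) : Measurable (gaussPow q s) := by
  unfold gaussPow
  fun_prop

lemma measurable_gaussKernel (x : ℝ) : Measurable (gaussKernel x) :=
  (measurable_gaussPow _ _).const_mul _

lemma measurable_fouDensity (hh : 0 < h) : Measurable (fouDensity a h x) :=
  (measurable_gaussKernel x).comp (continuous_fouVar hh).measurable

lemma measurable_fouDensityFactor (hh : 0 < h) : Measurable (fouDensityFactor a h x) := by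
  have hm := (continuous_fouVar (a := a) hh).measurable
  have := fun s => (measurable_gaussPow (x ^ 2 / 2) s).comp hm
  exact (((this _).const_mul _).add ((this _).const_mul _)).const_mul _

lemma measurable_fouDensityFactorDeriv (hh : 0 < h) : Measurable (fouDensityFactorDeriv a h x) := by
  have hm := (continuous_fouVar (a := a) hh).measurable
  have := fun s => (measurable_gaussPow (x ^ 2 / 2) s).comp hm
  exact (((((this _).const_mul _).add ((this _).const_mul _)).const_mul _).add
    ((((this _).const_mul _).add ((this _).const_mul _)).const_mul _)).const_mul _

lemma exists_gaussKernel_le (hx : x ≠ 0) :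
    ∃ C, 0 < C ∧ ∀ v, 0 ≤ v → |gaussKernel x v| ≤ C := by
  obtain ⟨C, hC, h⟩ := exists_gaussPow_le (q := x ^ 2 / 2) (by positivity) (s := 1 / 2)
    (by norm_num)
  refine ⟨(√(2 * Real.pi))⁻¹ * C, by positivity, fun v hv => ?_⟩
  rcases hv.eq_or_lt with rfl | hv
  · simp [gaussKernel, gaussPow]; positivity
  · rw [gaussKernel, abs_mul, abs_of_nonneg (by positivity : 0 ≤ (√(2 * Real.pi))⁻¹)]
    gcongr
    exact h v hv

lemma exists_fouDensity_le (hx : x ≠ 0) (hh : 1 < h) :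
    ∃ C, 0 < C ∧ ∀ t, 0 ≤ t → |fouDensity a h x t| ≤ C := by
  obtain ⟨C, hC, hb⟩ := exists_gaussKernel_le hx
  refine ⟨C, hC, fun t ht => hb _ ?_⟩
  rcases ht.eq_or_lt with rfl | ht
  · rw [fouVar_zero (by linarith)]
  · exact (fouVar_pos hh ht).le

lemma exists_fouDensityFactor_le (hx : x ≠ 0) (hh : 1 < h) :
    ∃ C, 0 < C ∧ ∀ t, 0 < t → |fouDensityFactor a h x t| ≤ C := by
  have hq : 0 < x ^ 2 / 2 := by positivity
  obtain ⟨C, hC, h1⟩ := exists_gaussPow_le hq (s := 3 / 2) (by norm_num)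
  obtain ⟨D, hD, h2⟩ := exists_gaussPow_le hq (s := 5 / 2) (by norm_num)
  refine ⟨(√(2 * Real.pi))⁻¹ * (1 / 2 * C + x ^ 2 / 2 * D), by positivity, fun t ht => ?_⟩
  have hv := fouVar_pos (a := a) hh ht
  rw [fouDensityFactor, abs_mul, abs_of_nonneg (by positivity : 0 ≤ (√(2 * Real.pi))⁻¹)]
  gcongr
  refine (abs_add_le _ _).trans ?_
  rw [abs_mul, abs_mul, abs_neg, abs_of_pos hq, abs_of_pos (by norm_num : (0 : ℝ) < 1 / 2)]
  gcongr
  exacts [h1 _ hv, h2 _ hv]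

lemma exists_fouDensityFactorDeriv_le (hx : x ≠ 0) (hh : 1 < h) :
    ∃ C, 0 < C ∧ ∀ t, 0 < t → |fouDensityFactorDeriv a h x t| ≤ C := by
  have hq : 0 < x ^ 2 / 2 := by positivity
  obtain ⟨C, hC, h1⟩ := exists_gaussPow_le hq (s := 5 / 2) (by norm_num)
  obtain ⟨D, hD, h2⟩ := exists_gaussPow_le hq (s := 7 / 2) (by norm_num)
  obtain ⟨E, hE, h3⟩ := exists_gaussPow_le hq (s := 9 / 2) (by norm_num)
  refine ⟨(√(2 * Real.pi))⁻¹ * (1 / 2 * (3 / 2 * C + x ^ 2 / 2 * D)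
    + x ^ 2 / 2 * (5 / 2 * D + x ^ 2 / 2 * E)), by positivity, fun t ht => ?_⟩
  have hv := fouVar_pos (a := a) hh ht
  rw [fouDensityFactorDeriv, abs_mul, abs_of_nonneg (by positivity : 0 ≤ (√(2 * Real.pi))⁻¹)]
  gcongr
  have b1 := abs_le.1 (h1 _ hv)
  have b2 := abs_le.1 (h2 _ hv)
  have b3 := abs_le.1 (h3 _ hv)
  generalize gaussPow (x ^ 2 / 2) (5 / 2) (fouVar a h t) = X at *
  generalize gaussPow (x ^ 2 / 2) (7 / 2) (fouVar a h t) = Y at *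
  generalize gaussPow (x ^ 2 / 2) (9 / 2) (fouVar a h t) = Z at *
  generalize x ^ 2 / 2 = q at *
  have hq2 : 0 < q * q := mul_pos hq hq
  rw [abs_le]
  constructor <;> nlinarith

lemma tendsto_fouDensity_zero (hx : x ≠ 0) (hh : 1 < h) :
    Tendsto (fouDensity a h x) (𝓝[>] 0) (𝓝 0) := by
  obtain ⟨C, hC, hb⟩ := exists_abs_gaussPow_le_mul (q := x ^ 2 / 2) (by positivity) (s := 1 / 2)
    (by norm_num)
  have h1 := ((tendsto_fouVar_zero (a := a) (by linarith : 0 < h)).const_mul C).const_mul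
    (√(2 * Real.pi))⁻¹
  rw [mul_zero, mul_zero] at h1
  refine squeeze_zero_norm' ?_ h1
  filter_upwards [self_mem_nhdsWithin] with t ht
  rw [fouDensity, gaussKernel, norm_mul, Real.norm_of_nonneg (by positivity)]
  gcongr
  exact hb _ (fouVar_pos hh ht)

lemma tendsto_fouDensityDeriv_zero (hx : x ≠ 0) (hh : 1 < h) :
    Tendsto (fouDensityDeriv a h x) (𝓝[>] 0) (𝓝 0) := by
  obtain ⟨C, hC, hb⟩ := exists_fouDensityFactor_le (a := a) hx hh
  have h1 := (tendsto_fouVarDeriv_zero (a := a) hh).norm.const_mul C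
  rw [norm_zero, mul_zero] at h1
  refine squeeze_zero_norm' ?_ h1
  filter_upwards [self_mem_nhdsWithin] with t ht
  rw [fouDensityDeriv, norm_mul]
  gcongr
  exact hb _ ht

/-! ### Laplace transform of the density in time -/

lemma laplaceIntegrable_fouDensity (hx : x ≠ 0) (hh : 1 < h) {c : ℝ} (hc : 0 < c) :
    LaplaceIntegrable (fouDensity a h x) c := by
  obtain ⟨C, hC, hb⟩ := exists_fouDensity_le (a := a) hx hh
  exact .of_bounded hc (measurable_fouDensity (by linarith)).aestronglyMeasurable
    fun t ht => hb t (le_of_lt ht)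

lemma LaplaceIntegrable.bdd_mul {f g : ℝ → ℝ} {c C : ℝ} (hg : LaplaceIntegrable g c)
    (hm : AEStronglyMeasurable f (volume.restrict (Ioi 0)))
    (hf : ∀ t ∈ Ioi (0 : ℝ), |f t| ≤ C) : LaplaceIntegrable (fun t => f t * g t) c := by
  refine (Integrable.bdd_mul (c := C) hg hm ?_).congr
    (Eventually.of_forall fun t => mul_left_comm _ _ _)
  filter_upwards [ae_restrict_mem measurableSet_Ioi] with t ht using hf t ht

lemma laplaceIntegrable_fouDensityDeriv (ha : 0 < a) (hx : x ≠ 0) (hh : 1 < h) {c : ℝ}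
    (hc : -a < c) : LaplaceIntegrable (fouDensityDeriv a h x) c := by
  obtain ⟨C, hC, hb⟩ := exists_fouDensityFactor_le (a := a) hx hh
  exact (laplaceIntegrable_fouVarDeriv ha hh hc).bdd_mul
    (measurable_fouDensityFactor (by linarith)).aestronglyMeasurable hb

lemma laplaceIntegrable_fouDensityDeriv_deriv (ha : 0 < a) (hx : x ≠ 0) (hh : 1 < h) {c : ℝ}
    (hc : -a < c) : LaplaceIntegrable (fun t => fouDensityFactorDeriv a h x t * fouVarDeriv a h t ^ 2
      + fouDensityFactor a h x t * (-(2 * a) * fouVarDeriv a h t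
        + h * (h - 1) * (Real.exp (-(a * t)) * t ^ (h - 2)))) c := by
  obtain ⟨C, hC, hb⟩ := exists_fouDensityFactor_le (a := a) hx hh
  obtain ⟨D, hD, hb'⟩ := exists_fouDensityFactorDeriv_le (a := a) hx hh
  exact ((laplaceIntegrable_fouVarDeriv_sq ha hh (by linarith)).bdd_mul
    (measurable_fouDensityFactorDeriv (by linarith)).aestronglyMeasurable hb').add
    ((laplaceIntegrable_fouVarDeriv_deriv ha hh hc).bdd_mul
      (measurable_fouDensityFactor (by linarith)).aestronglyMeasurable hb)

/-- Two integrations by parts, with no boundary terms since the density and its derivative vanish at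
0+, show that l² times the transform is the transform of the second derivative. The latter is
bounded on the line, because |e^(-lt)| depends only on Re l. -/
lemma integrable_laplaceTransform_fouDensity (ha : 0 < a) (hx : x ≠ 0) (hh : 1 < h) {c : ℝ}
    (hc : 0 < c) :
    Integrable fun z : ℝ => laplaceTransform (fouDensity a h x) (c + Complex.I * z) := by
  have hc' : -a < c := by linarith
  obtain ⟨K, hK⟩ : ∃ K, K = ∫ t in Ioi (0 : ℝ), ‖Real.exp (-(c * t)) *
      (fouDensityFactorDeriv a h x t * fouVarDeriv a h t ^ 2
      + fouDensityFactor a h x t * (-(2 * a) * fouVarDeriv a h t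
        + h * (h - 1) * (Real.exp (-(a * t)) * t ^ (h - 2))))‖ := ⟨_, rfl⟩
  refine integrable_of_norm_le_vertical (r := 2) (K := K) hc one_lt_two
    (continuous_laplaceTransform_vertical
      (laplaceIntegrable_fouDensity hx hh (half_pos hc)) (half_lt_self hc)) fun z => ?_
  set l : ℂ := c + Complex.I * z with hl
  have hre : l.re = c := by simp [hl]
  have h1 := laplaceTransform_deriv (l := l) (fun t ht => hasDerivAt_fouDensity (a := a) hh ht)
    (tendsto_fouDensity_zero hx hh) (laplaceIntegrable_fouDensity hx hh (by rwa [hre]))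
    (laplaceIntegrable_fouDensityDeriv ha hx hh (by rwa [hre]))
  have h2 := laplaceTransform_deriv (l := l)
    (fun t ht => hasDerivAt_fouDensityDeriv (a := a) (x := x) hh ht)
    (tendsto_fouDensityDeriv_zero hx hh) (laplaceIntegrable_fouDensityDeriv ha hx hh (by rwa [hre]))
    (laplaceIntegrable_fouDensityDeriv_deriv ha hx hh (by rwa [hre]))
  have h3 := norm_laplaceTransform_le (fun t => fouDensityFactorDeriv a h x t * fouVarDeriv a h t ^ 2
      + fouDensityFactor a h x t * (-(2 * a) * fouVarDeriv a h t
        + h * (h - 1) * (Real.exp (-(a * t)) * t ^ (h - 2)))) l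
  rw [h2, h1, hre, ← hK, norm_mul, norm_mul] at h3
  have h4 : 0 < ‖l‖ := by
    rw [norm_pos_iff]
    intro h0
    rw [h0, Complex.zero_re] at hre
    linarith
  rw [Real.rpow_neg h4.le, ← div_eq_mul_inv, le_div_iff₀ (by positivity)]
  norm_cast
  linarith

lemma integrableOn_fouDensityDeriv (ha : 0 < a) (hx : x ≠ 0) (hh : 1 < h) :
    IntegrableOn (fouDensityDeriv a h x) (Ioi 0) := by
  have := laplaceIntegrable_fouDensityDeriv ha hx hh (c := 0) (by linarith)
  simpa [LaplaceIntegrable] using this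

/-- The initial value is zero, so the density at a random time becomes an integral of its derivative
against the indicator of s < E(t). -/
lemma fouDensity_eq_integral (ha : 0 < a) (hx : x ≠ 0) (hh : 1 < h) {s : ℝ} (hs : 0 ≤ s) :
    fouDensity a h x s = ∫ r in (0 : ℝ)..s, fouDensityDeriv a h x r := by
  have hcont : ContinuousOn (fouDensity a h x) (Icc 0 s) := by
    intro t ht
    rcases ht.1.eq_or_lt with rfl | h0
    · refine ContinuousWithinAt.mono (t := Ici 0) ?_ Icc_subset_Ici_self
      rw [← Ioi_insert, continuousWithinAt_insert_self, ContinuousWithinAt,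
        fouDensity_zero (by linarith)]
      exact tendsto_fouDensity_zero hx hh
    · exact (hasDerivAt_fouDensity hh h0).continuousAt.continuousWithinAt
  rw [intervalIntegral.integral_eq_sub_of_hasDerivAt_of_le hs hcont
    (fun t ht => hasDerivAt_fouDensity hh ht.1), fouDensity_zero (by linarith), sub_zero]
  rw [intervalIntegrable_iff_integrableOn_Ioc_of_le hs]
  exact (integrableOn_fouDensityDeriv ha hx hh).mono_set Ioc_subset_Ioi_self

/-! ### The iterated integrals defining `L̂` -/

lemma laplaceTransform_congr {f g : ℝ → ℝ} (hfg : ∀ t ∈ Ioi (0 : ℝ), f t = g t) (l : ℂ) :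
    laplaceTransform f l = laplaceTransform g l := by
  refine setIntegral_congr_fun measurableSet_Ioi fun t ht => ?_
  simp only [laplaceIntegrand, hfg t ht]

section HatL

variable {V D f : ℝ → ℝ} {c₁ c₂ : ℝ} {w : ℂ → ℂ}

lemma hatLInnerIntegrand_eq (hV : ∀ t ∈ Ioi (0 : ℝ), deriv V t = D t)
    (hw : ∀ z : ℝ, w (c₂ + Complex.I * z) = laplaceTransform f (c₂ + Complex.I * z)) (s z : ℝ) :
    hatLInnerIntegrand V c₁ c₂ w s z
      = laplaceTransform D ((c₁ - c₂ : ℝ) + Complex.I * (s - z : ℝ))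
        * laplaceTransform f (c₂ + Complex.I * z) := by
  rw [hatLInnerIntegrand, hw, laplaceTransform_congr hV]
  push_cast
  rfl

/-- Up to an exponential of constant modulus e^(c₁t), this is the integrand of the convolution of
two integrable functions, one of them truncated. Fubini thus becomes available. -/
lemma integrable_prod_hatLInnerIntegrand (hV : ∀ t ∈ Ioi (0 : ℝ), deriv V t = D t)
    (hw : ∀ z : ℝ, w (c₂ + Complex.I * z) = laplaceTransform f (c₂ + Complex.I * z))
    (hDi : Integrable fun y : ℝ => laplaceTransform D ((c₁ - c₂ : ℝ) + Complex.I * y))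
    (hfi : Integrable fun z : ℝ => laplaceTransform f (c₂ + Complex.I * z)) (t R : ℝ) :
    Integrable (Function.uncurry fun s z : ℝ => Complex.exp ((c₁ + Complex.I * s) * t)
      * hatLInnerIntegrand V c₁ c₂ w s z) (volume.prod (volume.restrict (Ioc (-R) R))) := by
  have h := (hfi.integrableOn (s := Ioc (-R) R)).convolution_integrand
    (ContinuousLinearMap.mul ℂ ℂ) hDi
  refine (h.bdd_mul (c := Real.exp (c₁ * t))
    (f := fun p : ℝ × ℝ => Complex.exp ((c₁ + Complex.I * p.1) * t))
    (Continuous.aestronglyMeasurable (by fun_prop)) ?_).congr ?_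
  · refine Eventually.of_forall fun p => le_of_eq ?_
    rw [Complex.norm_exp]
    simp
  · refine Eventually.of_forall fun p => ?_
    simp only [Function.uncurry, hatLInnerIntegrand_eq hV hw, ContinuousLinearMap.mul_apply']
    ring

lemma hatLMiddleIntegrand_eq (hR : 0 ≤ R) (t s : ℝ) :
    hatLMiddleIntegrand V c₁ c₂ w t R s = ∫ z in Ioc (-R) R,
      Complex.exp ((c₁ + Complex.I * s) * t) * hatLInnerIntegrand V c₁ c₂ w s z := by
  rw [hatLMiddleIntegrand, intervalIntegral.integral_of_le (by linarith), integral_const_mul]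

lemma integrable_hatLMiddleIntegrand (hV : ∀ t ∈ Ioi (0 : ℝ), deriv V t = D t)
    (hw : ∀ z : ℝ, w (c₂ + Complex.I * z) = laplaceTransform f (c₂ + Complex.I * z))
    (hDi : Integrable fun y : ℝ => laplaceTransform D ((c₁ - c₂ : ℝ) + Complex.I * y))
    (hfi : Integrable fun z : ℝ => laplaceTransform f (c₂ + Complex.I * z)) {t R : ℝ}
    (hR : 0 ≤ R) : Integrable (hatLMiddleIntegrand V c₁ c₂ w t R) :=
  (integrable_prod_hatLInnerIntegrand hV hw hDi hfi t R).integral_prod_left.congr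
    (Eventually.of_forall fun s => (hatLMiddleIntegrand_eq hR t s).symm)

lemma hatLTruncated_eq (hV : ∀ t ∈ Ioi (0 : ℝ), deriv V t = D t)
    (hw : ∀ z : ℝ, w (c₂ + Complex.I * z) = laplaceTransform f (c₂ + Complex.I * z))
    (hDi : Integrable fun y : ℝ => laplaceTransform D ((c₁ - c₂ : ℝ) + Complex.I * y))
    (hD : LaplaceIntegrable D (c₁ - c₂))
    (hfi : Integrable fun z : ℝ => laplaceTransform f (c₂ + Complex.I * z)) {t R : ℝ}
    (hR : 0 ≤ R) (ht : 0 < t) (hDc : ContinuousAt D t) :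
    hatLTruncated V c₁ c₂ w t R = 2 * Real.pi * D t * ∫ z in (-R)..R,
      Complex.exp ((c₂ + Complex.I * z) * t) * laplaceTransform f (c₂ + Complex.I * z) := by
  rw [hatLTruncated, intervalIntegral.integral_of_le (by linarith), ← integral_const_mul]
  calc _ = ∫ s : ℝ, ∫ z in Ioc (-R) R,
      Complex.exp ((c₁ + Complex.I * s) * t) * hatLInnerIntegrand V c₁ c₂ w s z := by
        congr 1; ext s; exact hatLMiddleIntegrand_eq hR t s
    _ = ∫ z in Ioc (-R) R, ∫ s : ℝ,
      Complex.exp ((c₁ + Complex.I * s) * t) * hatLInnerIntegrand V c₁ c₂ w s z :=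
        integral_integral_swap (integrable_prod_hatLInnerIntegrand hV hw hDi hfi t R)
    _ = _ := by
      congr 1
      ext z
      -- The translation s ↦ s + z splits e^((c₁+is)t) into one exponential for each of the
      -- abscissas c₁ - c₂ and c₂; the integral over s is then the inversion formula for D.
      rw [← integral_exp_mul_laplaceTransform hD hDi ht hDc, ← integral_mul_const,
        ← integral_add_right_eq_self _ z]
      congr 1
      ext s
      rw [hatLInnerIntegrand_eq hV hw, mul_mul_mul_comm, ← Complex.exp_add, add_sub_cancel_right]
      congr 2
      push_cast
      ring

lemma tendsto_hatLTruncated (hV : ∀ t ∈ Ioi (0 : ℝ), deriv V t = D t)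
    (hw : ∀ z : ℝ, w (c₂ + Complex.I * z) = laplaceTransform f (c₂ + Complex.I * z))
    (hDi : Integrable fun y : ℝ => laplaceTransform D ((c₁ - c₂ : ℝ) + Complex.I * y))
    (hD : LaplaceIntegrable D (c₁ - c₂))
    (hfi : Integrable fun z : ℝ => laplaceTransform f (c₂ + Complex.I * z))
    (hf : LaplaceIntegrable f c₂) {t : ℝ} (ht : 0 < t) (hDc : ContinuousAt D t)
    (hfc : ContinuousAt f t) :
    Tendsto (fun R : ℝ => hatLTruncated V c₁ c₂ w t R) atTop
      (𝓝 (4 * (Real.pi : ℂ) ^ 2 * (D t * f t))) := by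
  have hint : Integrable fun z : ℝ =>
      Complex.exp ((c₂ + Complex.I * z) * t) * laplaceTransform f (c₂ + Complex.I * z) := by
    refine hfi.bdd_mul (c := Real.exp (c₂ * t)) (Continuous.aestronglyMeasurable (by fun_prop)) ?_
    refine Eventually.of_forall fun p => le_of_eq ?_
    rw [Complex.norm_exp]
    simp
  have hlim := (intervalIntegral_tendsto_integral hint tendsto_neg_atTop_atBot
    tendsto_id).const_mul (2 * Real.pi * D t : ℂ)
  -- Absolute integrability lets R tend to infinity, and a second inversion, on the line Re ξ = c₂,
  -- recovers f(t).
  rw [integral_exp_mul_laplaceTransform hf hfi ht hfc] at hlim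
  have he : (2 * Real.pi * D t * (2 * Real.pi * f t) : ℂ) = 4 * (Real.pi : ℂ) ^ 2 * (D t * f t) := by
    ring
  rw [he] at hlim
  refine hlim.congr' ?_
  filter_upwards [eventually_ge_atTop 0] with R hR
  exact (hatLTruncated_eq hV hw hDi hD hfi hR ht hDc).symm

/-- If `w` is the Laplace transform of `f` on the line `Re ξ = c₂`, then the integrals in the
definition of `L̂` compute the Laplace transform of `V' f`. -/
lemma hatLWellDefined_and_integral_eq (hV : ∀ t ∈ Ioi (0 : ℝ), deriv V t = D t)
    (hw : ∀ z : ℝ, w (c₂ + Complex.I * z) = laplaceTransform f (c₂ + Complex.I * z))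
    (hDcont : Continuous fun y : ℝ => laplaceTransform D ((c₁ - c₂ : ℝ) + Complex.I * y))
    (hDi : Integrable fun y : ℝ => laplaceTransform D ((c₁ - c₂ : ℝ) + Complex.I * y))
    (hD : LaplaceIntegrable D (c₁ - c₂))
    (hfcont : Continuous fun z : ℝ => laplaceTransform f (c₂ + Complex.I * z))
    (hfi : Integrable fun z : ℝ => laplaceTransform f (c₂ + Complex.I * z))
    (hf : LaplaceIntegrable f c₂) (hDc : ∀ t, 0 < t → ContinuousAt D t)
    (hfc : ∀ t, 0 < t → ContinuousAt f t) {Ψ : ℂ → ℂ} {l : ℂ}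
    (hDf : LaplaceIntegrable (fun t => D t * f t) (Ψ l).re) :
    HatLWellDefined V Ψ c₁ c₂ w l ∧
      1 / (4 * (Real.pi : ℂ) ^ 2) * ∫ t in Ioi (0 : ℝ), hatLOuterIntegrand V Ψ c₁ c₂ w l t
        = laplaceTransform (fun t => D t * f t) (Ψ l) := by
  have hlim := fun t (ht : t ∈ Ioi (0 : ℝ)) =>
    tendsto_hatLTruncated hV hw hDi hD hfi hf ht (hDc t ht) (hfc t ht)
  have houter : ∀ t ∈ Ioi (0 : ℝ), 4 * (Real.pi : ℂ) ^ 2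
      * laplaceIntegrand (fun t => D t * f t) (Ψ l) t = hatLOuterIntegrand V Ψ c₁ c₂ w l t := by
    intro t ht
    rw [hatLOuterIntegrand, (hlim t ht).limUnder_eq, laplaceIntegrand]
    push_cast
    ring
  refine ⟨⟨fun R s _ => ?_, fun t R _ hR => integrable_hatLMiddleIntegrand hV hw hDi hfi hR.le,
    fun t ht => ⟨_, hlim t ht⟩, ?_⟩, ?_⟩
  · refine Continuous.intervalIntegrable ?_ _ _
    have h1 := hDcont.comp (continuous_const.sub continuous_id : Continuous fun z : ℝ => s - z)
    refine (h1.mul hfcont).congr fun z => ?_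
    exact (hatLInnerIntegrand_eq hV hw s z).symm
  · exact (integrableOn_congr_fun houter measurableSet_Ioi).1 (hDf.integrableOn.const_mul _)
  · rw [← setIntegral_congr_fun measurableSet_Ioi houter, integral_const_mul, ← mul_assoc,
      one_div, inv_mul_cancel₀, one_mul, laplaceTransform]
    have : (Real.pi : ℂ) ≠ 0 := by exact_mod_cast Real.pi_ne_zero
    simp [this]

end HatL

/-! ### Riemann sums -/

noncomputable section

/-- The left Riemann sum of `f` over `[0, T]` with `n` steps. -/
def riemannSum (f : ℝ → ℝ) (T : ℝ) (n : ℕ) : ℝ :=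
  ∑ k ∈ Finset.range n, T / n * f (T * k / n)

/-- The covariance of fractional Brownian motion of Hurst index `h / 2`. -/
def fbmCov (h s t : ℝ) : ℝ := 1 / 2 * (t ^ h + s ^ h - |t - s| ^ h)

end

lemma mul_div_mem_Icc {T : ℝ} (hT : 0 ≤ T) {k n : ℕ} (hk : k ≤ n) : T * k / n ∈ Icc 0 T := by
  refine ⟨by positivity, ?_⟩
  rcases Nat.eq_zero_or_pos n with rfl | hn
  · simpa using hT
  · have : (k : ℝ) ≤ n := by exact_mod_cast hk
    rw [div_le_iff₀ (by positivity)]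
    gcongr

lemma abs_riemannSum_sub_integral_le {f : ℝ → ℝ} {T ε : ℝ} (hT : 0 ≤ T) {n : ℕ} (hn : 0 < n)
    (hf : ContinuousOn f (Icc 0 T))
    (hε : ∀ x ∈ Icc 0 T, ∀ y ∈ Icc 0 T, |x - y| ≤ T / n → |f x - f y| ≤ ε) :
    |riemannSum f T n - ∫ s in (0 : ℝ)..T, f s| ≤ T * ε := by
  have hn' : (0 : ℝ) < n := by exact_mod_cast hn
  set p : ℕ → ℝ := fun k => T * k / n with hp
  have hmono : ∀ k, p k ≤ p (k + 1) := fun k => by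
    simp only [hp]
    gcongr
    simp
  have hstep : ∀ k, p (k + 1) - p k = T / n := fun k => by
    simp only [hp]
    push_cast
    field_simp
    ring
  have hsub : ∀ k < n, Icc (p k) (p (k + 1)) ⊆ Icc 0 T := fun k hk =>
    Icc_subset_Icc (mul_div_mem_Icc hT hk.le).1 (mul_div_mem_Icc hT hk).2
  have hint : ∀ k < n, IntervalIntegrable f volume (p k) (p (k + 1)) := fun k hk =>
    ((hf.mono (hsub k hk)).mono (by rw [uIcc_of_le (hmono k)])).intervalIntegrable
  have hsum := intervalIntegral.sum_integral_adjacent_intervals hint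
  have hp0 : p 0 = 0 := by simp [hp]
  have hpn : p n = T := by simp [hp, hn'.ne']
  rw [hp0, hpn] at hsum
  rw [← hsum, riemannSum, ← Finset.sum_sub_distrib]
  refine (Finset.abs_sum_le_sum_abs _ _).trans ?_
  calc _ ≤ ∑ k ∈ Finset.range n, T / n * ε := by
        refine Finset.sum_le_sum fun k hk => ?_
        have hk : k < n := Finset.mem_range.1 hk
        have h1 : T / n * f (T * k / n) = ∫ _ in p k..p (k + 1), f (p k) := by
          rw [intervalIntegral.integral_const, hstep, smul_eq_mul]
        rw [h1, ← intervalIntegral.integral_sub (by simp) (hint k hk), ← Real.norm_eq_abs]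
        refine (intervalIntegral.norm_integral_le_of_norm_le_const (C := ε) fun s hs => ?_).trans ?_
        · rw [uIoc_of_le (hmono k)] at hs
          refine hε _ (mul_div_mem_Icc hT hk.le) _ (hsub k hk ⟨hs.1.le, hs.2⟩) ?_
          rw [abs_sub_comm, abs_of_nonneg (sub_nonneg.2 hs.1.le), ← hstep k]
          exact sub_le_sub_right hs.2 _
        · rw [hstep, abs_of_nonneg (by positivity), mul_comm]
    _ = T * ε := by
        rw [Finset.sum_const, Finset.card_range, nsmul_eq_mul]
        field_simp

lemma eventually_div_le {T δ : ℝ} (hδ : 0 < δ) : ∀ᶠ n : ℕ in atTop, 0 < n ∧ T / n < δ :=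
  (eventually_gt_atTop 0).and
    ((tendsto_const_div_atTop_nhds_zero_nat T).eventually_lt_const hδ)

lemma tendsto_riemannSum {f : ℝ → ℝ} {T : ℝ} (hT : 0 ≤ T) (hf : ContinuousOn f (Icc 0 T)) :
    Tendsto (riemannSum f T) atTop (𝓝 (∫ s in (0 : ℝ)..T, f s)) := by
  rw [Metric.tendsto_nhds]
  intro ε hε
  have hu := Metric.uniformContinuousOn_iff.1
    (isCompact_Icc.uniformContinuousOn_of_continuous hf) (ε / (T + 1)) (by positivity)
  obtain ⟨δ, hδ, hu⟩ := hu
  filter_upwards [eventually_div_le (T := T) hδ] with n hn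
  rw [Real.dist_eq]
  refine (abs_riemannSum_sub_integral_le hT hn.1 hf
    fun x hx y hy hxy => (hu x hx y hy (hxy.trans_lt hn.2)).le).trans_lt ?_
  rw [mul_div_assoc', div_lt_iff₀ (by positivity)]
  nlinarith

lemma abs_riemannSum_le {f : ℝ → ℝ} {T C : ℝ} (hT : 0 ≤ T) {n : ℕ} (hn : 0 < n)
    (hf : ∀ s ∈ Icc 0 T, |f s| ≤ C) : |riemannSum f T n| ≤ T * C := by
  refine (Finset.abs_sum_le_sum_abs _ _).trans ?_
  calc _ ≤ ∑ k ∈ Finset.range n, T / n * C := by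
        refine Finset.sum_le_sum fun k hk => ?_
        rw [abs_mul, abs_of_nonneg (by positivity : 0 ≤ T / n)]
        gcongr
        exact hf _ (mul_div_mem_Icc hT (Finset.mem_range.1 hk).le)
    _ = T * C := by
        rw [Finset.sum_const, Finset.card_range, nsmul_eq_mul]
        field_simp

lemma riemannSum_sub (f g : ℝ → ℝ) (T : ℝ) (n : ℕ) :
    riemannSum (fun s => f s - g s) T n = riemannSum f T n - riemannSum g T n := by
  simp only [riemannSum, ← Finset.sum_sub_distrib, mul_sub]

lemma tendsto_riemannSum_riemannSum {K : ℝ → ℝ → ℝ} {T : ℝ} (hT : 0 ≤ T)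
    (hK : Continuous (Function.uncurry K)) :
    Tendsto (fun n => riemannSum (fun s => riemannSum (K s) T n) T n) atTop
      (𝓝 (∫ s in (0 : ℝ)..T, ∫ r in (0 : ℝ)..T, K s r)) := by
  have h1 : Continuous fun s => ∫ r in (0 : ℝ)..T, K s r :=
    intervalIntegral.continuous_parametric_intervalIntegral_of_continuous' hK 0 T
  have h2 := tendsto_riemannSum hT h1.continuousOn
  -- The inner sums converge uniformly in s by uniform continuity of K on the square, so replacing
  -- them by integrals costs nothing in the limit.
  suffices h3 : Tendsto (fun n => riemannSum (fun s => riemannSum (K s) T n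
      - ∫ r in (0 : ℝ)..T, K s r) T n) atTop (𝓝 0) by
    have := h3.add h2
    simp only [riemannSum_sub, sub_add_cancel, zero_add] at this
    exact this
  rw [Metric.tendsto_nhds]
  intro ε hε
  have hu := Metric.uniformContinuousOn_iff.1
    ((isCompact_Icc.prod isCompact_Icc).uniformContinuousOn_of_continuous
      (hK.continuousOn (s := Icc 0 T ×ˢ Icc 0 T))) (ε / (T * T + 1)) (by positivity)
  obtain ⟨δ, hδ, hu⟩ := hu
  filter_upwards [eventually_div_le (T := T) hδ] with n hn
  rw [Real.dist_eq, sub_zero]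
  refine (abs_riemannSum_le hT hn.1 fun s hs => abs_riemannSum_sub_integral_le hT hn.1
    (Continuous.continuousOn (by fun_prop))
    fun x hx y hy hxy => (hu (s, x) ⟨hs, hx⟩ (s, y) ⟨hs, hy⟩ ?_).le).trans_lt ?_
  · simpa [Prod.dist_eq, Real.dist_eq, hδ] using hxy.trans_lt hn.2
  · rw [← mul_assoc, mul_div_assoc', div_lt_iff₀ (by positivity)]
    nlinarith [mul_nonneg hT hT]

/-! ### The variance as a double integral -/

lemma integral_exp_mul_sub_rpow {a h : ℝ} (t : ℝ) :
    ∫ s in (0 : ℝ)..t, Real.exp (a * s) * (t - s) ^ h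
      = Real.exp (a * t) * ∫ r in (0 : ℝ)..t, Real.exp (-(a * r)) * r ^ h := by
  have := intervalIntegral.integral_comp_sub_left (a := 0) (b := t)
    (fun r => Real.exp (a * (t - r)) * r ^ h) t
  simp only [sub_sub_cancel, sub_self, sub_zero] at this
  rw [this, ← intervalIntegral.integral_const_mul]
  congr 1
  ext r
  rw [← mul_assoc, ← Real.exp_add]
  congr 2
  ring

/-- Splitting at r = s and translating each half removes the absolute value and leaves the two
primitives in terms of which the variance is written. -/
lemma integral_exp_mul_abs_sub_rpow {a h : ℝ} (hh : 0 < h) {s t : ℝ} (hs : 0 ≤ s) (hst : s ≤ t) :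
    ∫ r in (0 : ℝ)..t, Real.exp (a * r) * |s - r| ^ h
      = Real.exp (a * s) * (∫ r in (0 : ℝ)..s, Real.exp (-(a * r)) * r ^ h)
        + Real.exp (a * s) * ∫ r in (0 : ℝ)..(t - s), Real.exp (a * r) * r ^ h := by
  have hc : Continuous fun r => Real.exp (a * r) * |s - r| ^ h :=
    (by fun_prop : Continuous fun r : ℝ => Real.exp (a * r)).mul
      ((by fun_prop : Continuous fun r : ℝ => |s - r|).rpow_const fun _ => Or.inr hh.le)
  rw [← intervalIntegral.integral_add_adjacent_intervals (b := s) (hc.intervalIntegrable _ _)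
    (hc.intervalIntegrable _ _), ← integral_exp_mul_sub_rpow]
  congr 1
  · refine intervalIntegral.integral_congr fun r hr => ?_
    rw [uIcc_of_le hs] at hr
    rw [abs_of_nonneg (sub_nonneg.2 hr.2)]
  · have := intervalIntegral.integral_comp_sub_right (a := s) (b := t)
      (fun r => Real.exp (a * (r + s)) * |r| ^ h) s
    simp only [sub_add_cancel, sub_self] at this
    rw [← intervalIntegral.integral_const_mul]
    simp only [abs_sub_comm s]
    rw [this]
    refine intervalIntegral.integral_congr fun r hr => ?_
    rw [uIcc_of_le (sub_nonneg.2 hst)] at hr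
    rw [abs_of_nonneg hr.1, ← mul_assoc, ← Real.exp_add]
    congr 2
    ring

lemma hasDerivAt_integral_of_continuous {f : ℝ → ℝ} (hf : Continuous f) (t : ℝ) :
    HasDerivAt (fun t => ∫ r in (0 : ℝ)..t, f r) (f t) t :=
  intervalIntegral.integral_hasDerivAt_right (hf.intervalIntegrable 0 t)
    (hf.stronglyMeasurableAtFilter _ _) hf.continuousAt

lemma continuous_integral_of_continuous {f : ℝ → ℝ} (hf : Continuous f) :
    Continuous fun t => ∫ r in (0 : ℝ)..t, f r :=
  continuous_iff_continuousAt.2 fun t => (hasDerivAt_integral_of_continuous hf t).continuousAt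

lemma integral_exp_mul_primitive_neg {a h : ℝ} (ha : a ≠ 0) (hh : 0 < h) (t : ℝ) :
    ∫ s in (0 : ℝ)..t, Real.exp (2 * a * s) * ∫ r in (0 : ℝ)..s, Real.exp (-(a * r)) * r ^ h
      = (Real.exp (2 * a * t) * (∫ r in (0 : ℝ)..t, Real.exp (-(a * r)) * r ^ h)
        - ∫ r in (0 : ℝ)..t, Real.exp (a * r) * r ^ h) / (2 * a) := by
  have hG := continuous_exp_neg_mul_rpow a hh
  have hA := continuous_exp_mul_rpow a hh
  have hGc := continuous_integral_of_continuous hG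
  rw [intervalIntegral.integral_eq_sub_of_hasDerivAt
    (f := fun t => (Real.exp (2 * a * t) * (∫ r in (0 : ℝ)..t, Real.exp (-(a * r)) * r ^ h)
        - ∫ r in (0 : ℝ)..t, Real.exp (a * r) * r ^ h) / (2 * a)) (fun s _ => ?_)
    (Continuous.intervalIntegrable (by fun_prop) _ _)]
  · simp
  · refine ((((hasDerivAt_exp_mul (2 * a) s).mul (hasDerivAt_integral_of_continuous hG s)).sub
      (hasDerivAt_integral_of_continuous hA s)).div_const (2 * a)).congr_deriv ?_
    have h4 : Real.exp (2 * a * s) * Real.exp (-(a * s)) = Real.exp (a * s) := by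
      rw [← Real.exp_add]; congr 1; ring
    rw [← h4]
    field_simp
    ring

/-- This is the part r > s of the square and equals the part r < s. After s ↦ t - s an
antiderivative is explicit, the two exponentials recombining through e^(-2as) e^(as) = e^(-as). -/
lemma integral_exp_mul_primitive_sub {a h : ℝ} (ha : a ≠ 0) (hh : 0 < h) (t : ℝ) :
    ∫ s in (0 : ℝ)..t, Real.exp (2 * a * s) * ∫ r in (0 : ℝ)..(t - s), Real.exp (a * r) * r ^ h
      = (Real.exp (2 * a * t) * (∫ r in (0 : ℝ)..t, Real.exp (-(a * r)) * r ^ h)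
        - ∫ r in (0 : ℝ)..t, Real.exp (a * r) * r ^ h) / (2 * a) := by
  have hG := continuous_exp_neg_mul_rpow a hh
  have hA := continuous_exp_mul_rpow a hh
  have hAc := continuous_integral_of_continuous hA
  have h1 := intervalIntegral.integral_comp_sub_left (a := 0) (b := t)
    (fun s => Real.exp (2 * a * (t - s)) * ∫ r in (0 : ℝ)..s, Real.exp (a * r) * r ^ h) t
  simp only [sub_sub_cancel, sub_self, sub_zero] at h1
  have h5 : ∀ s, Real.exp (2 * a * (t - s)) = Real.exp (2 * a * t) * Real.exp (-(2 * a * s)) :=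
    fun s => by rw [← Real.exp_add]; congr 1; ring
  rw [h1, intervalIntegral.integral_eq_sub_of_hasDerivAt
    (f := fun s => Real.exp (2 * a * t) * ((∫ r in (0 : ℝ)..s, Real.exp (-(a * r)) * r ^ h)
        - Real.exp (-(2 * a * s)) * ∫ r in (0 : ℝ)..s, Real.exp (a * r) * r ^ h) / (2 * a))
    (fun s _ => ?_) (Continuous.intervalIntegrable (by fun_prop) _ _)]
  · have h6 : Real.exp (2 * a * t) * Real.exp (-(2 * a * t)) = 1 := by
      rw [← Real.exp_add]; simp
    simp only [intervalIntegral.integral_same, mul_zero, sub_zero, zero_div]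
    rw [mul_sub, ← mul_assoc, h6, one_mul]
  · refine ((((hasDerivAt_integral_of_continuous hG s).sub ((hasDerivAt_exp_neg_mul (2 * a) s).mul
      (hasDerivAt_integral_of_continuous hA s))).const_mul _).div_const (2 * a)).congr_deriv ?_
    have h4 : Real.exp (-(2 * a * s)) * Real.exp (a * s) = Real.exp (-(a * s)) := by
      rw [← Real.exp_add]; congr 1; ring
    rw [h5, ← h4]
    field_simp
    ring

lemma continuous_fbmCov {h : ℝ} (hh : 0 < h) : Continuous (Function.uncurry (fbmCov h)) := by
  have h1 : Continuous fun p : ℝ × ℝ => p.1 ^ h := continuous_fst.rpow_const fun _ => Or.inr hh.le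
  have h2 : Continuous fun p : ℝ × ℝ => p.2 ^ h := continuous_snd.rpow_const fun _ => Or.inr hh.le
  have h3 : Continuous fun p : ℝ × ℝ => |p.2 - p.1| ^ h :=
    (by fun_prop : Continuous fun p : ℝ × ℝ => |p.2 - p.1|).rpow_const fun _ => Or.inr hh.le
  unfold Function.uncurry fbmCov
  fun_prop

lemma integral_exp_mul_eq {a : ℝ} (ha : a ≠ 0) (t : ℝ) :
    ∫ s in (0 : ℝ)..t, Real.exp (a * s) = (Real.exp (a * t) - 1) / a := by
  rw [intervalIntegral.integral_comp_mul_left _ ha]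
  simp
  field_simp

lemma integral_exp_mul_fbmCov {a h : ℝ} (ha : a ≠ 0) (hh : 0 < h) {s t : ℝ} (hs : 0 ≤ s)
    (hst : s ≤ t) :
    ∫ r in (0 : ℝ)..t, Real.exp (a * r) * fbmCov h r s
      = 1 / 2 * (s ^ h * ((Real.exp (a * t) - 1) / a)
        + (∫ r in (0 : ℝ)..t, Real.exp (a * r) * r ^ h)
        - (Real.exp (a * s) * (∫ r in (0 : ℝ)..s, Real.exp (-(a * r)) * r ^ h)
        + Real.exp (a * s) * ∫ r in (0 : ℝ)..(t - s), Real.exp (a * r) * r ^ h)) := by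
  have hc : Continuous fun r => Real.exp (a * r) * |s - r| ^ h :=
    (by fun_prop : Continuous fun r : ℝ => Real.exp (a * r)).mul
      ((by fun_prop : Continuous fun r : ℝ => |s - r|).rpow_const fun _ => Or.inr hh.le)
  have hA := continuous_exp_mul_rpow a hh
  rw [← integral_exp_mul_abs_sub_rpow hh hs hst, ← integral_exp_mul_eq ha,
    ← intervalIntegral.integral_const_mul, ← intervalIntegral.integral_add
      (Continuous.intervalIntegrable (by fun_prop) _ _) (hA.intervalIntegrable _ _),
    ← intervalIntegral.integral_sub (Continuous.intervalIntegrable (by fun_prop) _ _)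
      (hc.intervalIntegrable _ _), ← intervalIntegral.integral_const_mul]
  congr 1
  ext r
  unfold fbmCov
  ring

/-- The variance of the fractional Ornstein-Uhlenbeck process, computed from the covariance of
fractional Brownian motion. -/
lemma variance_integral_eq_fouVar {a h : ℝ} (ha : a ≠ 0) (hh : 0 < h) {t : ℝ} (ht : 0 ≤ t) :
    t ^ h - 2 * (∫ s in (0 : ℝ)..t, a * Real.exp (-(a * (t - s))) * fbmCov h s t)
      + (∫ s in (0 : ℝ)..t, ∫ r in (0 : ℝ)..t, a * Real.exp (-(a * (t - s))) *
        (a * Real.exp (-(a * (t - r))) * fbmCov h r s)) = fouVar a h t := by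
  have hG := continuous_exp_neg_mul_rpow a hh
  have hA := continuous_exp_mul_rpow a hh
  have hGc := continuous_integral_of_continuous hG
  have hAc := continuous_integral_of_continuous hA
  have hAc' : Continuous fun s => ∫ r in (0 : ℝ)..(t - s), Real.exp (a * r) * r ^ h :=
    hAc.comp (by fun_prop : Continuous fun s : ℝ => t - s)
  have he : ∀ s, a * Real.exp (-(a * (t - s))) = a * Real.exp (-(a * t)) * Real.exp (a * s) :=
    fun s => by rw [mul_assoc, ← Real.exp_add]; congr 2; ring
  have e1 : ∫ s in (0 : ℝ)..t, a * Real.exp (-(a * (t - s))) * fbmCov h s t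
      = a * Real.exp (-(a * t)) * ∫ s in (0 : ℝ)..t, Real.exp (a * s) * fbmCov h s t := by
    rw [← intervalIntegral.integral_const_mul]
    congr 1
    ext s
    rw [he, mul_assoc]
  have e2 : (∫ s in (0 : ℝ)..t, ∫ r in (0 : ℝ)..t, a * Real.exp (-(a * (t - s))) *
        (a * Real.exp (-(a * (t - r))) * fbmCov h r s))
      = (a * Real.exp (-(a * t))) ^ 2 * ∫ s in (0 : ℝ)..t, Real.exp (a * s) *
        ∫ r in (0 : ℝ)..t, Real.exp (a * r) * fbmCov h r s := by
    simp only [← intervalIntegral.integral_const_mul]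
    congr 1
    ext s
    congr 1
    ext r
    rw [he, he]
    ring
  set A := ∫ r in (0 : ℝ)..t, Real.exp (a * r) * r ^ h with hAdef
  set G := ∫ r in (0 : ℝ)..t, Real.exp (-(a * r)) * r ^ h with hGdef
  have e3 : ∫ s in (0 : ℝ)..t, Real.exp (a * s) *
        ∫ r in (0 : ℝ)..t, Real.exp (a * r) * fbmCov h r s
      = 1 / 2 * (((Real.exp (a * t) - 1) / a) * A + A * ((Real.exp (a * t) - 1) / a)
        - ((Real.exp (2 * a * t) * G - A) / (2 * a) + (Real.exp (2 * a * t) * G - A) / (2 * a))) := by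
    nth_rewrite 2 [← integral_exp_mul_eq ha t]
    rw [hAdef, hGdef]
    nth_rewrite 1 [← integral_exp_mul_primitive_neg ha hh t]
    rw [← integral_exp_mul_primitive_sub ha hh t]
    rw [← intervalIntegral.integral_const_mul, ← intervalIntegral.integral_const_mul,
      ← intervalIntegral.integral_add (Continuous.intervalIntegrable (by fun_prop) _ _)
        (Continuous.intervalIntegrable (by fun_prop) _ _),
      ← intervalIntegral.integral_add (Continuous.intervalIntegrable (by fun_prop) _ _)
        (Continuous.intervalIntegrable (by fun_prop) _ _),
      ← intervalIntegral.integral_sub (Continuous.intervalIntegrable (by fun_prop) _ _)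
        (Continuous.intervalIntegrable (by fun_prop) _ _),
      ← intervalIntegral.integral_const_mul]
    refine intervalIntegral.integral_congr fun s hs => ?_
    rw [uIcc_of_le ht] at hs
    rw [integral_exp_mul_fbmCov ha hh hs.1 hs.2]
    have h4 : Real.exp (2 * a * s) = Real.exp (a * s) * Real.exp (a * s) := by
      rw [← Real.exp_add]; congr 1; ring
    rw [h4]
    ring
  rw [e1, e2, e3, integral_exp_mul_fbmCov ha hh ht le_rfl, ← hAdef, ← hGdef, sub_self,
    intervalIntegral.integral_same, fouVar, ← hAdef, ← hGdef]
  have h4 : Real.exp (2 * a * t) = Real.exp (a * t) * Real.exp (a * t) := by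
    rw [← Real.exp_add]; congr 1; ring
  have h5 : Real.exp (-(2 * a * t)) = Real.exp (-(a * t)) * Real.exp (-(a * t)) := by
    rw [← Real.exp_add]; congr 1; ring
  have h6 : Real.exp (-(a * t)) = (Real.exp (a * t))⁻¹ := Real.exp_neg _
  have h7 : Real.exp (a * t) ≠ 0 := (Real.exp_pos _).ne'
  rw [h4, h5, h6]
  field_simp
  ring

/-! ### Gaussianity of the fractional Ornstein-Uhlenbeck process -/

namespace IsFractionalBrownianMotion

variable {Ω : Type*} [MeasurableSpace Ω] {P : Measure Ω} {H : ℝ} {B : ℝ≥0 → Ω → ℝ}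

lemma integrable_mul (hB : IsFractionalBrownianMotion H B P) (s t : ℝ≥0) :
    Integrable (fun ω => B t ω * B s ω) P :=
  (hB.gaussian.hasGaussianLaw_eval t).memLp_two.integrable_mul
    (hB.gaussian.hasGaussianLaw_eval s).memLp_two

lemma integral_mul (hB : IsFractionalBrownianMotion H B P) (s t : ℝ≥0) :
    ∫ ω, B t ω * B s ω ∂P = fbmCov (2 * H) s t := hB.cov s t

lemma ae_zero (hB : IsFractionalBrownianMotion H B P) (hH : H ≠ 0) : ∀ᵐ ω ∂P, B 0 ω = 0 := by
  have h1 := hB.integral_mul 0 0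
  have h2 : fbmCov (2 * H) (0 : ℝ≥0) (0 : ℝ≥0) = 0 := by
    simp [fbmCov, Real.zero_rpow (mul_ne_zero two_ne_zero hH)]
  rw [h2, integral_eq_zero_iff_of_nonneg (fun ω => mul_self_nonneg _) (hB.integrable_mul 0 0)] at h1
  filter_upwards [h1] with ω hω
  exact mul_self_eq_zero.1 hω

/-- A finite combination of values of a Gaussian process is Gaussian, so its characteristic function
is determined by the mean, here zero, and the quadratic form of covariances. -/
lemma integral_exp_sum (hB : IsFractionalBrownianMotion H B P) (c : ℕ → ℝ) (s : ℕ → ℝ≥0) (n : ℕ)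
    (ξ : ℝ) :
    ∫ ω, Complex.exp (ξ * (∑ k ∈ Finset.range n, c k * B (s k) ω : ℝ) * Complex.I) ∂P
      = Complex.exp (-(ξ ^ 2 * (∑ k ∈ Finset.range n, ∑ j ∈ Finset.range n,
        c k * (c j * fbmCov (2 * H) (s j) (s k)) : ℝ) / 2)) := by
  set X : Ω → ℝ := fun ω => ∑ k ∈ Finset.range n, c k * B (s k) ω with hX
  have hG : HasGaussianLaw X P :=
    ((hB.gaussian.comp_right s).smul c).hasGaussianLaw_fun_sum
  have hmean : ∫ ω, X ω ∂P = 0 := by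
    rw [integral_finsetSum _ fun k _ =>
      (hB.gaussian.hasGaussianLaw_eval (s k)).integrable.const_mul (c k)]
    refine Finset.sum_eq_zero fun k _ => ?_
    rw [integral_const_mul, hB.mean, mul_zero]
  have hvar : variance X P = ∑ k ∈ Finset.range n, ∑ j ∈ Finset.range n,
      c k * (c j * fbmCov (2 * H) (s j) (s k)) := by
    rw [variance_of_integral_eq_zero hG.aemeasurable hmean]
    have h1 : ∀ ω, X ω ^ 2 = ∑ k ∈ Finset.range n, ∑ j ∈ Finset.range n,
        c k * (c j * (B (s k) ω * B (s j) ω)) := fun ω => by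
      rw [sq, hX, Finset.sum_mul_sum]
      refine Finset.sum_congr rfl fun k _ => Finset.sum_congr rfl fun j _ => ?_
      ring
    simp only [h1]
    have h2 : ∀ k j, Integrable (fun ω => c k * (c j * (B (s k) ω * B (s j) ω))) P := fun k j =>
      ((hB.integrable_mul _ _).const_mul _).const_mul _
    rw [integral_finsetSum _ fun k _ => integrable_finsetSum _ fun j _ => h2 k j]
    refine Finset.sum_congr rfl fun k _ => ?_
    rw [integral_finsetSum _ fun j _ => h2 k j]
    refine Finset.sum_congr rfl fun j _ => ?_
    rw [integral_const_mul, integral_const_mul, hB.integral_mul]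
  have h1 := hG.map_eq_gaussianReal
  rw [hmean] at h1
  have h2 := charFun_gaussianReal (μ := 0) (v := (variance X P).toNNReal) ξ
  rw [← h1, charFun_apply_real, integral_map hG.aemeasurable
    (Continuous.aestronglyMeasurable (by fun_prop))] at h2
  rw [h2, ← hvar]
  congr 1
  rw [Real.coe_toNNReal _ (variance_nonneg _ _)]
  push_cast
  ring

lemma integral_exp_sub_sum (hB : IsFractionalBrownianMotion H B P) (c : ℕ → ℝ) (s : ℕ → ℝ≥0)
    (t : ℝ≥0) (n : ℕ) (ξ : ℝ) :
    ∫ ω, Complex.exp (ξ * (B t ω - ∑ k ∈ Finset.range n, c k * B (s k) ω : ℝ) * Complex.I) ∂P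
      = Complex.exp (-(ξ ^ 2 * (fbmCov (2 * H) t t
        - 2 * ∑ k ∈ Finset.range n, c k * fbmCov (2 * H) (s k) t
        + ∑ k ∈ Finset.range n, ∑ j ∈ Finset.range n,
          c k * (c j * fbmCov (2 * H) (s j) (s k)) : ℝ) / 2)) := by
  -- The value at t is adjoined as node n with weight 1, the other weights changing sign, so that
  -- the formula for plain sums applies.
  have h1 := hB.integral_exp_sum (fun k => if k < n then -c k else 1)
    (fun k => if k < n then s k else t) (n + 1) ξ
  simp only [Finset.sum_range_succ, lt_self_iff_false, if_false] at h1
  have hcomm : ∀ u v : ℝ, fbmCov (2 * H) u v = fbmCov (2 * H) v u := fun u v => by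
    unfold fbmCov
    rw [abs_sub_comm]
    ring
  have h2 : ∀ F : ℝ → ℝ≥0 → ℝ, ∑ k ∈ Finset.range n, F (if k < n then -c k else 1)
      (if k < n then s k else t) = ∑ k ∈ Finset.range n, F (-c k) (s k) := fun F =>
    Finset.sum_congr rfl fun k hk => by rw [if_pos (Finset.mem_range.1 hk),
      if_pos (Finset.mem_range.1 hk)]
  have h3 := fun ω => h2 fun c s => c * B s ω
  have h4 := fun (k : ℝ) (u : ℝ) => h2 fun c s => k * (c * fbmCov (2 * H) s u)
  have h5 := h2 fun c' s' => ∑ j ∈ Finset.range n, c' * (-c j * fbmCov (2 * H) (s j) s')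
    + c' * (1 * fbmCov (2 * H) t s')
  beta_reduce at h3 h4 h5
  simp only [h3, h4, h5] at h1
  convert h1 using 1
  · congr 1
    ext ω
    congr 3
    simp only [neg_mul, Finset.sum_neg_distrib, one_mul]
    ring_nf
  · congr 4
    simp only [Finset.sum_add_distrib, neg_mul, mul_neg, neg_neg, Finset.sum_neg_distrib, one_mul,
      hcomm (t : ℝ)]
    ring_nf

/-- Independence factors the expectation. Keeping the event attached to Y replaces conditioning: Y
will be the path of the subordinator, and the event a condition on the random time. -/
lemma setIntegral_exp_sub_sum (hB : IsFractionalBrownianMotion H B P) {𝓨 : Type*}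
    [MeasurableSpace 𝓨] {Y : Ω → 𝓨} (hY : AEMeasurable Y P)
    (hBY : IndepFun (fun ω t => B t ω) Y P) {S : Set 𝓨} (hS : MeasurableSet S)
    (c : ℕ → ℝ) (s : ℕ → ℝ≥0) (t : ℝ≥0) (n : ℕ) (ξ : ℝ) :
    ∫ ω, (Y ⁻¹' S).indicator (fun ω => Complex.exp (ξ * (B t ω
        - ∑ k ∈ Finset.range n, c k * B (s k) ω : ℝ) * Complex.I)) ω ∂P
      = P.real (Y ⁻¹' S) * Complex.exp (-(ξ ^ 2 * (fbmCov (2 * H) t t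
        - 2 * ∑ k ∈ Finset.range n, c k * fbmCov (2 * H) (s k) t
        + ∑ k ∈ Finset.range n, ∑ j ∈ Finset.range n,
          c k * (c j * fbmCov (2 * H) (s j) (s k)) : ℝ) / 2)) := by
  have h1 := hBY.integral_fun_comp_mul_comp (𝕜 := ℂ)
    (f := fun b => Complex.exp (ξ * (b t - ∑ k ∈ Finset.range n, c k * b (s k) : ℝ) * Complex.I))
    (g := S.indicator fun _ => 1) (measurable_pi_lambda _ hB.measurable).aemeasurable hY
    (Measurable.aestronglyMeasurable (by fun_prop))
    (measurable_const.indicator hS).aestronglyMeasurable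
  have h2 : ∫ ω, (S.indicator (fun _ => (1 : ℂ)) (Y ω)) ∂P = P.real (Y ⁻¹' S) := by
    have : ∀ ω, S.indicator (fun _ => (1 : ℂ)) (Y ω) = (Y ⁻¹' S).indicator (fun _ => 1) ω :=
      fun ω => rfl
    simp only [this]
    rw [integral_indicator₀ (hY.nullMeasurable hS)]
    simp [Measure.real]
  rw [h2, hB.integral_exp_sub_sum] at h1
  rw [mul_comm, ← h1]
  congr 1
  ext ω
  by_cases hω : Y ω ∈ S
  · rw [indicator_of_mem (show ω ∈ Y ⁻¹' S from hω), indicator_of_mem hω, mul_one]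
  · rw [indicator_of_notMem (show ω ∉ Y ⁻¹' S from hω), indicator_of_notMem hω, mul_zero]

end IsFractionalBrownianMotion

/-! ### Passage from Riemann sums to the Ornstein–Uhlenbeck process -/

lemma fOU_eq {Ω : Type*} {θ : ℝ} {B : ℝ≥0 → Ω → ℝ} {ω : Ω} (h0 : B 0 ω = 0) (t : ℝ≥0) :
    fOU θ B t ω = B t ω
      - ∫ s in (0 : ℝ)..t, 1 / θ * Real.exp (-(1 / θ * (t - s))) * B s.toNNReal ω := by
  rw [fOU, expIntegral, h0, sub_zero, mul_sub, ← mul_assoc, ← Real.exp_add, neg_add_cancel,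
    Real.exp_zero, one_mul, ← intervalIntegral.integral_const_mul]
  congr 2
  ext s
  have : Real.exp (-(1 / θ * (t - s))) = Real.exp (-(t / θ)) * Real.exp (s / θ) := by
    rw [← Real.exp_add]; congr 1; ring
  rw [this]
  ring

section FOU

variable {Ω : Type*} [MeasurableSpace Ω] {P : Measure Ω}
  {H θ : ℝ} {B : ℝ≥0 → Ω → ℝ}

noncomputable section

/-- The weight of the `k`-th node in the Riemann sum for the fractional Ornstein-Uhlenbeck
process. -/
def fouWeight (θ : ℝ) (t : ℝ≥0) (n k : ℕ) : ℝ :=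
  t / n * (1 / θ * Real.exp (-(1 / θ * (t - t * k / n))))

/-- The `k`-th node in the Riemann sum for the fractional Ornstein-Uhlenbeck process. -/
def fouNode (t : ℝ≥0) (n k : ℕ) : ℝ≥0 := t * k / n

/-- The approximation of the fractional Ornstein-Uhlenbeck process by Riemann sums. -/
def fouApprox (θ : ℝ) (B : ℝ≥0 → Ω → ℝ) (t : ℝ≥0) (n : ℕ) (ω : Ω) : ℝ :=
  B t ω - ∑ k ∈ Finset.range n, fouWeight θ t n k * B (fouNode t n k) ω

end

lemma tendsto_fouApprox (hB : IsFractionalBrownianMotion H B P) (hH : H ≠ 0) :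
    ∀ᵐ ω ∂P, ∀ t, Tendsto (fun n => fouApprox θ B t n ω) atTop (𝓝 (fOU θ B t ω)) := by
  filter_upwards [hB.continuous, hB.ae_zero hH] with ω hc h0 t
  rw [fOU_eq h0]
  refine tendsto_const_nhds.sub ?_
  have hcont : Continuous fun s : ℝ =>
      1 / θ * Real.exp (-(1 / θ * (t - s))) * B s.toNNReal ω :=
    (by fun_prop : Continuous fun s : ℝ => 1 / θ * Real.exp (-(1 / θ * (t - s)))).mul
      (hc.comp continuous_real_toNNReal)
  refine (tendsto_riemannSum t.coe_nonneg hcont.continuousOn).congr fun n => ?_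
  refine Finset.sum_congr rfl fun k _ => ?_
  have : (t * k / n : ℝ).toNNReal = fouNode t n k := by
    rw [fouNode, ← Real.toNNReal_coe (r := t * k / n)]
    push_cast
    rfl
  beta_reduce
  rw [this, fouWeight]
  ring

lemma tendsto_variance_fouApprox (hθ : 0 < θ) (hH : 0 < H) (t : ℝ≥0) :
    Tendsto (fun n => fbmCov (2 * H) t t
        - 2 * ∑ k ∈ Finset.range n, fouWeight θ t n k * fbmCov (2 * H) (fouNode t n k) t
        + ∑ k ∈ Finset.range n, ∑ j ∈ Finset.range n, fouWeight θ t n k *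
          (fouWeight θ t n j * fbmCov (2 * H) (fouNode t n j) (fouNode t n k)))
      atTop (𝓝 (fouVar (1 / θ) (2 * H) t)) := by
  have hh : 0 < 2 * H := by linarith
  have hcov := continuous_fbmCov hh
  rw [← variance_integral_eq_fouVar (by positivity) hh t.coe_nonneg]
  have h0 : fbmCov (2 * H) t t = (t : ℝ) ^ (2 * H) := by
    simp [fbmCov, Real.zero_rpow hh.ne']
    ring
  rw [h0]
  have hnode : ∀ n k, (fouNode t n k : ℝ) = t * k / n := fun n k => by simp [fouNode]
  refine (tendsto_const_nhds.sub (Tendsto.const_mul 2 ?_)).add ?_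
  · have hc : Continuous fun s : ℝ =>
        1 / θ * Real.exp (-(1 / θ * (t - s))) * fbmCov (2 * H) s t :=
      (by fun_prop : Continuous fun s : ℝ => 1 / θ * Real.exp (-(1 / θ * (t - s)))).mul
        (hcov.comp (by fun_prop : Continuous fun s : ℝ => (s, (t : ℝ))))
    refine (tendsto_riemannSum t.coe_nonneg hc.continuousOn).congr fun n => ?_
    refine Finset.sum_congr rfl fun k _ => ?_
    rw [hnode, fouWeight]
    ring
  · have hc : Continuous (Function.uncurry fun s r : ℝ => 1 / θ * Real.exp (-(1 / θ * (t - s))) *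
        (1 / θ * Real.exp (-(1 / θ * (t - r))) * fbmCov (2 * H) r s)) := by
      have := hcov.comp (by fun_prop : Continuous fun p : ℝ × ℝ => (p.2, p.1))
      have h2 : Continuous fun p : ℝ × ℝ => fbmCov (2 * H) p.2 p.1 := this
      unfold Function.uncurry
      fun_prop
    refine (tendsto_riemannSum_riemannSum t.coe_nonneg hc).congr fun n => ?_
    refine Finset.sum_congr rfl fun k _ => ?_
    beta_reduce
    unfold riemannSum
    rw [Finset.mul_sum]
    refine Finset.sum_congr rfl fun j _ => ?_
    rw [hnode, hnode, fouWeight, fouWeight]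
    ring

lemma measurable_fouApprox (hB : IsFractionalBrownianMotion H B P) (t : ℝ≥0) (n : ℕ) :
    Measurable (fouApprox θ B t n) := by
  have := hB.measurable
  unfold fouApprox
  fun_prop

lemma aemeasurable_fOU (hB : IsFractionalBrownianMotion H B P) (hH : H ≠ 0) (t : ℝ≥0) :
    AEMeasurable (fOU θ B t) P := by
  refine aemeasurable_of_tendsto_metrizable_ae' (f := fun n => fouApprox θ B t n)
    (fun n => (measurable_fouApprox hB t n).aemeasurable) ?_
  filter_upwards [tendsto_fouApprox (θ := θ) hB hH] with ω hω using hω t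

lemma continuous_fOU (hB : IsFractionalBrownianMotion H B P) :
    ∀ᵐ ω ∂P, Continuous fun t => fOU θ B t ω := by
  filter_upwards [hB.continuous] with ω hc
  have h1 : Continuous fun s : ℝ => 1 / θ * Real.exp (s / θ) * B s.toNNReal ω :=
    (by fun_prop : Continuous fun s : ℝ => 1 / θ * Real.exp (s / θ)).mul
      (hc.comp continuous_real_toNNReal)
  have h2 : Continuous fun t : ℝ≥0 =>
      ∫ s in (0 : ℝ)..t, 1 / θ * Real.exp (s / θ) * B s.toNNReal ω :=
    (continuous_integral_of_continuous h1).comp NNReal.continuous_coe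
  unfold fOU expIntegral
  fun_prop

lemma norm_exp_mul_I (ξ y : ℝ) : ‖Complex.exp (ξ * y * Complex.I)‖ = 1 := by
  rw [← Complex.ofReal_mul, Complex.norm_exp_ofReal_mul_I]

/-- Both sides pass to the limit along Riemann sums: the left by dominated convergence, the
exponentials having modulus one, and the right by convergence of the variances. So U(t) is Gaussian
and independent of Y. -/
lemma setIntegral_exp_fOU [IsProbabilityMeasure P] (hB : IsFractionalBrownianMotion H B P) (hθ : 0 < θ) (hH : 0 < H)
    {𝓨 : Type*} [MeasurableSpace 𝓨] {Y : Ω → 𝓨} (hY : AEMeasurable Y P)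
    (hBY : IndepFun (fun ω t => B t ω) Y P) {S : Set 𝓨} (hS : MeasurableSet S) (t : ℝ≥0)
    (ξ : ℝ) :
    ∫ ω in Y ⁻¹' S, Complex.exp (ξ * fOU θ B t ω * Complex.I) ∂P
      = P.real (Y ⁻¹' S) * Complex.exp (-(ξ ^ 2 * fouVar (1 / θ) (2 * H) t / 2)) := by
  have hS' := hY.nullMeasurable hS
  rw [← integral_indicator₀ hS']
  refine tendsto_nhds_unique (f := fun n => ∫ ω, (Y ⁻¹' S).indicator (fun ω =>
    Complex.exp (ξ * fouApprox θ B t n ω * Complex.I)) ω ∂P) (l := atTop) ?_ ?_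
  · refine tendsto_integral_of_dominated_convergence (fun _ => 1) (fun n => ?_)
      (integrable_const _) (fun n => Eventually.of_forall fun ω => ?_) ?_
    · have := measurable_fouApprox (θ := θ) hB t n
      exact AEStronglyMeasurable.indicator₀ (Measurable.aestronglyMeasurable (by fun_prop)) hS'
    · refine (norm_indicator_le_norm_self _ _).trans ?_
      rw [norm_exp_mul_I]
    · filter_upwards [tendsto_fouApprox (θ := θ) hB hH.ne'] with ω hω
      have h1 : Tendsto (fun n => Complex.exp (ξ * fouApprox θ B t n ω * Complex.I)) atTop
          (𝓝 (Complex.exp (ξ * fOU θ B t ω * Complex.I))) :=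
        ((by fun_prop : Continuous fun y : ℝ => Complex.exp (ξ * y * Complex.I)).tendsto _).comp
          (hω t)
      by_cases hm : ω ∈ Y ⁻¹' S
      · simpa only [indicator_of_mem hm] using h1
      · simp only [indicator_of_notMem hm, tendsto_const_nhds_iff]
  · have h1 := ((by fun_prop : Continuous fun v : ℝ =>
      (P.real (Y ⁻¹' S) : ℂ) * Complex.exp (-(ξ ^ 2 * v / 2))).tendsto _).comp
        (tendsto_variance_fouApprox hθ hH t)
    refine h1.congr fun n => ?_
    exact (hB.setIntegral_exp_sub_sum hY hBY hS _ _ t n ξ).symm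

lemma fouVar_nonneg {a h : ℝ} (hh : 1 < h) {t : ℝ} (ht : 0 ≤ t) : 0 ≤ fouVar a h t := by
  rcases ht.eq_or_lt with rfl | ht
  · rw [fouVar_zero (by linarith)]
  · exact (fouVar_pos hh ht).le

lemma map_fOU [IsProbabilityMeasure P] (hB : IsFractionalBrownianMotion H B P) (hθ : 0 < θ) (hH : 1 / 2 < H) (t : ℝ≥0) :
    P.map (fOU θ B t) = gaussianReal 0 (fouVar (1 / θ) (2 * H) t).toNNReal := by
  have hU := aemeasurable_fOU (θ := θ) hB (by linarith) t
  have := Measure.isProbabilityMeasure_map hU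
  refine Measure.ext_of_charFun (funext fun ξ => ?_)
  have h1 := setIntegral_exp_fOU hB hθ (by linarith) (Y := fun _ => ()) aemeasurable_const
    (indepFun_const_right _ _) MeasurableSet.univ t ξ
  simp only [preimage_univ, Measure.restrict_univ, probReal_univ] at h1
  rw [charFun_apply_real, integral_map hU (Continuous.aestronglyMeasurable (by fun_prop)), h1,
    charFun_gaussianReal, Real.coe_toNNReal _ (fouVar_nonneg (by linarith) t.coe_nonneg)]
  push_cast
  rw [one_mul]
  congr 1
  ring

lemma varianceFun_fOU [IsProbabilityMeasure P] (hB : IsFractionalBrownianMotion H B P) (hθ : 0 < θ) (hH : 1 / 2 < H)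
    {t : ℝ} (ht : 0 ≤ t) : varianceFun P (fOU θ B) t = fouVar (1 / θ) (2 * H) t := by
  have hU := aemeasurable_fOU (θ := θ) hB (by linarith) t.toNNReal
  have h1 := variance_of_integral_eq_zero (X := id)
    (μ := gaussianReal 0 (fouVar (1 / θ) (2 * H) t).toNNReal) aemeasurable_id (by simp)
  rw [variance_id_gaussianReal, Real.coe_toNNReal _ (fouVar_nonneg (by linarith) ht)] at h1
  rw [varianceFun, h1]
  have h2 := map_fOU hB hθ hH t.toNNReal
  rw [Real.coe_toNNReal _ ht] at h2
  rw [← h2, integral_map hU (Continuous.aestronglyMeasurable (by fun_prop))]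
  simp

end FOU

/-! ### First passage times -/

noncomputable section

open Classical in
/-- The infimum of the positive rational times at which the path `f` exceeds `t`. -/
def firstPassage (f : ℝ≥0 → ℝ) (t : ℝ) : ℝ≥0∞ :=
  ⨅ q : ℚ, if 0 < q ∧ t < f (q : ℝ).toNNReal then ENNReal.ofReal q else ⊤

end

/-- Only rational levels of the operational time enter, so a countable infimum gives joint
measurability in the path and the time. -/
lemma measurable_firstPassage :
    Measurable fun p : (ℝ≥0 → ℝ) × ℝ => firstPassage p.1 p.2 := by
  refine Measurable.iInf fun q => Measurable.ite ?_ measurable_const measurable_const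
  by_cases hq : 0 < q
  · simp only [hq, true_and]
    exact measurableSet_lt measurable_snd ((measurable_pi_apply _).comp measurable_fst)
  · simp [hq]

/-- Along a monotone path, any admissible level can be replaced by a slightly larger rational one,
so rationals suffice. If no level is admissible, both sides take the default value 0. -/
lemma firstPassage_toNNReal {f : ℝ≥0 → ℝ} (hf : Monotone f) (t : ℝ) :
    (firstPassage f t).toNNReal = sInf {y : ℝ≥0 | 0 < y ∧ t < f y} := by
  set A := {y : ℝ≥0 | 0 < y ∧ t < f y} with hA
  have hmem : ∀ q : ℚ, 0 < q → t < f (q : ℝ).toNNReal → (q : ℝ).toNNReal ∈ A := fun q hq h =>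
    ⟨by simpa using hq, h⟩
  rcases A.eq_empty_or_nonempty with h0 | hne
  · have : firstPassage f t = ⊤ := by
      refine iInf_eq_top.2 fun q => if_neg fun h => ?_
      have := hmem q h.1 h.2
      rw [h0] at this
      exact this
    rw [this, h0]
    simp
  · suffices h : firstPassage f t = (sInf A : ℝ≥0) by rw [h, ENNReal.toNNReal_coe]
    refine le_antisymm ?_ (le_iInf fun q => ?_)
    · rw [ENNReal.coe_sInf hne]
      refine le_iInf₂ fun y hy => ?_
      refine ENNReal.le_of_forall_pos_le_add fun ε hε _ => ?_
      obtain ⟨q, hq1, hq2⟩ := exists_rat_btwn (show (y : ℝ) < y + ε by simpa using hε)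
      have hq0 : (0 : ℝ) < q := lt_of_le_of_lt y.coe_nonneg hq1
      have hyq : y ≤ (q : ℝ).toNNReal := NNReal.le_toNNReal_of_coe_le hq1.le
      have h1 : firstPassage f t ≤ ENNReal.ofReal q := by
        refine (iInf_le _ q).trans ?_
        rw [if_pos ⟨by exact_mod_cast hq0, hy.2.trans_le (hf hyq)⟩]
      refine h1.trans ?_
      rw [← ENNReal.coe_add, ENNReal.ofReal, ENNReal.coe_le_coe, Real.toNNReal_le_iff_le_coe]
      exact_mod_cast hq2.le
    · split_ifs with h
      · rw [ENNReal.ofReal, ENNReal.coe_le_coe]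
        exact csInf_le (OrderBot.bddBelow _) (hmem q h.1 h.2)
      · exact le_top

namespace IsSubordinator

variable {Ω : Type*} [MeasurableSpace Ω] {ν : Measure ℝ} {σ : ℝ≥0 → Ω → ℝ} {P : Measure Ω}

lemma ae_nonneg (hσ : IsSubordinator ν σ P) : ∀ᵐ ω ∂P, ∀ y, 0 ≤ σ y ω := by
  filter_upwards [hσ.zero, hσ.monotone] with ω h0 hm y
  rw [← h0]
  exact hm (zero_le (a := y))

lemma integrable_exp [IsProbabilityMeasure P] (hσ : IsSubordinator ν σ P) (y : ℝ≥0) {r : ℝ}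
    (hr : r ≤ 0) : Integrable (fun ω => Real.exp (r * σ y ω)) P := by
  have := hσ.measurable y
  refine Integrable.mono' (integrable_const 1)
    (Measurable.aestronglyMeasurable (by fun_prop)) ?_
  filter_upwards [hσ.ae_nonneg] with ω hω
  rw [Real.norm_eq_abs, Real.abs_exp, Real.exp_le_one_iff]
  exact mul_nonpos_of_nonpos_of_nonneg hr (hω y)

/-- Both sides are holomorphic, the left because the process is almost surely nonnegative and its
complex moment generating function is analytic on the left half-plane; they agree at positive reals
by definition. -/
lemma integral_exp_neg_mul [IsProbabilityMeasure P] (hσ : IsSubordinator ν σ P)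
    (hν : IsSubordinatorLevyMeasure ν) (y : ℝ≥0) {l : ℂ} (hl : l ∈ rightHalfPlane) :
    ∫ ω, Complex.exp (-(l * σ y ω)) ∂P = Complex.exp (-(y * laplaceExponent ν l)) := by
  have hmgf : ∀ l : ℂ, ∫ ω, Complex.exp (-(l * σ y ω)) ∂P = complexMGF (σ y) P (-l) := fun l => by
    simp [complexMGF]
  refine eqOn_rightHalfPlane_of_ofReal (f := fun l => ∫ ω, Complex.exp (-(l * σ y ω)) ∂P)
    (g := fun l => Complex.exp (-(y * laplaceExponent ν l))) ?_ ?_ (fun r hr => ?_) hl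
  · simp only [hmgf]
    intro z hz
    have hz : 0 < z.re := hz
    refine DifferentiableAt.differentiableWithinAt ?_
    refine DifferentiableAt.fun_comp' (f := fun z : ℂ => -z) z ?_ (by fun_prop)
    refine (hasDerivAt_complexMGF ?_).differentiableAt
    refine interior_maximal (s := integrableExpSet (σ y) P) (t := Iio 0) (fun r hr => ?_) isOpen_Iio
      (by simpa using hz)
    exact hσ.integrable_exp y (le_of_lt hr)
  · have := hν.differentiableOn_laplaceExponent
    fun_prop
  · have h1 := hσ.laplace y r hr
    rw [laplaceExponent_ofReal]
    have h2 : ∫ ω, Complex.exp (-(r * σ y ω)) ∂P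
        = ((∫ ω, Real.exp (-(r * σ y ω)) ∂P : ℝ) : ℂ) := by
      rw [← integral_complex_ofReal]
      simp
    rw [h2, h1]
    push_cast
    rfl

/-- If m is the exponent at 1, the expectation of e^(-σ(n)) is e^(-nm), which tends to 0; an event
on which σ(n) ≤ M for every n therefore has probability zero. Thus E(t) is never the infimum of an
empty set. -/
lemma ae_unbounded [IsProbabilityMeasure P] (hσ : IsSubordinator ν σ P)
    (hν : IsSubordinatorLevyMeasure ν) (hν0 : ν (Ioi 0) ≠ 0) :
    ∀ᵐ ω ∂P, ∀ t : ℝ, ∃ y : ℝ≥0, 0 < y ∧ t < σ y ω := by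
  have hΨ : 0 < ∫ x, (1 - Real.exp (-(1 * x))) ∂ν := by
    have h1 := hν.re_laplaceExponent_pos hν0 (l := (1 : ℝ)) (by simp [rightHalfPlane])
    rw [laplaceExponent_ofReal] at h1
    exact h1
  set m := ∫ x, (1 - Real.exp (-(1 * x))) ∂ν with hm
  have hlim : Tendsto (fun n : ℕ => Real.exp (-(n * m))) atTop (𝓝 0) := by
    refine Real.tendsto_exp_neg_atTop_nhds_zero.comp ?_
    exact tendsto_natCast_atTop_atTop.atTop_mul_const hΨ
  have hnull : ∀ M : ℕ, ∀ᵐ ω ∂P, ∃ n : ℕ, (M : ℝ) < σ n ω := by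
    intro M
    set S := {ω | ∀ n : ℕ, σ n ω ≤ M} with hS
    have hSm : MeasurableSet S := by
      rw [hS, Set.ofPred_forall]
      exact MeasurableSet.iInter fun n => measurableSet_le (hσ.measurable _) measurable_const
    have hle : ∀ n : ℕ, P.real S * Real.exp (-M) ≤ Real.exp (-(n * m)) := fun n => by
      have h1 := hσ.laplace n 1 one_pos
      have hi := hσ.integrable_exp (n : ℝ≥0) (r := -1) (by norm_num)
      simp only [neg_mul, one_mul] at hi
      rw [← hm] at h1
      simp only [one_mul, NNReal.coe_natCast] at h1
      rw [← h1]
      calc P.real S * Real.exp (-M) = ∫ _ in S, Real.exp (-M) ∂P := by simp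
        _ ≤ ∫ ω in S, Real.exp (-σ n ω) ∂P := by
          refine setIntegral_mono_on (by simp) hi.integrableOn hSm fun ω hω => ?_
          exact Real.exp_le_exp.2 (neg_le_neg (hω n))
        _ ≤ _ := setIntegral_le_integral hi (Eventually.of_forall fun ω => (Real.exp_pos _).le)
    have h0 : P.real S * Real.exp (-M) ≤ 0 := ge_of_tendsto' hlim hle
    have h1 : P.real S = 0 := le_antisymm
      (nonpos_of_mul_nonpos_left h0 (Real.exp_pos _)) measureReal_nonneg
    rw [measureReal_eq_zero_iff] at h1
    rw [ae_iff]
    convert h1 using 2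
    ext ω
    simp [hS]
  filter_upwards [ae_all_iff.2 hnull, hσ.monotone] with ω hω hmono t
  obtain ⟨n, hn⟩ := hω ⌈t⌉₊
  refine ⟨n + 1, by positivity, ((Nat.le_ceil t).trans_lt hn).trans_le (hmono ?_)⟩
  simp

/-- The almost sure relation between a subordinator and its first passage times. -/
lemma ae_firstPassage [IsProbabilityMeasure P] (hσ : IsSubordinator ν σ P)
    (hν : IsSubordinatorLevyMeasure ν) (hν0 : ν (Ioi 0) ≠ 0) :
    ∀ᵐ ω ∂P, ∀ s : ℝ≥0, 0 < s → ∀ t : ℝ, t ≠ σ s ω →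
      (s < (firstPassage (fun y => σ y ω) t).toNNReal ↔ σ s ω < t) := by
  filter_upwards [hσ.monotone, hσ.rightContinuous, hσ.ae_unbounded hν hν0]
    with ω hm hr hu s hs t hts
  rw [firstPassage_toNNReal hm]
  refine ⟨fun h => ?_, fun h => ?_⟩
  · by_contra hlt
    have hlt' : t < σ s ω := lt_of_le_of_ne (not_lt.1 hlt) hts
    exact absurd (csInf_le (OrderBot.bddBelow _) (show s ∈ {y | 0 < y ∧ t < σ y ω} from ⟨hs, hlt'⟩))
      (not_le.2 h)
  -- Right-continuity keeps the path below t a little beyond s, which makes the inequality s < E(t)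
  -- strict.
  · have h1 : ∀ᶠ z in 𝓝[>] s, σ z ω < t :=
      ((hr s).mono Ioi_subset_Ici_self).eventually_lt_const h
    obtain ⟨z, hz1, hz2⟩ := (h1.and self_mem_nhdsWithin).exists
    refine lt_of_lt_of_le hz2 (le_csInf (hu t) fun y hy => ?_)
    by_contra hlt
    exact absurd (hm (not_le.1 hlt).le) (not_le.2 (hz1.trans hy.2))

lemma ae_inverseSubordinator (hσ : IsSubordinator ν σ P) :
    ∀ᵐ ω ∂P, ∀ t : ℝ≥0,
      inverseSubordinator σ t ω = (firstPassage (fun y => σ y ω) t).toNNReal := by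
  filter_upwards [hσ.monotone] with ω hm t
  rw [firstPassage_toNNReal hm, inverseSubordinator]

lemma measurable_firstPassage_toNNReal (hσ : IsSubordinator ν σ P) :
    Measurable fun p : ℝ × Ω => (firstPassage (fun y => σ y p.2) p.1).toNNReal :=
  (measurable_firstPassage.comp (Measurable.prodMk (measurable_pi_lambda _ fun y =>
    (hσ.measurable y).comp measurable_snd) measurable_fst)).ennreal_toNNReal

/-- The Laplace transform in time of the indicator of `s < E(t)`. -/
lemma integral_exp_mul_indicator_firstPassage [IsProbabilityMeasure P] (hσ : IsSubordinator ν σ P)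
    (hν : IsSubordinatorLevyMeasure ν) (hν0 : ν (Ioi 0) ≠ 0) {l : ℂ} (hl : l ∈ rightHalfPlane) :
    ∀ᵐ ω ∂P, ∀ s : ℝ≥0, 0 < s → ∫ t in Ioi (0 : ℝ), {t : ℝ | s <
      (firstPassage (fun y => σ y ω) t).toNNReal}.indicator (fun t => Complex.exp (-(l * t))) t
      = Complex.exp (-(l * σ s ω)) / l := by
  filter_upwards [hσ.ae_nonneg, hσ.ae_firstPassage hν hν0] with ω h0 hω s hs
  have hl0 : l ≠ 0 := by
    rintro rfl
    simp [rightHalfPlane] at hl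
  have h1 := integral_exp_mul_complex_Ioi (a := -l) (by simpa [rightHalfPlane] using hl) (σ s ω)
  have h2 : ∫ t in Ioi (0 : ℝ), {t : ℝ | s < (firstPassage (fun y => σ y ω) t).toNNReal}.indicator
      (fun t : ℝ => Complex.exp (-(l * t))) t
      = ∫ t in Ioi (0 : ℝ), (Ioi (σ s ω)).indicator (fun t : ℝ => Complex.exp (-(l * t))) t := by
    refine integral_congr_ae (ae_restrict_of_ae ?_)
    -- Only the single time t = σ(s), where the equivalence may fail, has to be discarded.
    filter_upwards [compl_mem_ae_iff.2 (measure_singleton (μ := (volume : Measure ℝ)) (σ s ω))]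
      with t ht
    simp only [indicator, mem_ofPred_eq, mem_Ioi, hω s hs t ht]
  rw [h2, integral_indicator measurableSet_Ioi, Measure.restrict_restrict measurableSet_Ioi,
    Ioi_inter_Ioi, sup_of_le_left (h0 s)]
  simp only [neg_mul] at h1
  rw [h1]
  field_simp

end IsSubordinator

/-! ### Gaussian processes at independent random times -/

section RandomTime

variable {Ω : Type*} [MeasurableSpace Ω] {P : Measure Ω} {U : ℝ≥0 → Ω → ℝ} {τ : Ω → ℝ≥0}

/-- Countably many exceptional null sets may be united; this is why the random time is first rounded
down to a grid. -/
lemma aemeasurable_comp_countable {X : ℕ → Ω → ℝ} (hX : ∀ k, AEMeasurable (X k) P) {K : Ω → ℕ}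
    (hK : Measurable K) : AEMeasurable (fun ω => X (K ω) ω) P := by
  have h1 : Measurable fun p : Ω × ℕ => (hX p.2).mk _ p.1 :=
    measurable_from_prod_countable_left fun k => (hX k).measurable_mk
  refine ⟨fun ω => (hX (K ω)).mk _ ω, h1.comp (measurable_id.prodMk hK), ?_⟩
  filter_upwards [ae_all_iff.2 fun k => (hX k).ae_eq_mk] with ω hω using hω _

lemma tendsto_floor_mul_div (y : ℝ≥0) :
    Tendsto (fun n : ℕ => ((⌊(y : ℝ) * n⌋₊ : ℝ≥0) / n)) atTop (𝓝 y) := by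
  rw [← NNReal.tendsto_coe]
  have := (tendsto_nat_floor_mul_div_atTop (R := ℝ) y.coe_nonneg).comp tendsto_natCast_atTop_atTop
  simpa [Function.comp_def] using this

lemma measurable_floor_mul (hτ : Measurable τ) (n : ℕ) :
    Measurable fun ω => ⌊(τ ω : ℝ) * n⌋₊ :=
  Nat.measurable_floor.comp ((measurable_coe_nnreal_real.comp hτ).mul_const _)

lemma aemeasurable_randomTime (hU : ∀ t, AEMeasurable (U t) P)
    (hUc : ∀ᵐ ω ∂P, Continuous fun t => U t ω) (hτ : Measurable τ) :
    AEMeasurable (fun ω => U (τ ω) ω) P := by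
  refine aemeasurable_of_tendsto_metrizable_ae'
    (f := fun (n : ℕ) ω => U ((⌊(τ ω : ℝ) * n⌋₊ : ℝ≥0) / n) ω) (fun n => ?_) ?_
  · exact aemeasurable_comp_countable (X := fun k => U ((k : ℝ≥0) / n)) (fun k => hU _)
      (measurable_floor_mul hτ n)
  · filter_upwards [hUc] with ω hω
    exact (hω.tendsto _).comp (tendsto_floor_mul_div (τ ω))

lemma norm_exp_neg_sq_mul_le {v : ℝ} (hv : 0 ≤ v) (ξ : ℝ) :
    ‖Complex.exp (-(ξ ^ 2 * v / 2))‖ ≤ 1 := by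
  rw [Complex.norm_exp, Real.exp_le_one_iff]
  have : (-(ξ ^ 2 * v / 2) : ℂ) = ((-(ξ ^ 2 * v / 2) : ℝ) : ℂ) := by push_cast; rfl
  rw [this, Complex.ofReal_re]
  have : 0 ≤ ξ ^ 2 * v / 2 := by positivity
  linarith

/-- The characteristic function of a Gaussian process at an independent random time. -/
lemma integral_exp_randomTime [IsProbabilityMeasure P] (hU : ∀ t, AEMeasurable (U t) P)
    (hUc : ∀ᵐ ω ∂P, Continuous fun t => U t ω) (hτ : Measurable τ) {v : ℝ≥0 → ℝ}
    (hv : Continuous v) (hv0 : ∀ t, 0 ≤ v t) (ξ : ℝ)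
    (h : ∀ (t : ℝ≥0) (S : Set ℝ≥0), MeasurableSet S →
      ∫ ω in τ ⁻¹' S, Complex.exp (ξ * U t ω * Complex.I) ∂P
        = P.real (τ ⁻¹' S) * Complex.exp (-(ξ ^ 2 * v t / 2))) :
    ∫ ω, Complex.exp (ξ * U (τ ω) ω * Complex.I) ∂P
      = ∫ ω, Complex.exp (-(ξ ^ 2 * v (τ ω) / 2)) ∂P := by
  -- It suffices that the error G has zero expectation at the random time. On a grid this follows
  -- level by level from `h`; refining the grid passes to the limit, since paths and variance are
  -- continuous and G is bounded by 2.
  set G : ℝ≥0 → Ω → ℂ := fun t ω =>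
    Complex.exp (ξ * U t ω * Complex.I) - Complex.exp (-(ξ ^ 2 * v t / 2)) with hG
  have hGb : ∀ t ω, ‖G t ω‖ ≤ 2 := fun t ω => by
    refine (norm_sub_le _ _).trans ?_
    rw [norm_exp_mul_I]
    linarith [norm_exp_neg_sq_mul_le (hv0 t) ξ]
  have hexp : ∀ f : Ω → ℝ, AEMeasurable f P →
      AEStronglyMeasurable (fun ω => Complex.exp (ξ * f ω * Complex.I)) P := fun f hf =>
    (by fun_prop : Continuous fun y : ℝ =>
      Complex.exp (ξ * y * Complex.I)).comp_aestronglyMeasurable hf.aestronglyMeasurable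
  have hexp' : ∀ f : Ω → ℝ≥0, Measurable f →
      AEStronglyMeasurable (fun ω => Complex.exp (-(ξ ^ 2 * v (f ω) / 2))) P := fun f hf =>
    ((by fun_prop : Continuous fun t : ℝ≥0 =>
      Complex.exp (-(ξ ^ 2 * v t / 2))).measurable.comp hf).aestronglyMeasurable
  have hzero : ∀ n : ℕ, ∫ ω, G ((⌊(τ ω : ℝ) * n⌋₊ : ℝ≥0) / n) ω ∂P = 0 := by
    intro n
    have hK := measurable_floor_mul hτ n
    have hm : AEStronglyMeasurable (fun ω => G ((⌊(τ ω : ℝ) * n⌋₊ : ℝ≥0) / n) ω) P :=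
      (hexp _ (aemeasurable_comp_countable (X := fun k => U ((k : ℝ≥0) / n)) (fun k => hU _)
        hK)).sub (hexp' _ ((measurable_from_top (f := fun k : ℕ => (k : ℝ≥0) / n)).comp hK))
    have hi : Integrable (fun ω => G ((⌊(τ ω : ℝ) * n⌋₊ : ℝ≥0) / n) ω) P :=
      Integrable.mono' (integrable_const 2) hm (Eventually.of_forall fun ω => hGb _ _)
    have huniv : ⋃ k : ℕ, (fun ω => ⌊(τ ω : ℝ) * n⌋₊) ⁻¹' {k} = univ := by
      rw [← preimage_iUnion, iUnion_of_singleton, preimage_univ]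
    rw [← setIntegral_univ, ← huniv, integral_iUnion (fun k => hK (measurableSet_singleton k))
      (fun i j hij => Disjoint.preimage _ (by simpa using hij)) hi.integrableOn]
    refine (tsum_congr fun k => ?_).trans tsum_zero
    set S : Set ℝ≥0 := {y | ⌊(y : ℝ) * n⌋₊ = k} with hS
    have hSm : MeasurableSet S := measurable_floor_mul measurable_id n (measurableSet_singleton k)
    have hSτ : (fun ω => ⌊(τ ω : ℝ) * n⌋₊) ⁻¹' {k} = τ ⁻¹' S := rfl
    have h1 : ∫ ω in τ ⁻¹' S, G ((⌊(τ ω : ℝ) * n⌋₊ : ℝ≥0) / n) ω ∂P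
        = ∫ ω in τ ⁻¹' S, G ((k : ℝ≥0) / n) ω ∂P :=
      setIntegral_congr_fun (hτ hSm) fun ω hω => by
        have : ⌊(τ ω : ℝ) * n⌋₊ = k := hω
        simp only [this]
    rw [hSτ, h1, hG]
    simp only
    rw [integral_sub ?_ (integrable_const _), h _ S hSm]
    · simp
    · refine Integrable.integrableOn (Integrable.mono' (integrable_const 1) (hexp _ (hU _))
        (Eventually.of_forall fun ω => ?_))
      rw [norm_exp_mul_I]
  have hlim : Tendsto (fun n : ℕ => ∫ ω, G ((⌊(τ ω : ℝ) * n⌋₊ : ℝ≥0) / n) ω ∂P) atTop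
      (𝓝 (∫ ω, G (τ ω) ω ∂P)) := by
    refine tendsto_integral_of_dominated_convergence (fun _ => 2) (fun n => ?_)
      (integrable_const _) (fun n => Eventually.of_forall fun ω => hGb _ _) ?_
    · have hK := measurable_floor_mul hτ n
      exact (hexp _ (aemeasurable_comp_countable (X := fun k => U ((k : ℝ≥0) / n)) (fun k => hU _)
        hK)).sub (hexp' _ ((measurable_from_top (f := fun k : ℕ => (k : ℝ≥0) / n)).comp hK))
    · filter_upwards [hUc] with ω hω
      have hGc : Continuous fun t => G t ω := by fun_prop
      exact (hGc.tendsto _).comp (tendsto_floor_mul_div (τ ω))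
  simp only [hzero] at hlim
  have h0 := tendsto_nhds_unique tendsto_const_nhds hlim
  have hUτ := aemeasurable_randomTime hU hUc hτ
  rw [hG, integral_sub] at h0
  · exact sub_eq_zero.1 h0.symm
  · exact Integrable.mono' (integrable_const 1) (hexp _ hUτ)
      (Eventually.of_forall fun ω => by rw [norm_exp_mul_I])
  · exact Integrable.mono' (integrable_const 1) (hexp' _ hτ)
      (Eventually.of_forall fun ω => norm_exp_neg_sq_mul_le (hv0 _) _)

/-- The law of a variance mixture of centered Gaussian variables. -/
lemma map_real_eq_integral_gaussianReal [IsProbabilityMeasure P] {X : Ω → ℝ}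
    (hX : AEMeasurable X P) {v : Ω → ℝ} (hv : Measurable v) (hv0 : ∀ ω, 0 ≤ v ω)
    (h : ∀ ξ : ℝ, ∫ ω, Complex.exp (ξ * X ω * Complex.I) ∂P
      = ∫ ω, Complex.exp (-(ξ ^ 2 * v ω / 2)) ∂P) {S : Set ℝ} (hS : MeasurableSet S) :
    (P.map X).real S = ∫ ω, (gaussianReal 0 (v ω).toNNReal).real S ∂P := by
  -- The mixture is realised on a product space as √v times an independent standard normal; equality
  -- of characteristic functions identifies the laws.
  set Z : Ω × ℝ → ℝ := fun p => √(v p.1) * p.2 with hZ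
  have hZm : Measurable Z := by fun_prop
  have hmap : P.map X = (P.prod (gaussianReal 0 1)).map Z := by
    have := Measure.isProbabilityMeasure_map hX
    have := Measure.isProbabilityMeasure_map (μ := P.prod (gaussianReal 0 1)) hZm.aemeasurable
    refine Measure.ext_of_charFun (funext fun ξ => ?_)
    rw [charFun_apply_real, charFun_apply_real,
      integral_map hX (Continuous.aestronglyMeasurable (by fun_prop)),
      integral_map hZm.aemeasurable (Continuous.aestronglyMeasurable (by fun_prop)), h,
      integral_prod]
    · congr 1
      ext ω
      have h1 := charFun_gaussianReal (μ := 0) (v := 1) (ξ * √(v ω))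
      rw [charFun_apply_real] at h1
      have h2 : ∀ y : ℝ, Complex.exp (ξ * Z (ω, y) * Complex.I)
          = Complex.exp ((ξ * √(v ω) : ℝ) * y * Complex.I) := fun y => by
        simp only [hZ]
        push_cast
        ring_nf
      simp only [h2]
      rw [h1]
      congr 1
      have h3 : ((√(v ω) : ℝ) : ℂ) ^ 2 = v ω := by
        rw [← Complex.ofReal_pow, Real.sq_sqrt (hv0 ω)]
      push_cast
      rw [mul_pow, h3]
      ring
    · refine Integrable.mono' (integrable_const 1) ?_
        (Eventually.of_forall fun p => by rw [norm_exp_mul_I])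
      exact Measurable.aestronglyMeasurable (by fun_prop)
  have hsec : ∀ ω, gaussianReal 0 1 (Prod.mk ω ⁻¹' (Z ⁻¹' S))
      = gaussianReal 0 (v ω).toNNReal S := fun ω => by
    have h1 := gaussianReal_map_const_mul (μ := 0) (v := 1) (√(v ω))
    have h2 : (NNReal.mk (√(v ω) ^ 2) (sq_nonneg _) * 1 : ℝ≥0) = (v ω).toNNReal := by
      rw [← NNReal.coe_inj, Real.coe_toNNReal _ (hv0 ω)]
      simp [Real.sq_sqrt (hv0 ω)]
    rw [mul_zero, h2] at h1
    rw [← h1, Measure.map_apply (by fun_prop) hS]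
    rfl
  rw [hmap, measureReal_def, Measure.map_apply hZm hS, Measure.prod_apply (hZm hS)]
  rw [← integral_toReal (measurable_measure_prodMk_left (hZm hS)).aemeasurable
    (Eventually.of_forall fun ω => measure_lt_top _ _)]
  simp only [hsec, measureReal_def]

end RandomTime

/-! ### Densities -/

lemma continuous_gaussianPDFReal (v : ℝ≥0) : Continuous (gaussianPDFReal 0 v) := by
  unfold gaussianPDFReal
  fun_prop

lemma gaussianReal_real_closedBall {v : ℝ≥0} (hv : v ≠ 0) (x : ℝ) {r : ℝ} (hr : 0 ≤ r) :
    (gaussianReal 0 v).real (Metric.closedBall x r)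
      = ∫ y in (x - r)..(x + r), gaussianPDFReal 0 v y := by
  rw [measureReal_def, gaussianReal_apply_eq_integral _ hv, ENNReal.toReal_ofReal
    (integral_nonneg fun y => gaussianPDFReal_nonneg _ _ _), Real.closedBall_eq_Icc,
    integral_Icc_eq_integral_Ioc, intervalIntegral.integral_of_le (by linarith)]

lemma tendsto_gaussianReal_closedBall (v : ℝ≥0) {x : ℝ} (hx : x ≠ 0) :
    Tendsto (fun r => (gaussianReal 0 v).real (Metric.closedBall x r) / (2 * r)) (𝓝[>] 0)
      (𝓝 (gaussianPDFReal 0 v x)) := by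
  -- Zero variance means a point mass at the origin: small balls around x miss it, in agreement with
  -- the value 0 that the density formula takes there.
  rcases eq_or_ne v 0 with rfl | hv
  · refine tendsto_const_nhds.congr' ?_
    filter_upwards [Ioo_mem_nhdsGT (abs_pos.2 hx)] with r hr
    have : (0 : ℝ) ∉ Metric.closedBall x r := by
      simp [Real.dist_eq, hr.2]
    rw [gaussianReal_zero_var, measureReal_def,
      Measure.dirac_apply' _ Metric.isClosed_closedBall.measurableSet]
    simp [this]
  · rw [Metric.tendsto_nhds]
    intro ε hε
    obtain ⟨δ, hδ, h⟩ := Metric.continuousAt_iff.1 ((continuous_gaussianPDFReal v).continuousAt (x := x))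
      (ε / 2) (half_pos hε)
    filter_upwards [Ioo_mem_nhdsGT hδ] with r hr
    have hr0 : 0 < r := hr.1
    have hint := fun a b => (continuous_gaussianPDFReal v).intervalIntegrable (μ := volume) a b
    have h1 : (gaussianReal 0 v).real (Metric.closedBall x r) / (2 * r) - gaussianPDFReal 0 v x
        = (∫ y in (x - r)..(x + r), (gaussianPDFReal 0 v y - gaussianPDFReal 0 v x)) / (2 * r) := by
      rw [gaussianReal_real_closedBall hv x hr0.le, intervalIntegral.integral_sub (hint _ _)
        (by simp), intervalIntegral.integral_const, smul_eq_mul]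
      field_simp
      ring
    rw [Real.dist_eq, h1, abs_div, abs_of_pos (by positivity : 0 < 2 * r),
      div_lt_iff₀ (by positivity)]
    have h2 := intervalIntegral.norm_integral_le_of_norm_le_const (a := x - r) (b := x + r)
      (f := fun y => gaussianPDFReal 0 v y - gaussianPDFReal 0 v x) (C := ε / 2) fun y hy => by
        rw [uIoc_of_le (by linarith)] at hy
        rw [← dist_eq_norm]
        refine (h ?_).le
        rw [Real.dist_eq, abs_lt]
        constructor <;> linarith [hy.1, hy.2, hr.2]
    rw [show x + r - (x - r) = 2 * r by ring, abs_of_pos (by positivity : 0 < 2 * r)] at h2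
    refine h2.trans_lt ?_
    nlinarith

/-- Every point of the ball has modulus at least |x|/2, so the density there is at most the Gaussian
density of the same variance at x/2, bounded over all variances. This dominates the averages when a
mixture is differentiated. -/
lemma exists_gaussianReal_closedBall_le {x : ℝ} (hx : x ≠ 0) :
    ∃ C, ∀ v : ℝ≥0, ∀ r ∈ Ioo 0 (|x| / 2),
      |(gaussianReal 0 v).real (Metric.closedBall x r) / (2 * r)| ≤ C := by
  obtain ⟨C, hC, h⟩ := exists_gaussKernel_le (x := x / 2) (by simpa using hx)
  refine ⟨C, fun v r hr => ?_⟩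
  have hr0 : 0 < r := hr.1
  rw [abs_of_nonneg (by positivity)]
  have hball : ∀ y ∈ Metric.closedBall x r, |x| / 2 ≤ |y| := fun y hy => by
    have h1 : |x - y| ≤ r := by rwa [abs_sub_comm, ← Real.dist_eq]
    have h2 := abs_sub_abs_le_abs_sub x y
    linarith [hr.2]
  rcases eq_or_ne v 0 with rfl | hv
  · have : (0 : ℝ) ∉ Metric.closedBall x r := fun h0 => by
      have := hball 0 h0
      rw [abs_zero] at this
      linarith [abs_pos.2 hx]
    rw [gaussianReal_zero_var, measureReal_def,
      Measure.dirac_apply' _ Metric.isClosed_closedBall.measurableSet]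
    simp [this, hC.le]
  · rw [gaussianReal_real_closedBall hv x hr0.le, div_le_iff₀ (by positivity)]
    have h2 := intervalIntegral.norm_integral_le_of_norm_le_const (a := x - r) (b := x + r)
      (f := fun y => gaussianPDFReal 0 v y) (C := C) fun y hy => by
        rw [uIoc_of_le (by linarith)] at hy
        have hy' : y ∈ Metric.closedBall x r := by
          rw [Real.closedBall_eq_Icc]
          exact ⟨hy.1.le, hy.2⟩
        refine le_trans ?_ (h v v.coe_nonneg)
        rw [← gaussianPDFReal_eq_gaussKernel, Real.norm_of_nonneg (gaussianPDFReal_nonneg _ _ _),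
          abs_of_nonneg (gaussianPDFReal_nonneg _ _ _)]
        unfold gaussianPDFReal
        have h3 : (x / 2) ^ 2 ≤ y ^ 2 := by
          rw [sq_le_sq, abs_div, abs_two]
          exact hball y hy'
        simp only [sub_zero]
        gcongr
    rw [show x + r - (x - r) = 2 * r by ring, abs_of_pos (by positivity : 0 < 2 * r)] at h2
    exact (le_abs_self _).trans h2

/-- The density of a variance mixture of centered Gaussian variables away from the origin. -/
lemma densityAt_gaussian_mixture {Ω : Type*} [MeasurableSpace Ω] {P : Measure Ω}
    [IsProbabilityMeasure P] {μ : Measure ℝ} {v : Ω → ℝ} (hv : Measurable v) (hv0 : ∀ ω, 0 ≤ v ω)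
    (hμ : ∀ S, MeasurableSet S → μ.real S = ∫ ω, (gaussianReal 0 (v ω).toNNReal).real S ∂P)
    {x : ℝ} (hx : x ≠ 0) : densityAt μ x = ∫ ω, gaussKernel x (v ω) ∂P := by
  obtain ⟨C, hC⟩ := exists_gaussianReal_closedBall_le hx
  refine Tendsto.limUnder_eq ?_
  have h1 : ∀ r : ℝ, μ.real (Metric.closedBall x r) / (2 * r)
      = ∫ ω, (gaussianReal 0 (v ω).toNNReal).real (Metric.closedBall x r) / (2 * r) ∂P := fun r => by
    rw [hμ _ Metric.isClosed_closedBall.measurableSet, integral_div]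
  simp only [h1]
  have h2 : ∀ ω, gaussKernel x (v ω) = gaussianPDFReal 0 (v ω).toNNReal x := fun ω => by
    rw [gaussianPDFReal_eq_gaussKernel, Real.coe_toNNReal _ (hv0 ω)]
  simp only [h2]
  refine tendsto_integral_filter_of_dominated_convergence (fun _ => C) ?_ ?_ (integrable_const _)
    (Eventually.of_forall fun ω => tendsto_gaussianReal_closedBall _ hx)
  · refine Eventually.of_forall fun r => Measurable.aestronglyMeasurable ?_
    have hm : Measurable fun ω => gaussianReal 0 (v ω).toNNReal (Metric.closedBall x r) :=
      (Measure.measurable_coe Metric.isClosed_closedBall.measurableSet).comp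
        (measurable_gaussianReal.comp (measurable_const.prodMk hv.real_toNNReal))
    exact hm.ennreal_toReal.div_const _
  · filter_upwards [Ioo_mem_nhdsGT (half_pos (abs_pos.2 hx))] with r hr
    exact Eventually.of_forall fun ω => hC _ r hr

/-! ### The time-changed process -/

section TimeChange

variable {Ω : Type*} [MeasurableSpace Ω] {P : Measure Ω} {H θ : ℝ}
  {B : ℝ≥0 → Ω → ℝ} {ν : Measure ℝ} {σ : ℝ≥0 → Ω → ℝ}

lemma processDensity_fOU [IsProbabilityMeasure P] (hB : IsFractionalBrownianMotion H B P) (hθ : 0 < θ) (hH : 1 / 2 < H)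
    {t x : ℝ} (ht : 0 ≤ t) (hx : x ≠ 0) :
    processDensity P (fOU θ B) t x = fouDensity (1 / θ) (2 * H) x t := by
  have h1 := map_fOU hB hθ hH t.toNNReal
  rw [Real.coe_toNNReal _ ht] at h1
  rw [processDensity, h1, densityAt_gaussian_mixture (P := P)
    (v := fun _ => fouVar (1 / θ) (2 * H) t) measurable_const
    (fun _ => fouVar_nonneg (by linarith) ht) (fun S _ => by simp) hx]
  simp [fouDensity]

lemma measurable_firstPassage_time (hσ : IsSubordinator ν σ P) (t : ℝ) :
    Measurable fun ω => (firstPassage (fun y => σ y ω) t).toNNReal :=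
  hσ.measurable_firstPassage_toNNReal.comp measurable_prodMk_left

/-- By independence the law of U(E(t)) is a Gaussian mixture with variance V(E(t)); its density away
from 0 is the corresponding mixture of densities. -/
lemma processDensity_timeChange [IsProbabilityMeasure P] (hB : IsFractionalBrownianMotion H B P) (hθ : 0 < θ)
    (hH : 1 / 2 < H) (hσ : IsSubordinator ν σ P)
    (hindep : IndepFun (fun ω t => B t ω) (fun ω y => σ y ω) P) {t x : ℝ} (ht : 0 ≤ t)
    (hx : x ≠ 0) :
    processDensity P (timeChange (fOU θ B) (inverseSubordinator σ)) t x
      = ∫ ω, fouDensity (1 / θ) (2 * H) x (firstPassage (fun y => σ y ω) t).toNNReal ∂P := by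
  set τ : Ω → ℝ≥0 := fun ω => (firstPassage (fun y => σ y ω) t).toNNReal with hτdef
  have hτ : Measurable τ := measurable_firstPassage_time hσ t
  have hh : 1 < 2 * H := by linarith
  have hcont : Continuous fun s : ℝ≥0 => fouVar (1 / θ) (2 * H) s :=
    (continuous_fouVar (by linarith)).comp NNReal.continuous_coe
  have hU := aemeasurable_fOU (θ := θ) hB (by linarith)
  have hUc := continuous_fOU (θ := θ) hB
  have hpath : Measurable fun ω y => σ y ω := measurable_pi_lambda _ hσ.measurable
  have hae : timeChange (fOU θ B) (inverseSubordinator σ) t.toNNReal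
      =ᵐ[P] fun ω => fOU θ B (τ ω) ω := by
    filter_upwards [hσ.ae_inverseSubordinator] with ω hω
    rw [timeChange, hω, Real.coe_toNNReal _ ht]
  have hchar := fun ξ : ℝ => integral_exp_randomTime hU hUc hτ hcont
    (fun s => fouVar_nonneg hh s.coe_nonneg) ξ fun s S hS => by
      -- The condition on the random time is a measurable condition on the whole subordinator path,
      -- which is the variable known to be independent of B.
      have hS' : MeasurableSet {f : ℝ≥0 → ℝ | (firstPassage f t).toNNReal ∈ S} :=
        (measurable_firstPassage.comp measurable_prodMk_right).ennreal_toNNReal hS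
      exact setIntegral_exp_fOU hB hθ (by linarith) hpath.aemeasurable hindep hS' s ξ
  rw [processDensity, Measure.map_congr hae, densityAt_gaussian_mixture (hcont.measurable.comp hτ)
    (fun ω => fouVar_nonneg hh (τ ω).coe_nonneg)
    (fun S hS => map_real_eq_integral_gaussianReal (aemeasurable_randomTime hU hUc hτ)
      (hcont.measurable.comp hτ) (fun ω => fouVar_nonneg hh (τ ω).coe_nonneg) hchar hS) hx]
  rfl

variable {a h x : ℝ}

lemma measurable_fouDensity_firstPassage (hh : 1 < h) (hσ : IsSubordinator ν σ P) :
    Measurable fun p : ℝ × Ω =>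
      fouDensity a h x (firstPassage (fun y => σ y p.2) p.1).toNNReal :=
  (measurable_fouDensity (by linarith)).comp
    (measurable_coe_nnreal_real.comp hσ.measurable_firstPassage_toNNReal)

lemma laplaceIntegrable_integral_fouDensity [IsProbabilityMeasure P] (hx : x ≠ 0) (hh : 1 < h)
    (hσ : IsSubordinator ν σ P) {c : ℝ} (hc : 0 < c) : LaplaceIntegrable
      (fun t => ∫ ω, fouDensity a h x (firstPassage (fun y => σ y ω) t).toNNReal ∂P) c := by
  obtain ⟨C, hC, hb⟩ := exists_fouDensity_le (a := a) hx hh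
  refine .of_bounded (C := C) hc ?_ fun t _ => ?_
  · exact (measurable_fouDensity_firstPassage hh hσ).stronglyMeasurable.integral_prod_right'
      |>.aestronglyMeasurable
  · have := norm_integral_le_of_norm_le_const (μ := P)
      (f := fun ω => fouDensity a h x (firstPassage (fun y => σ y ω) t).toNNReal) (C := C)
      (Eventually.of_forall fun ω => hb _ (NNReal.coe_nonneg _))
    simpa using this

/-- The Laplace transform in time of the density of the time-changed process. -/
lemma laplaceTransform_integral_fouDensity [IsProbabilityMeasure P] (ha : 0 < a) (hx : x ≠ 0) (hh : 1 < h)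
    (hν : IsSubordinatorLevyMeasure ν) (hν0 : ν (Ioi 0) ≠ 0) (hσ : IsSubordinator ν σ P) {l : ℂ}
    (hl : l ∈ rightHalfPlane) :
    laplaceTransform
      (fun t => ∫ ω, fouDensity a h x (firstPassage (fun y => σ y ω) t).toNNReal ∂P) l
      = laplaceExponent ν l / l * laplaceTransform (fouDensity a h x) (laplaceExponent ν l) := by
  have hl0 : 0 < l.re := hl
  have hΨ := hν.re_laplaceExponent_pos hν0 hl
  have hf' := integrableOn_fouDensityDeriv ha hx hh
  set τ : ℝ → Ω → ℝ≥0 := fun t ω => (firstPassage (fun y => σ y ω) t).toNNReal with hτdef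
  have hτm : Measurable fun p : ℝ × Ω => τ p.1 p.2 := hσ.measurable_firstPassage_toNNReal
  -- The integrand e^(-lt) f'(s) 1{s < E(t)} on (t, (ω, s)). Integrating over (ω, s) first recovers
  -- the expected density at time t; integrating over t first yields e^(-lσ(s))/l.
  set g : ℝ → Ω × ℝ → ℂ := fun t q => (fouDensityDeriv a h x q.2 : ℂ) *
    {t : ℝ | q.2 < τ t q.1}.indicator (fun t => Complex.exp (-(l * t))) t with hg
  have hset : MeasurableSet {p : ℝ × Ω × ℝ | p.2.2 < τ p.1 p.2.1} :=
    measurableSet_lt (by fun_prop)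
      (measurable_coe_nnreal_real.comp
        (hτm.comp (measurable_fst.prodMk (measurable_fst.comp measurable_snd))))
  have hg' : ∀ p : ℝ × Ω × ℝ, Function.uncurry g p = {p : ℝ × Ω × ℝ | p.2.2 < τ p.1 p.2.1}.indicator
      (fun p => Complex.exp (-(l * p.1)) * (fouDensityDeriv a h x p.2.2 : ℂ)) p := fun p => by
    simp only [Function.uncurry, hg, indicator, mem_ofPred_eq]
    split_ifs <;> ring
  have hexp : IntegrableOn (fun t : ℝ => Complex.exp (-(l * t))) (Ioi 0) := by
    have := integrableOn_exp_mul_complex_Ioi (a := -l) (by simpa using hl0) 0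
    simpa using this
  have hgi : Integrable (Function.uncurry g)
      ((volume.restrict (Ioi 0)).prod (P.prod (volume.restrict (Ioi 0)))) := by
    have h1 : Integrable (fun q : Ω × ℝ => (fouDensityDeriv a h x q.2 : ℂ))
        (P.prod (volume.restrict (Ioi 0))) := by
      have h0 : Integrable (fun s => (fouDensityDeriv a h x s : ℂ)) (volume.restrict (Ioi 0)) :=
        hf'.ofReal
      exact h0.comp_snd P
    exact ((Integrable.mul_prod hexp h1).indicator hset).congr
      (Eventually.of_forall fun p => (hg' p).symm)
  have hgt : ∀ t, ∫ q, g t q ∂(P.prod (volume.restrict (Ioi 0)))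
      = laplaceIntegrand (fun t => ∫ ω, fouDensity a h x (τ t ω) ∂P) l t := by
    intro t
    have h1 : ∀ q : Ω × ℝ, g t q = Complex.exp (-(l * t)) *
        ((Iio ((τ t q.1 : ℝ≥0) : ℝ)).indicator (fouDensityDeriv a h x) q.2 : ℝ) := fun q => by
      simp only [hg, indicator, mem_ofPred_eq, mem_Iio]
      split_ifs <;> simp [mul_comm]
    have hm : MeasurableSet {q : Ω × ℝ | q.2 < τ t q.1} :=
      measurableSet_lt measurable_snd (measurable_coe_nnreal_real.comp
        (hτm.comp (measurable_const.prodMk measurable_fst)))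
    have hi : Integrable (fun q : Ω × ℝ =>
        (Iio ((τ t q.1 : ℝ≥0) : ℝ)).indicator (fouDensityDeriv a h x) q.2)
        (P.prod (volume.restrict (Ioi 0))) := by
      refine ((Integrable.comp_snd hf' P).indicator hm).congr (Eventually.of_forall fun q => ?_)
      simp [indicator]
    simp only [h1]
    rw [integral_const_mul, integral_complex_ofReal, integral_prod _ hi, laplaceIntegrand]
    congr 3
    ext ω
    change ∫ y in Ioi (0 : ℝ), (Iio ((τ t ω : ℝ≥0) : ℝ)).indicator (fouDensityDeriv a h x) y = _
    rw [fouDensity_eq_integral ha hx hh (NNReal.coe_nonneg _),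
      intervalIntegral.integral_of_le (NNReal.coe_nonneg _), integral_indicator measurableSet_Iio,
      Measure.restrict_restrict measurableSet_Iio, inter_comm, Ioi_inter_Iio,
      integral_Ioc_eq_integral_Ioo]
  -- Fubini holds since g is dominated by |e^(-lt)| |f'(s)|, a product of integrable functions.
  have hswap := integral_integral_swap hgi
  simp only [hgt] at hswap
  have hpr : Integrable (fun q => ∫ t in Ioi (0 : ℝ), g t q)
      (P.prod (volume.restrict (Ioi 0))) := hgi.integral_prod_right
  rw [laplaceTransform, hswap, integral_prod_symm _ hpr]
  have hL := laplaceTransform_deriv (l := laplaceExponent ν l)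
    (fun t ht => hasDerivAt_fouDensity (a := a) hh ht)
    (tendsto_fouDensity_zero hx hh) (laplaceIntegrable_fouDensity hx hh hΨ)
    (laplaceIntegrable_fouDensityDeriv ha hx hh (by linarith [show 0 < (laplaceExponent ν l).re from hΨ]))
  -- The factor Ψ(l) is absorbed as a derivative, so that both sides are integrals of f'(s)
  -- e^(-sΨ(l))/l over s.
  rw [div_mul_eq_mul_div, ← hL, laplaceTransform, ← integral_div]
  refine setIntegral_congr_fun measurableSet_Ioi fun s hs => ?_
  have hs : 0 < s := hs
  have h2 : ∫ ω, (∫ t in Ioi (0 : ℝ), g t (ω, s)) ∂P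
      = ∫ ω, fouDensityDeriv a h x s / l * Complex.exp (-(l * σ s.toNNReal ω)) ∂P := by
    refine integral_congr_ae ?_
    filter_upwards [hσ.integral_exp_mul_indicator_firstPassage hν hν0 hl] with ω hω
    have h3 := hω s.toNNReal (by simpa using hs)
    have h4 : ∀ t, s.toNNReal < τ t ω ↔ s < τ t ω := fun t => by
      rw [← NNReal.coe_lt_coe, Real.coe_toNNReal _ hs.le]
    simp only [hg]
    rw [integral_const_mul]
    simp only [← h4]
    rw [h3]
    ring
  rw [h2, integral_const_mul, hσ.integral_exp_neg_mul hν _ hl, laplaceIntegrand,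
    Real.coe_toNNReal _ hs.le, mul_comm (s : ℂ)]
  ring

end TimeChange

end TimeChangedFOU

/-! ### Assembly of the theorem -/

open TimeChangedFOU in
theorem mainTheorem11 {Ω : Type*} [MeasurableSpace Ω] (P : Measure Ω) [IsProbabilityMeasure P]
    (H θ : ℝ) (hH : 1 / 2 < H) (hH' : H < 1) (hθ : 0 < θ)
    (B : ℝ≥0 → Ω → ℝ) (hB : IsFractionalBrownianMotion H B P)
    (ν : Measure ℝ) (hν : IsSubordinatorLevyMeasure ν) (hν_top : ν (Ioi 0) = ∞)
    (σ : ℝ≥0 → Ω → ℝ) (hσ : IsSubordinator ν σ P)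
    (hindep : IndepFun (fun ω t => B t ω) (fun ω y => σ y ω) P)
    (c₁ c₂ : ℝ) (hc₁ : c₁ < 0) (hc₂ : 0 < c₂) (hc : -(1 / θ) < c₁ - c₂)
    (U : ℝ≥0 → Ω → ℝ) (hU : U = fOU θ B)
    (V : ℝ → ℝ) (hV : V = varianceFun P U)
    (Ψ : ℂ → ℂ) (hΨ : Ψ = laplaceExponent ν)
    (p : ℝ → ℝ → ℝ) (hp : p = processDensity P U)
    (pΨ : ℝ → ℝ → ℝ) (hpΨ : pΨ = processDensity P (timeChange U (inverseSubordinator σ)))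
    (pbar : ℂ → ℝ → ℂ) (hpbar : pbar = fun l x => laplaceTransform (fun t => pΨ t x) l) :
    (∀ x : ℝ, x ≠ 0 → ∀ l ∈ rightHalfPlane,
      IntegrableOn (laplaceIntegrand (fun t => pΨ t x) l) (Ioi 0)) ∧
    MemDomainHatL V Ψ c₁ c₂ pbar {x | x ≠ 0} ∧
    ∀ x : ℝ, x ≠ 0 → ∀ l ∈ rightHalfPlane,
      OpLDefinedAt V p (Ψ l) x ∧ opHatL V Ψ c₁ c₂ pbar l x = opL V p (Ψ l) x := by
  subst hU hV hΨ hp hpΨ hpbar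
  have ha : 0 < 1 / θ := by positivity
  have hh : 1 < 2 * H := by linarith
  have hν0 : ν (Ioi 0) ≠ 0 := by simp [hν_top]
  set f : ℝ → ℝ → ℝ := fouDensity (1 / θ) (2 * H) with hf
  have hpΨ : ∀ x : ℝ, x ≠ 0 → ∀ t ∈ Ioi (0 : ℝ),
      processDensity P (timeChange (fOU θ B) (inverseSubordinator σ)) t x
      = ∫ ω, f x (firstPassage (fun y => σ y ω) t).toNNReal ∂P := fun x hx t ht =>
    processDensity_timeChange hB hθ hH hσ hindep (le_of_lt ht) hx
  have hVd : ∀ t ∈ Ioi (0 : ℝ),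
      deriv (varianceFun P (fOU θ B)) t = fouVarDeriv (1 / θ) (2 * H) t := by
    intro t ht
    have : varianceFun P (fOU θ B) =ᶠ[𝓝 t] fouVar (1 / θ) (2 * H) := by
      filter_upwards [Ioi_mem_nhds ht] with s hs
      exact varianceFun_fOU hB hθ hH (le_of_lt hs)
    rw [this.deriv_eq, (hasDerivAt_fouVar (by linarith) ht).deriv]
  have hpbar : ∀ x : ℝ, x ≠ 0 → ∀ l ∈ rightHalfPlane, laplaceTransform
      (fun t => processDensity P (timeChange (fOU θ B) (inverseSubordinator σ)) t x) l
      = laplaceExponent ν l / l * laplaceTransform (f x) (laplaceExponent ν l) := by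
    intro x hx l hl
    rw [laplaceTransform_congr (hpΨ x hx), laplaceTransform_integral_fouDensity ha hx hh hν hν0 hσ
      hl]
  have htrans : ∀ x : ℝ, x ≠ 0 → IsInverseTransport (laplaceExponent ν) (fun ζ => laplaceTransform
      (fun t => processDensity P (timeChange (fOU θ B) (inverseSubordinator σ)) t x) ζ)
      (laplaceTransform (f x)) := by
    intro x hx
    refine ⟨differentiableOn_laplaceTransform fun c hc => laplaceIntegrable_fouDensity hx hh hc,
      fun ξ hξ g hg => ?_⟩
    have hgξ : laplaceExponent ν (g ξ) = ξ := hg.2.2.self_of_nhds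
    have hg0 : g ξ ≠ 0 := fun h0 => by
      have := hg.2.1
      rw [h0] at this
      simp [rightHalfPlane] at this
    have hξ0 : ξ ≠ 0 := fun h0 => by
      rw [h0] at hξ
      simp [rightHalfPlane] at hξ
    beta_reduce
    -- At l = g(ξ) the factor Ψ(l)/l equals ξ/g(ξ) and cancels g(ξ)/ξ, whichever local inverse is
    -- taken.
    rw [hpbar x hx _ hg.2.1, hgξ]
    field_simp
  have hmain : ∀ x : ℝ, x ≠ 0 → ∀ l ∈ rightHalfPlane,
      LaplaceIntegrable (fun t => fouVarDeriv (1 / θ) (2 * H) t * f x t) (laplaceExponent ν l).re ∧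
      HatLWellDefined (varianceFun P (fOU θ B)) (laplaceExponent ν) c₁ c₂
        (inverseTransport (laplaceExponent ν) fun ζ => laplaceTransform (fun t =>
          processDensity P (timeChange (fOU θ B) (inverseSubordinator σ)) t x) ζ) l ∧
      opHatL (varianceFun P (fOU θ B)) (laplaceExponent ν) c₁ c₂ (fun l x => laplaceTransform
        (fun t => processDensity P (timeChange (fOU θ B) (inverseSubordinator σ)) t x) l) l x
        = laplaceTransform (fun t => fouVarDeriv (1 / θ) (2 * H) t * f x t)
          (laplaceExponent ν l) := by
    intro x hx l hl
    have hΨl : 0 < (laplaceExponent ν l).re := hν.re_laplaceExponent_pos hν0 hl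
    obtain ⟨C, hC, hb⟩ := exists_fouDensity_le (a := 1 / θ) hx hh
    have hDf : LaplaceIntegrable (fun t => fouVarDeriv (1 / θ) (2 * H) t * f x t)
        (laplaceExponent ν l).re := by
      have := (laplaceIntegrable_fouVarDeriv ha hh (c := (laplaceExponent ν l).re)
        (by linarith)).bdd_mul (f := f x) (measurable_fouDensity (by linarith)).aestronglyMeasurable
        fun t ht => hb t (le_of_lt ht)
      simpa only [mul_comm] using this
    have hex : ∃ w, IsInverseTransport (laplaceExponent ν) (fun ζ => laplaceTransform
        (fun t => processDensity P (timeChange (fOU θ B) (inverseSubordinator σ)) t x) ζ) w :=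
      ⟨_, htrans x hx⟩
    have h1 : (1 : ℂ) ∈ rightHalfPlane := by simp [rightHalfPlane]
    have hw : ∀ z : ℝ, inverseTransport (laplaceExponent ν) (fun ζ => laplaceTransform (fun t =>
        processDensity P (timeChange (fOU θ B) (inverseSubordinator σ)) t x) ζ)
        (c₂ + Complex.I * z) = laplaceTransform (f x) (c₂ + Complex.I * z) := fun z => by
      rw [inverseTransport, dif_pos hex]
      -- The function selected by choice in `inverseTransport` is the Laplace transform of the
      -- density on the line Re ξ = c₂, by uniqueness anchored at the noncritical point 1.
      refine IsInverseTransport.eqOn h1 (hν.re_laplaceExponent_pos hν0 h1)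
        (hν.differentiableOn_laplaceExponent.analyticAt (isOpen_rightHalfPlane.mem_nhds h1))
        (hν.deriv_laplaceExponent_one_ne_zero hν0) hex.choose_spec (htrans x hx) ?_
      simpa [rightHalfPlane] using hc₂
    refine ⟨hDf, hatLWellDefined_and_integral_eq hVd hw
      (continuous_laplaceTransform_vertical (laplaceIntegrable_fouVarDeriv ha hh
        -- The midpoint of -1/θ and c₁ - c₂ lies strictly between them by the choice of c₁ and c₂.
        (c := (c₁ - c₂ - 1 / θ) / 2) (by linarith)) (by linarith))
      (integrable_laplaceTransform_fouVarDeriv ha hh hc) (laplaceIntegrable_fouVarDeriv ha hh hc)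
      (continuous_laplaceTransform_vertical (laplaceIntegrable_fouDensity hx hh (half_pos hc₂))
        (half_lt_self hc₂)) (integrable_laplaceTransform_fouDensity ha hx hh hc₂)
      (laplaceIntegrable_fouDensity hx hh hc₂)
      (fun t _ => (continuous_fouVarDeriv hh).continuousAt)
      (fun t ht => (hasDerivAt_fouDensity hh ht).continuousAt) hDf⟩
  have hDp : ∀ x : ℝ, x ≠ 0 → ∀ t ∈ Ioi (0 : ℝ), deriv (varianceFun P (fOU θ B)) t
      * processDensity P (fOU θ B) t x = fouVarDeriv (1 / θ) (2 * H) t * f x t := fun x hx t ht => by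
    rw [hVd t ht, processDensity_fOU hB hθ hH (le_of_lt ht) hx]
  refine ⟨fun x hx l hl => ?_, fun x hx => ⟨⟨_, htrans x hx⟩, fun l hl => (hmain x hx l hl).2.1⟩,
    fun x hx l hl => ⟨?_, ?_⟩⟩
  · refine (integrableOn_congr_fun (fun t ht => ?_) measurableSet_Ioi).1
      (laplaceIntegrable_integral_fouDensity (a := 1 / θ) hx hh hσ hl).integrableOn
    simp only [laplaceIntegrand, hpΨ x hx t ht, hf]
  · refine (integrableOn_congr_fun (fun t ht => ?_) measurableSet_Ioi).1
      (hmain x hx l hl).1.integrableOn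
    simp only [laplaceIntegrand, hDp x hx t ht]
  · rw [(hmain x hx l hl).2.2, opL, laplaceTransform_congr (hDp x hx)]
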